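/- **Setting.** For $d\ge 1$ let $\|\cdot\|$ be the Euclidean norm on $\mathbb{R}^d$ and, for $q\ge 1$, let $\mathcal{P}_q(\mathbb{R}^d)$ be the set of Borel probability measures $\mu$ on $\mathbb{R}^d$ with $M_q(\mu)=\int\|x\|^q\,d\mu(x)<\infty$. Let $u_d$ be the uniform distribution on the unit sphere $\mathbb{S}^{d-1}$; for $\mathbf{u}\in\mathbb{S}^{d-1}$ let $\mathcal{R}_{\mathbf{u}}\mu$ be the image of $\mu$ under $s\mapsto\langle \mathbf{u},s\rangle$; for $\sigma\ge 0$ let $\mathcal{N}_\sigma$ be the centred Gaussian law on $\mathbb{R}$ with standard deviation $\sigma$ ($\mathcal N_0=\delta_0$), and $M_q(\mathcal{N}_\sigma)=\int|t|^q\,d\mathcal{N}_\sigma(t)$. For $p\ge 1$ let $W_p^p(\alpha,\beta)=\inf_{\gamma}\int|x-y|^p\,d\gamma(x,y)$, the infimum over all couplings $\gamma$ of $\alpha$ and $\beta$, and $$G_\sigma\mathrm{SWD}^p(\mu,\nu)=\int_{\mathbb{S}^{d-1}}W_p^p\big(\mathcal{R}_{\mathbf{u}}\mu*\mathcal{N}_\sigma,\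 \mathcal{R}_{\mathbf{u}}\nu*\mathcal{N}_\sigma\big)\,du_d(\mathbf{u}).$$ **Proposition.** Let $p,q\in[1,\infty)$ with $p<q$. There is a constant $C_{p,q}>0$, depending only on $p$ and $q$, such that the following holds for all $d\ge1$, all $\sigma\ge0$, all $\mu,\nu\in\mathcal{P}_q(\mathbb{R}^d)$ and all $n\ge 1$ (with $n\ge 2$ if $q=2p$). Let $X_1,\dots,X_n$ be i.i.d. with law $\mu$ and $Y_1,\dots,Y_n$ i.i.d. with law $\nu$, defined on one probability space, and let $\hat\mu_n=\frac1n\sum_i\delta_{X_i}$, $\hat\nu_n=\frac1n\sum_i\delta_{Y_i}$. Then $G_\sigma\mathrm{SWD}^p(\mu,\nu)$ and $G_\sigma\mathrm{SWD}^p(\hat\mu_n,\hat\nu_n)$ are finite, the latter is integrable, and $$\mathbf{E}\big|G_\sigma\mathrm{SWD}^p(\hat\mu_n,\hat\nu_n)-G_\sigma\mathrm{SWD}^p(\mu,\nu)\big|\le\alpha_n(p,q,\sigma),$$ where, with $M_q(\mu,\nu)=M_q(\mu)+M_q(\nu)$, $$\alpha_n(p,q,\sigma)=2C_{p,q}\,A\,r_n,$$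 $$A=\begin{cases}2^{p(q-1)/q}\,M_q(\mu,\nu)^{p/q}&\text{if } q \text{ is an odd integer},\\ 2^{p(q-1)/q}\,\big(M_q(\mu,\nu)+M_q(\mathcal{N}_\sigma)\big)^{p/q}&\text{otherwise},\end{cases}$$ $$r_n=\begin{cases}n^{-1/2}&\text{if } q>2p,\\ n^{-1/2}\log n&\text{if } q=2p,\\ n^{-(q-p)/q}&\text{if } p<q<2p.\end{cases}$$ If $q=2k$ is an even integer, then $M_q(\mathcal{N}_\sigma)=\dfrac{(2k)!}{2^k\,k!}\,\sigma^{2k}$. In particular the rate does not depend on the dimension $d$. -/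

import Mathlib

open MeasureTheory ProbabilityTheory
open scoped ENNReal NNReal

noncomputable section

/-- The couplings of two measures: measures on the product with the two given marginals. -/
def couplings {E : Type*} [MeasurableSpace E] (μ ν : Measure E) : Set (Measure (E × E)) :=
  {γ | γ.map Prod.fst = μ ∧ γ.map Prod.snd = ν}

/-- The `p`-th power `W_p^p(μ, ν)` of the Wasserstein distance of order `p`. -/
def wassersteinPow {E : Type*} [NormedAddCommGroup E] [MeasurableSpace E]
    (p : ℝ) (μ ν : Measure E) : ℝ≥0∞ :=
  ⨅ γ ∈ couplings μ ν, ∫⁻ z, ‖z.1 - z.2‖ₑ ^ p ∂γ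

/-- The unit sphere `𝕊^{d-1}` of `ℝ^d`. -/
abbrev UnitSphere (d : ℕ) : Type := Metric.sphere (0 : EuclideanSpace ℝ (Fin d)) 1

/-- The uniform distribution on `𝕊^{d-1}`: the normalized surface measure. -/
def sphereUniform (d : ℕ) : Measure (UnitSphere d) :=
  ((volume : Measure (EuclideanSpace ℝ (Fin d))).toSphere Set.univ)⁻¹ •
    (volume : Measure (EuclideanSpace ℝ (Fin d))).toSphere

/-- The Radon projection of `μ` in the direction `u`: the law of `⟨u, X⟩` for `X ∼ μ`. -/
def radonProj {d : ℕ} (u : UnitSphere d) (μ : Measure (EuclideanSpace ℝ (Fin d))) : Measure ℝ :=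
  μ.map (fun s => inner ℝ (u : EuclideanSpace ℝ (Fin d)) s)

/-- The centred Gaussian law on `ℝ` with standard deviation `σ`. -/
def gaussianNoise (σ : ℝ) : Measure ℝ := gaussianReal 0 (Real.toNNReal (σ ^ 2))

/-- The (`p`-th power of the) Gaussian smoothed sliced Wasserstein distance: the average over
uniform directions `u` of `W_p^p` between the projected measures convolved with the noise. -/
def gswdPow {d : ℕ} (σ p : ℝ) (μ ν : Measure (EuclideanSpace ℝ (Fin d))) : ℝ≥0∞ :=
  ∫⁻ u, wassersteinPow p ((radonProj u μ).conv (gaussianNoise σ))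
    ((radonProj u ν).conv (gaussianNoise σ)) ∂(sphereUniform d)

/-- The empirical measure of the points `x₁, …, xₙ`. -/
def empiricalMeasure {E : Type*} [MeasurableSpace E] {n : ℕ} (x : Fin n → E) : Measure E :=
  (n : ℝ≥0∞)⁻¹ • ∑ i, Measure.dirac (x i)

/-- The `q`-th moment `M_q(μ) = ∫ ‖x‖^q dμ(x)`. -/
def absMoment {E : Type*} [NormedAddCommGroup E] [MeasurableSpace E]
    (q : ℝ) (μ : Measure E) : ℝ :=
  ∫ x, ‖x‖ ^ q ∂μ

open Classical in
/-- The moment factor of the bound; `m` is `M_q(μ) + M_q(ν)`. -/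
def momentFactor (p q σ m : ℝ) : ℝ :=
  if ∃ k : ℕ, q = 2 * (k : ℝ) + 1 then
    (2 : ℝ) ^ (p * (q - 1) / q) * m ^ (p / q)
  else
    (2 : ℝ) ^ (p * (q - 1) / q) * (m + absMoment q (gaussianNoise σ)) ^ (p / q)

/-- The rate in the number `n` of samples (used only for `p < q`). -/
def sampleRate (p q : ℝ) (n : ℕ) : ℝ :=
  if 2 * p < q then (n : ℝ) ^ (-(1 / 2) : ℝ)
  else if q = 2 * p then (n : ℝ) ^ (-(1 / 2) : ℝ) * Real.log n
  else (n : ℝ) ^ (-((q - p) / q))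

end

/-!
On the line, `W_p^p` is an integral over gaps. Let `κ` be the measure on `[0, ∞)` with
`κ [0, r] = p * r ^ (p - 1)` for `r > 0`, so that `∫ (t - h)⁺ κ(dh) = t ^ p` for `t ≥ 0`. Writing
`(t - h)⁺` as the length of an interval, and comparing an arbitrary coupling with the quantile
coupling, one gets for distribution functions `F`, `G`
`W_p^p = ∫ κ(dh) ∫ dx ((F (x - h/2) - G (x + h/2))⁺ + (G (x - h/2) - F (x + h/2))⁺)`
(`wassersteinPow_eq_gapCost`). Convolving the measures with the noise convolves `F` and `G` with
it. So the theorem reduces, direction by direction and with a bound uniform in the direction, to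
the mean error that the empirical distribution functions cause in the positive part of a smoothed
gap. Since one-dimensional projections do not increase moments, the dimension never enters.

The only inputs on the sample are the bound `min (2 * t) (√(t / n))` for the mean error of an
empirical frequency of probability `t` (`CdfSample`), and the Markov tails `(m / x) ^ q` of the
projections, where `m ^ q` dominates the moments (`TailBound`). Without noise they give the error
`r ^ (p - 1) * min (2 * (m / r) ^ q) (√((m / r) ^ q / n))` at the scale `r`, and its integral is of
order `m ^ p` times the stated rate (`exists_lintegral_errTail_le`).

The noise must not spoil this: a bound through the moments of the smoothed measures would contain
those of the Gaussian law, which the statement does not allow for odd `q`. For `h` much larger than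
`m` the difference `F (x - h/2) - G (x + h/2)` is of the form `t - k`, where `t` is small
everywhere and `k ≥ 1 / 2` near the origin (`farTail`); from here on `t` and `k` stand for the
smoothed functions. The error of `t` and the errors of `k` outside `[-h, h]` are harmless. An error
`s` of `k` in `[-h, h]` changes `(t - k)⁺` by at most `min t |s|`, and by at most `t * |s| / k`
(`CdfSample.exists_error_bound`). If the noise is narrower than `h`, then the Cauchy–Schwarz
inequality turns these three bounds into `√(t / n)` (`lintegral_le_of_noise_le_gap`). If it is
wider, then `s / k` is at most `n ^ (-1 / 2)` times a ratio of masses of Gaussian windows, which is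
under control except far out, where `s` itself is tiny (`exists_lintegral_le_of_gap_le_noise`). The
result is `exists_lintegral_gap_le`, with a constant independent of `σ` and with no moment of the
noise. The moment factor of the theorem dominates `M ^ (p / q)` for `M` the sum of the moments, in
both cases of its definition.
-/

section

open Set Filter Topology

universe u

/-! ### The gap kernel -/

/-- `κ` is the measure on `[0, ∞)` with `κ [0, r] = p * r ^ (p - 1)` for `r > 0`, that is the
second derivative of `t ↦ (t⁺) ^ p`. For `p = 1` it is the Dirac mass at `0`. Points of the
half-line are thought of as gaps between two transported points. -/
structure IsGapKernel (p : ℝ) (κ : Measure ℝ) : Prop where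
  Iio_zero : κ (Iio 0) = 0
  Iic_of_pos : ∀ r : ℝ, 0 < r → κ (Iic r) = ENNReal.ofReal (p * r ^ (p - 1))

theorem exists_isGapKernel {p : ℝ} (hp : 1 ≤ p) : ∃ κ : Measure ℝ, SFinite κ ∧ IsGapKernel p κ := by
  let f : StieltjesFunction ℝ :=
    { toFun := fun r => if r < 0 then 0 else p * r ^ (p - 1)
      mono' := by
        intro a b hab
        dsimp only
        split_ifs with h1 h2 h2
        · exact le_rfl
        · exact mul_nonneg (by linarith) (Real.rpow_nonneg (not_lt.1 h2) _)
        · linarith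
        · have := Real.rpow_le_rpow (not_lt.1 h1) hab (by linarith : 0 ≤ p - 1)
          gcongr
      right_continuous' := by
        intro x
        by_cases hx : x < 0
        · apply ContinuousAt.continuousWithinAt
          apply (continuousAt_const (y := (0 : ℝ))).congr
          filter_upwards [Iio_mem_nhds hx] with y hy
          simp [mem_Iio.1 hy]
        · have hx' := not_lt.1 hx
          have h2 : ContinuousWithinAt (fun r : ℝ => p * r ^ (p - 1)) (Ici x) x :=
            ((Real.continuous_rpow_const (by linarith)).const_mul p).continuousWithinAt
          apply h2.congr
          · intro y hy
            simp [not_lt.2 (hx'.trans hy)]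
          · simp [hx] }
  have hbot : Tendsto f atBot (𝓝 0) := by
    apply tendsto_const_nhds.congr'
    filter_upwards [Iio_mem_atBot (0 : ℝ)] with y hy
    change (0 : ℝ) = if y < 0 then 0 else p * y ^ (p - 1)
    simp [mem_Iio.1 hy]
  refine ⟨f.measure, inferInstance, ⟨?_, ?_⟩⟩
  · have h1 : Iio (0 : ℝ) = ⋃ n : ℕ, Iic (-(1 / ((n : ℝ) + 1))) := by
      ext x
      simp only [mem_Iio, mem_iUnion, mem_Iic]
      constructor
      · intro hx
        obtain ⟨n, hn⟩ := exists_nat_one_div_lt (neg_pos.2 hx)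
        exact ⟨n, by linarith⟩
      · rintro ⟨n, hn⟩
        have : (0 : ℝ) < 1 / ((n : ℝ) + 1) := by positivity
        linarith
    rw [h1, measure_iUnion_null_iff]
    intro n
    have h2 : -(1 / ((n : ℝ) + 1)) < 0 := by
      have : (0 : ℝ) < 1 / ((n : ℝ) + 1) := by positivity
      linarith
    rw [f.measure_Iic hbot]
    have : f (-(1 / ((n : ℝ) + 1))) = 0 := if_pos h2
    rw [this]; simp
  · intro r hr
    rw [f.measure_Iic hbot]
    have : f r = p * r ^ (p - 1) := if_neg (not_lt.2 hr.le)
    rw [this, sub_zero]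

namespace IsGapKernel

variable {p : ℝ} {κ : Measure ℝ}

theorem ae_nonneg (hκ : IsGapKernel p κ) : ∀ᵐ h ∂κ, 0 ≤ h := by
  rw [ae_iff]
  convert hκ.Iio_zero using 2
  ext x; simp

theorem Iic_of_neg (hκ : IsGapKernel p κ) {r : ℝ} (hr : r < 0) : κ (Iic r) = 0 :=
  measure_mono_null (fun _ hx => lt_of_le_of_lt hx hr) hκ.Iio_zero

/-- `∫ (t - h)⁺ κ(dh) = t ^ p`. -/
theorem lintegral_sub [SFinite κ] (hp : 1 ≤ p) (hκ : IsGapKernel p κ) {t : ℝ} (ht : 0 ≤ t) :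
    ∫⁻ h, ENNReal.ofReal (t - h) ∂κ = ENNReal.ofReal (t ^ p) := by
  have h1 : ∀ h : ℝ, ENNReal.ofReal (t - h)
      = ∫⁻ r, (Iio t).indicator (fun r => (Iic r).indicator (fun _ => (1 : ℝ≥0∞)) h) r := by
    intro h
    rw [← Real.volume_Ico, ← lintegral_indicator_one measurableSet_Ico]
    refine lintegral_congr fun r => ?_
    by_cases h1 : h ≤ r <;> by_cases h2 : r < t <;> simp [indicator, h1, h2]
  simp_rw [h1]
  rw [lintegral_lintegral_swap]
  · have h2 : ∀ r : ℝ, ∫⁻ h, (Iio t).indicator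
        (fun r => (Iic r).indicator (fun _ => (1 : ℝ≥0∞)) h) r ∂κ
        = (Iio t).indicator (fun r => κ (Iic r)) r := by
      intro r
      by_cases h2 : r < t
      · simp [indicator_of_mem (mem_Iio.2 h2), lintegral_indicator_const measurableSet_Iic]
      · simp [indicator, h2]
    simp_rw [h2]
    have h3 : ∫⁻ r, (Iio t).indicator (fun r => κ (Iic r)) r
        = ∫⁻ r, (Ioc 0 t).indicator (fun r => ENNReal.ofReal (p * r ^ (p - 1))) r := by
      apply lintegral_congr_ae
      have e1 : ∀ᵐ r : ℝ, r ≠ 0 := by simp [ae_iff]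
      have e2 : ∀ᵐ r : ℝ, r ≠ t := by simp [ae_iff]
      filter_upwards [e1, e2] with r h0 htt
      rcases lt_or_gt_of_ne h0 with h | h
      · have : ¬ (0 < r) := by linarith
        simp [indicator, hκ.Iic_of_neg h, this]
      · rcases lt_or_gt_of_ne htt with h' | h'
        · simp [indicator, h, h', h'.le, hκ.Iic_of_pos r h]
        · have h4 : ¬ r < t := by linarith
          have h5 : ¬ r ≤ t := by linarith
          simp [indicator, h4, h5]
    rw [h3, lintegral_indicator measurableSet_Ioc]
    have h6 : IntervalIntegrable (fun r : ℝ => p * r ^ (p - 1)) volume 0 t :=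
      (intervalIntegral.intervalIntegrable_rpow' (by linarith)).const_mul p
    rw [← ofReal_integral_eq_lintegral_ofReal]
    · rw [← intervalIntegral.integral_of_le ht, intervalIntegral.integral_const_mul,
        integral_rpow (Or.inl (by linarith))]
      rw [sub_add_cancel, Real.zero_rpow (by linarith), sub_zero, mul_div_cancel₀]
      linarith
    · exact (intervalIntegrable_iff_integrableOn_Ioc_of_le ht).1 h6
    · filter_upwards [ae_restrict_mem measurableSet_Ioc] with r hr
      exact mul_nonneg (by linarith) (Real.rpow_nonneg hr.1.le _)
  · apply Measurable.aemeasurable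
    have hm : MeasurableSet {z : ℝ × ℝ | z.2 < t ∧ z.1 ≤ z.2} :=
      (measurableSet_lt measurable_snd measurable_const).inter
        (measurableSet_le measurable_fst measurable_snd)
    convert (measurable_const (a := (1 : ℝ≥0∞))).indicator hm using 1
    ext ⟨a, b⟩
    by_cases h1 : a ≤ b <;> by_cases h2 : b < t <;> simp [indicator, Function.uncurry, h1, h2]

theorem lintegral_sub_of_nonpos (hκ : IsGapKernel p κ) {t : ℝ} (ht : t ≤ 0) :
    ∫⁻ h, ENNReal.ofReal (t - h) ∂κ = 0 := by
  rw [lintegral_eq_zero_iff (by fun_prop)]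
  filter_upwards [hκ.ae_nonneg] with h hh
  exact ENNReal.ofReal_of_nonpos (by linarith)

/-- The power `|a - b| ^ p` as a superposition of lengths of intervals: of the `x` with
`a ≤ x - h / 2` and `x + h / 2 < b`, or the same with `a` and `b` exchanged. -/
theorem lintegral_volume [SFinite κ] (hp : 1 ≤ p) (hκ : IsGapKernel p κ) (a b : ℝ) :
    ∫⁻ h, (volume (Ico (a + h / 2) (b - h / 2)) + volume (Ico (b + h / 2) (a - h / 2))) ∂κ
      = ‖a - b‖ₑ ^ p := by
  simp_rw [Real.volume_Ico]
  have e1 : ∀ a b h : ℝ, b - h / 2 - (a + h / 2) = (b - a) - h := by intros; ring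
  simp_rw [e1]
  rw [lintegral_add_left (by fun_prop)]
  have e2 : ‖a - b‖ₑ ^ p = ENNReal.ofReal (|a - b| ^ p) := by
    rw [Real.enorm_eq_ofReal_abs, ENNReal.ofReal_rpow_of_nonneg (abs_nonneg _) (by linarith)]
  rw [e2]
  rcases le_total a b with h | h
  · rw [hκ.lintegral_sub hp (by linarith), hκ.lintegral_sub_of_nonpos (by linarith), add_zero,
      abs_of_nonpos (by linarith), neg_sub]
  · rw [hκ.lintegral_sub_of_nonpos (t := b - a) (by linarith), hκ.lintegral_sub hp (by linarith),
      zero_add, abs_of_nonneg (by linarith)]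

end IsGapKernel

/-! ### The Wasserstein distance on the line as a gap cost -/

/-- The gap cost of two distribution functions: the integral, against the kernel `κ`, of the
positive parts of `F (x - h / 2) - G (x + h / 2)` and of the same difference with `F` and `G`
exchanged. Such a positive part is the least mass that a coupling can transport across
`[x - h / 2, x + h / 2]` in one direction. -/
noncomputable def gapCost (κ : Measure ℝ) (F G : ℝ → ℝ) : ℝ≥0∞ :=
  ∫⁻ h, (∫⁻ x, (ENNReal.ofReal (F (x - h / 2) - G (x + h / 2))
    + ENNReal.ofReal (G (x - h / 2) - F (x + h / 2)))) ∂κ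

theorem measurableSet_le_and_lt {γ : Type*} [MeasurableSpace γ] {f g k l : γ → ℝ}
    (hf : Measurable f) (hg : Measurable g) (hk : Measurable k) (hl : Measurable l) :
    MeasurableSet {w | f w ≤ g w ∧ k w < l w} :=
  (measurableSet_le hf hg).inter (measurableSet_lt hk hl)

/-- The cost of a coupling `γ`, in terms of the masses that `γ` gives to the quadrants below and
above the diagonal. -/
theorem lintegral_enorm_sub_rpow_eq {p : ℝ} {κ : Measure ℝ} [SFinite κ] (hp : 1 ≤ p)
    (hκ : IsGapKernel p κ) (γ : Measure (ℝ × ℝ)) [SFinite γ] :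
    ∫⁻ z, ‖z.1 - z.2‖ₑ ^ p ∂γ = ∫⁻ h, (∫⁻ x, (γ {z | z.1 ≤ x - h / 2 ∧ x + h / 2 < z.2}
      + γ {z | z.2 ≤ x - h / 2 ∧ x + h / 2 < z.1})) ∂κ := by
  have hA : MeasurableSet {w : (ℝ × ℝ) × (ℝ × ℝ) |
      w.1.1 ≤ w.2.2 - w.2.1 / 2 ∧ w.2.2 + w.2.1 / 2 < w.1.2} :=
    measurableSet_le_and_lt (by fun_prop) (by fun_prop) (by fun_prop) (by fun_prop)
  have hB : MeasurableSet {w : (ℝ × ℝ) × (ℝ × ℝ) |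
      w.1.2 ≤ w.2.2 - w.2.1 / 2 ∧ w.2.2 + w.2.1 / 2 < w.1.1} :=
    measurableSet_le_and_lt (by fun_prop) (by fun_prop) (by fun_prop) (by fun_prop)
  set f : (ℝ × ℝ) × (ℝ × ℝ) → ℝ≥0∞ := fun w =>
    {w : (ℝ × ℝ) × (ℝ × ℝ) | w.1.1 ≤ w.2.2 - w.2.1 / 2 ∧ w.2.2 + w.2.1 / 2 < w.1.2}.indicator 1 w
    + {w : (ℝ × ℝ) × (ℝ × ℝ) | w.1.2 ≤ w.2.2 - w.2.1 / 2 ∧ w.2.2 + w.2.1 / 2 < w.1.1}.indicator 1 w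
    with hf
  have hfm : Measurable f := (measurable_one.indicator hA).add (measurable_one.indicator hB)
  have h1 : ∀ z : ℝ × ℝ, ‖z.1 - z.2‖ₑ ^ p = ∫⁻ h, (∫⁻ x, f (z, (h, x))) ∂κ := by
    intro z
    rw [← hκ.lintegral_volume hp z.1 z.2]
    refine lintegral_congr fun h => ?_
    simp only [hf]
    rw [lintegral_add_left (by
      exact (measurable_one.indicator hA).comp (by fun_prop : Measurable fun x : ℝ => (z, (h, x))))]
    congr 1
    · rw [← lintegral_indicator_one measurableSet_Ico]
      refine lintegral_congr fun x => ?_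
      simp only [indicator, mem_Ico, mem_ofPred_eq, Pi.one_apply]
      congr 1
      apply propext
      constructor <;> rintro ⟨h1, h2⟩ <;> constructor <;> linarith
    · rw [← lintegral_indicator_one measurableSet_Ico]
      refine lintegral_congr fun x => ?_
      simp only [indicator, mem_Ico, mem_ofPred_eq, Pi.one_apply]
      congr 1
      apply propext
      constructor <;> rintro ⟨h1, h2⟩ <;> constructor <;> linarith
  have h2 : ∀ z : ℝ × ℝ, ∫⁻ h, (∫⁻ x, f (z, (h, x))) ∂κ = ∫⁻ w, f (z, w) ∂(κ.prod volume) := by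
    intro z
    rw [lintegral_prod _ (by exact (hfm.comp (by fun_prop)).aemeasurable)]
  simp_rw [h1, h2]
  rw [lintegral_lintegral_swap (by exact hfm.aemeasurable),
    lintegral_prod _ (by exact (hfm.comp measurable_swap).lintegral_prod_right'.aemeasurable)]
  refine lintegral_congr fun h => ?_
  refine lintegral_congr fun x => ?_
  have hA' : MeasurableSet {z : ℝ × ℝ | z.1 ≤ x - h / 2 ∧ x + h / 2 < z.2} :=
    measurableSet_le_and_lt (by fun_prop) (by fun_prop) (by fun_prop) (by fun_prop)
  have hB' : MeasurableSet {z : ℝ × ℝ | z.2 ≤ x - h / 2 ∧ x + h / 2 < z.1} :=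
    measurableSet_le_and_lt (by fun_prop) (by fun_prop) (by fun_prop) (by fun_prop)
  rw [← lintegral_indicator_one hA', ← lintegral_indicator_one hB', ← lintegral_add_left
    (measurable_one.indicator hA')]
  rfl

/-- The quantile function (generalized inverse) of `F`. -/
noncomputable def quantile (F : ℝ → ℝ) (u : ℝ) : ℝ := sInf {x | u ≤ F x}

/-- The Galois connection between a distribution function and its quantile function; it holds on
`(0, 1)` only, since `sInf` takes the junk value `0` on unbounded or empty sets. -/
theorem quantile_le_iff (α : Measure ℝ) [IsProbabilityMeasure α] {u x : ℝ}
    (hu : u ∈ Ioo (0 : ℝ) 1) :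
    quantile (cdf α) u ≤ x ↔ u ≤ cdf α x := by
  have hne : {x | u ≤ cdf α x}.Nonempty :=
    ((tendsto_cdf_atTop α).eventually (eventually_ge_nhds hu.2)).exists
  have hbdd : BddBelow {x | u ≤ cdf α x} := by
    obtain ⟨y, hy⟩ := ((tendsto_cdf_atBot α).eventually (eventually_lt_nhds hu.1)).exists
    refine ⟨y, fun z hz => ?_⟩
    by_contra hzy
    exact absurd (monotone_cdf α (not_le.1 hzy).le) (not_le.2 (lt_of_lt_of_le hy hz))
  constructor
  · intro h
    have h1 : ∀ y, x < y → u ≤ cdf α y := by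
      intro y hy
      obtain ⟨z, hz, hzy⟩ := exists_lt_of_csInf_lt hne (lt_of_le_of_lt h hy)
      exact le_trans hz (monotone_cdf α hzy.le)
    have h2 : Tendsto (cdf α) (𝓝[>] x) (𝓝 (cdf α x)) :=
      ((cdf α).right_continuous x).mono_left (nhdsWithin_mono _ Ioi_subset_Ici_self)
    refine ge_of_tendsto h2 ?_
    filter_upwards [self_mem_nhdsWithin] with y hy using h1 y hy
  · intro h
    exact csInf_le hbdd h

theorem aemeasurable_quantile (α : Measure ℝ) [IsProbabilityMeasure α] :
    AEMeasurable (quantile (cdf α)) (volume.restrict (Ioo (0 : ℝ) 1)) := by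
  apply aemeasurable_restrict_of_monotoneOn measurableSet_Ioo
  intro u hu v hv huv
  rw [quantile_le_iff α hu]
  exact huv.trans ((quantile_le_iff α hv).1 le_rfl)

theorem volume_Iic_inter_Ioo {c : ℝ} (h1 : c ≤ 1) :
    volume (Iic c ∩ Ioo (0 : ℝ) 1) = ENNReal.ofReal c := by
  rw [← sub_zero c]
  apply le_antisymm
  · rw [← Real.volume_Ioc]
    exact measure_mono fun x hx => ⟨hx.2.1, by simpa using hx.1⟩
  · rw [← Real.volume_Ioo]
    refine measure_mono fun x hx => ⟨by simpa using hx.2.le, hx.1, ?_⟩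
    exact lt_of_lt_of_le hx.2 h1

theorem map_quantile (α : Measure ℝ) [IsProbabilityMeasure α] :
    (volume.restrict (Ioo (0 : ℝ) 1)).map (quantile (cdf α)) = α := by
  have : IsFiniteMeasure ((volume.restrict (Ioo (0 : ℝ) 1)).map (quantile (cdf α))) := by
    infer_instance
  apply Measure.ext_of_Iic
  intro x
  have hq := aemeasurable_quantile α
  rw [Measure.map_apply_of_aemeasurable hq measurableSet_Iic, ← ofReal_cdf,
    ← volume_Iic_inter_Ioo (cdf_le_one α x),
    Measure.restrict_apply₀' measurableSet_Ioo.nullMeasurableSet]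
  congr 1
  ext u
  simp only [mem_inter_iff, mem_preimage, mem_Iic]
  constructor
  · rintro ⟨h1, h2⟩; exact ⟨(quantile_le_iff α h2).1 h1, h2⟩
  · rintro ⟨h1, h2⟩; exact ⟨(quantile_le_iff α h2).2 h1, h2⟩

/-- For the quantile coupling the mass of a quadrant is at most the positive part of the difference
of the distribution functions, which every other coupling must reach. -/
theorem volume_quantile_le_lt (α β : Measure ℝ) [IsProbabilityMeasure α] [IsProbabilityMeasure β]
    (s t : ℝ) :
    volume ({u | quantile (cdf α) u ≤ s ∧ t < quantile (cdf β) u} ∩ Ioo (0 : ℝ) 1)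
      ≤ ENNReal.ofReal (cdf α s - cdf β t) := by
  rw [← Real.volume_Ioc]
  apply measure_mono
  rintro u ⟨⟨h1, h2⟩, h3⟩
  refine ⟨?_, (quantile_le_iff α h3).1 h1⟩
  by_contra h
  exact absurd ((quantile_le_iff β h3).2 (not_lt.1 h)) (not_le.2 h2)

/-- On the line, `W_p^p` is the gap cost of the distribution functions: each coupling gives the
quadrant `{z₁ ≤ s, t < z₂}` at least the mass `F s - G t`, and the quantile coupling gives it no
more than `(F s - G t)⁺`. -/
theorem wassersteinPow_eq_gapCost {p : ℝ} {κ : Measure ℝ} [SFinite κ] (hp : 1 ≤ p)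
    (hκ : IsGapKernel p κ) (α β : Measure ℝ) [IsProbabilityMeasure α] [IsProbabilityMeasure β] :
    wassersteinPow p α β = gapCost κ (cdf α) (cdf β) := by
  apply le_antisymm
  -- the quantile coupling attains the gap cost
  · set U := volume.restrict (Ioo (0 : ℝ) 1)
    set T : ℝ → ℝ × ℝ := fun u => (quantile (cdf α) u, quantile (cdf β) u)
    have hT : AEMeasurable T U := (aemeasurable_quantile α).prodMk (aemeasurable_quantile β)
    have hmem : U.map T ∈ couplings α β := by
      constructor
      · rw [AEMeasurable.map_map_of_aemeasurable measurable_fst.aemeasurable hT]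
        exact map_quantile α
      · rw [AEMeasurable.map_map_of_aemeasurable measurable_snd.aemeasurable hT]
        exact map_quantile β
    refine (iInf₂_le _ hmem).trans ?_
    rw [lintegral_enorm_sub_rpow_eq hp hκ]
    apply lintegral_mono
    intro h
    apply lintegral_mono
    intro x
    dsimp only
    rw [Measure.map_apply_of_aemeasurable hT (measurableSet_le_and_lt (by fun_prop) (by fun_prop)
        (by fun_prop) (by fun_prop)),
      Measure.map_apply_of_aemeasurable hT (measurableSet_le_and_lt (by fun_prop) (by fun_prop)
        (by fun_prop) (by fun_prop)),
      Measure.restrict_apply₀' measurableSet_Ioo.nullMeasurableSet,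
      Measure.restrict_apply₀' measurableSet_Ioo.nullMeasurableSet]
    exact add_le_add (volume_quantile_le_lt α β _ _) (volume_quantile_le_lt β α _ _)
  -- every coupling `γ` satisfies `F s - G t ≤ γ {z₁ ≤ s, t < z₂}`
  · refine le_iInf₂ fun γ hγ => ?_
    have hγp : IsProbabilityMeasure γ := by
      constructor
      have := congrArg (fun m => m univ) hγ.1
      simpa [Measure.map_apply measurable_fst MeasurableSet.univ] using this
    rw [lintegral_enorm_sub_rpow_eq hp hκ]
    apply lintegral_mono
    intro h
    apply lintegral_mono
    intro x
    have e1 : ∀ s, γ {z | z.1 ≤ s} = ENNReal.ofReal (cdf α s) := by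
      intro s
      rw [ofReal_cdf, ← hγ.1, Measure.map_apply measurable_fst measurableSet_Iic]; rfl
    have e2 : ∀ s, γ {z | z.2 ≤ s} = ENNReal.ofReal (cdf β s) := by
      intro s
      rw [ofReal_cdf, ← hγ.2, Measure.map_apply measurable_snd measurableSet_Iic]; rfl
    apply add_le_add
    · rw [ENNReal.ofReal_sub _ (cdf_nonneg β _), ← e1, ← e2, tsub_le_iff_right]
      refine le_trans (measure_mono fun z hz => ?_) (measure_union_le _ _)
      by_cases h2 : z.2 ≤ x + h / 2
      · exact Or.inr h2
      · exact Or.inl ⟨hz, not_le.1 h2⟩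
    · rw [ENNReal.ofReal_sub _ (cdf_nonneg α _), ← e1, ← e2, tsub_le_iff_right]
      refine le_trans (measure_mono fun z hz => ?_) (measure_union_le _ _)
      by_cases h2 : z.1 ≤ x + h / 2
      · exact Or.inr h2
      · exact Or.inl ⟨hz, not_le.1 h2⟩

/-! ### Accuracy of empirical distribution functions -/

/-- The bound on the mean error of an empirical frequency over `n` trials of probability `t`: the
trivial bound `2 * t`, or the standard deviation. -/
noncomputable def sampleErr (n : ℕ) (t : ℝ) : ℝ := min (2 * t) (√(t / n))

theorem sampleErr_nonneg {n : ℕ} {t : ℝ} (ht : 0 ≤ t) : 0 ≤ sampleErr n t :=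
  le_min (by linarith) (Real.sqrt_nonneg _)

theorem sampleErr_mono {n : ℕ} {s t : ℝ} (hst : s ≤ t) : sampleErr n s ≤ sampleErr n t :=
  min_le_min (by linarith) (Real.sqrt_le_sqrt (by gcongr))

theorem sampleErr_const_mul_le {n : ℕ} {c t : ℝ} (hc : 1 ≤ c) :
    sampleErr n (c * t) ≤ c * sampleErr n t := by
  unfold sampleErr
  rw [mul_min_of_nonneg _ _ (by linarith)]
  refine min_le_min (by linarith) ?_
  rw [mul_div_assoc, Real.sqrt_mul (by linarith)]
  gcongr
  rw [Real.sqrt_le_left (by linarith)]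
  nlinarith

theorem sampleErr_le_sqrt {n : ℕ} {t : ℝ} : sampleErr n t ≤ √(t / n) := min_le_right _ _

theorem sampleErr_le_two_mul {n : ℕ} {t : ℝ} : sampleErr n t ≤ 2 * t := min_le_left _ _

theorem measurable_sampleErr (n : ℕ) : Measurable (sampleErr n) := by
  unfold sampleErr; fun_prop

/-- The mean of `n` independent copies of a `[0, 1]`-valued variable deviates from its expectation
`a` by at most `sampleErr n a` in `L¹`, since the variance of one copy is at most `a`. -/
theorem lintegral_abs_mean_sub_le {Ω : Type*} [MeasurableSpace Ω] {P : Measure Ω}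
    [IsProbabilityMeasure P] {n : ℕ} (hn : 1 ≤ n) {α : Measure ℝ} {ξ : Fin n → Ω → ℝ}
    (hξ : iIndepFun ξ P) (hlaw : ∀ i, HasLaw (ξ i) α P) {f : ℝ → ℝ} (hf : Measurable f)
    (hf0 : ∀ x, 0 ≤ f x) (hf1 : ∀ x, f x ≤ 1) :
    ∫⁻ ω, ENNReal.ofReal |(n : ℝ)⁻¹ * ∑ i, f (ξ i ω) - ∫ x, f x ∂α| ∂P
      ≤ ENNReal.ofReal (sampleErr n (∫ x, f x ∂α)) := by
  set a := ∫ x, f x ∂α with ha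
  have hn' : (0 : ℝ) < n := by exact_mod_cast hn
  have ha0 : 0 ≤ a := integral_nonneg hf0
  have hfm : ∀ i, AEStronglyMeasurable (fun ω => f (ξ i ω)) P := fun i =>
    (hf.comp_aemeasurable (hlaw i).aemeasurable).aestronglyMeasurable
  have hL : ∀ i, MemLp (fun ω => f (ξ i ω)) 2 P := fun i =>
    memLp_of_bounded (a := 0) (b := 1) (ae_of_all _ fun ω => ⟨hf0 _, hf1 _⟩) (hfm i) 2
  have hint : ∀ i, Integrable (fun ω => f (ξ i ω)) P := fun i => (hL i).integrable one_le_two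
  have hEi : ∀ i, ∫ ω, f (ξ i ω) ∂P = a := by
    intro i
    rw [ha, ← (hlaw i).map_eq, integral_map (hlaw i).aemeasurable hf.aestronglyMeasurable]
  set S : Ω → ℝ := fun ω => (n : ℝ)⁻¹ * ∑ i, f (ξ i ω) with hS
  have hSum : MemLp (fun ω => ∑ i, f (ξ i ω)) 2 P := memLp_finsetSum _ fun i _ => hL i
  have hSL : MemLp S 2 P := hSum.const_mul _
  have hSi : Integrable S P := hSL.integrable one_le_two
  have hES : ∫ ω, S ω ∂P = a := by
    simp only [hS]
    rw [integral_const_mul, integral_finsetSum _ fun i _ => hint i]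
    simp only [hEi, Finset.sum_const, Finset.card_univ, Fintype.card_fin, nsmul_eq_mul]
    field_simp
  have hvar : Var[S; P] ≤ a / n := by
    simp only [hS]
    rw [variance_const_mul]
    have h1 : (fun ω => ∑ i, f (ξ i ω)) = ∑ i, fun ω => f (ξ i ω) := by ext; simp
    rw [h1, IndepFun.variance_sum (fun i _ => hL i)]
    · have h2 : ∀ i ∈ (Finset.univ : Finset (Fin n)), Var[fun ω => f (ξ i ω); P] ≤ a := by
        intro i _
        refine (variance_le_expectation_sq (hfm i)).trans ?_
        rw [← hEi i]
        apply integral_mono (hL i).integrable_sq (hint i)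
        intro ω
        change f (ξ i ω) ^ 2 ≤ f (ξ i ω)
        nlinarith [hf0 (ξ i ω), hf1 (ξ i ω)]
      have h3 := Finset.sum_le_sum h2
      simp only [Finset.sum_const, Finset.card_univ, Fintype.card_fin, nsmul_eq_mul] at h3
      calc ((n : ℝ)⁻¹) ^ 2 * ∑ i, Var[fun ω => f (ξ i ω); P]
          ≤ ((n : ℝ)⁻¹) ^ 2 * (n * a) := by gcongr
        _ = a / n := by field_simp
    · intro i _ j _ hij
      exact (hξ.indepFun hij).comp hf hf
  have hZi : Integrable (fun ω => S ω - a) P := hSi.sub (integrable_const _)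
  rw [← ofReal_integral_eq_lintegral_ofReal hZi.abs (ae_of_all _ fun _ => abs_nonneg _)]
  apply ENNReal.ofReal_le_ofReal
  apply le_min
  · calc ∫ ω, |S ω - a| ∂P ≤ ∫ ω, (S ω + a) ∂P := by
          apply integral_mono hZi.abs (hSi.add (integrable_const _))
          intro ω
          have : 0 ≤ S ω := mul_nonneg (by positivity) (Finset.sum_nonneg fun i _ => hf0 _)
          have h6 : |S ω - a| ≤ S ω + a := abs_le.2 ⟨by linarith, by linarith⟩
          exact h6
      _ = 2 * a := by
          rw [integral_add hSi (integrable_const _), hES]; simp; ring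
  · apply Real.le_sqrt_of_sq_le
    have hZL : MemLp (fun ω => |S ω - a|) 2 P := (hSL.sub (memLp_const a)).abs
    have h4 := variance_nonneg (fun ω => |S ω - a|) P
    rw [variance_eq_sub hZL] at h4
    have h5 : ∫ ω, ((fun ω => |S ω - a|) ^ 2) ω ∂P = Var[S; P] := by
      rw [variance_eq_integral hSi.aemeasurable, hES]
      simp
    rw [h5] at h4
    linarith

/-- `Fh` is a random function with values in `[0, 1]` which estimates `F` at each point with the
accuracy of a sample of size `n`, in both tails. This is what is used of an empirical distribution
function; the independence of the sample is used through it alone. -/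
structure CdfSample {Ω : Type*} [MeasurableSpace Ω] (P : Measure Ω) (n : ℕ) (F : ℝ → ℝ)
    (Fh : Ω → ℝ → ℝ) : Prop where
  meas : Measurable F
  meas_hat : Measurable (Function.uncurry Fh)
  nonneg : ∀ x, 0 ≤ F x
  le_one : ∀ x, F x ≤ 1
  nonneg_hat : ∀ ω x, 0 ≤ Fh ω x
  le_one_hat : ∀ ω x, Fh ω x ≤ 1
  err : ∀ x, ∫⁻ ω, ENNReal.ofReal |Fh ω x - F x| ∂P ≤ ENNReal.ofReal (sampleErr n (F x))
  err' : ∀ x, ∫⁻ ω, ENNReal.ofReal |Fh ω x - F x| ∂P ≤ ENNReal.ofReal (sampleErr n (1 - F x))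

/-- The empirical distribution function of the points `x₁, …, xₙ`. -/
noncomputable def empCdf {n : ℕ} (x : Fin n → ℝ) (t : ℝ) : ℝ :=
  (n : ℝ)⁻¹ * ∑ i, (Ici (x i)).indicator 1 t

theorem cdfSample_empCdf {Ω : Type*} [MeasurableSpace Ω] {P : Measure Ω}
    [IsProbabilityMeasure P] {n : ℕ} (hn : 1 ≤ n) {α : Measure ℝ} [IsProbabilityMeasure α]
    {ξ : Fin n → Ω → ℝ} (hm : ∀ i, Measurable (ξ i))
    (hξ : iIndepFun ξ P) (hlaw : ∀ i, HasLaw (ξ i) α P) :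
    CdfSample P n (cdf α) (fun ω => empCdf fun i => ξ i ω) := by
  have hn' : (0 : ℝ) < n := by exact_mod_cast hn
  have hI : ∀ x : ℝ, ∫ y, (Iic x).indicator (1 : ℝ → ℝ) y ∂α = cdf α x := by
    intro x
    rw [integral_indicator_one measurableSet_Iic, cdf_eq_real]
  have hI' : ∀ x : ℝ, ∫ y, (Ioi x).indicator (1 : ℝ → ℝ) y ∂α = 1 - cdf α x := by
    intro x
    rw [integral_indicator_one measurableSet_Ioi, cdf_eq_real, ← compl_Iic,
      probReal_compl_eq_one_sub measurableSet_Iic]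
  have e1 : ∀ a x : ℝ, (Ici a).indicator (1 : ℝ → ℝ) x = (Iic x).indicator 1 a := by
    intro a x
    simp [indicator]
  have e2 : ∀ a x : ℝ, (Ici a).indicator (1 : ℝ → ℝ) x = 1 - (Ioi x).indicator 1 a := by
    intro a x
    by_cases h : a ≤ x
    · simp [indicator, h, not_lt.2 h]
    · simp [indicator, h, not_le.1 h]
  have b0 : ∀ (s : Set ℝ) x, 0 ≤ s.indicator (1 : ℝ → ℝ) x := fun s x =>
    indicator_nonneg (fun _ _ => zero_le_one) x
  have b1 : ∀ (s : Set ℝ) x, s.indicator (1 : ℝ → ℝ) x ≤ 1 := fun s x =>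
    indicator_le_self' (fun _ _ => zero_le_one) x
  refine ⟨(monotone_cdf α).measurable, ?_, cdf_nonneg α, cdf_le_one α, ?_, ?_, ?_, ?_⟩
  · have : ∀ i, Measurable fun w : Ω × ℝ => (Ici (ξ i w.1)).indicator (1 : ℝ → ℝ) w.2 := by
      intro i
      have hs : MeasurableSet {w : Ω × ℝ | ξ i w.1 ≤ w.2} :=
        measurableSet_le ((hm i).comp measurable_fst) measurable_snd
      convert (measurable_one (α := ℝ)).indicator hs using 1
      rfl
    unfold Function.uncurry empCdf
    exact (Finset.measurable_sum _ fun i _ => this i).const_mul _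
  · intro ω x
    exact mul_nonneg (by positivity) (Finset.sum_nonneg fun i _ => b0 _ _)
  · intro ω x
    unfold empCdf
    rw [inv_mul_le_iff₀ hn', mul_one]
    calc ∑ i : Fin n, (Ici (ξ i ω)).indicator (1 : ℝ → ℝ) x ≤ ∑ i : Fin n, (1 : ℝ) :=
          Finset.sum_le_sum fun i _ => b1 _ _
      _ = n := by simp
  · intro x
    have := lintegral_abs_mean_sub_le hn hξ hlaw (f := (Iic x).indicator 1)
      (measurable_one.indicator measurableSet_Iic) (b0 _) (b1 _)
    rw [hI] at this
    simpa only [empCdf, e1] using this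
  · intro x
    have := lintegral_abs_mean_sub_le hn hξ hlaw (f := (Ioi x).indicator 1)
      (measurable_one.indicator measurableSet_Ioi) (b0 _) (b1 _)
    rw [hI'] at this
    refine le_trans (le_of_eq (lintegral_congr fun ω => ?_)) this
    congr 1
    simp only [empCdf, e2, Finset.sum_sub_distrib, Finset.sum_const, Finset.card_univ,
      Fintype.card_fin, nsmul_eq_mul, mul_one, mul_sub]
    rw [inv_mul_cancel₀ hn'.ne', ← abs_neg]
    congr 1
    ring

/-! ### Smoothing by noise -/

/-- The convolution of a bounded function `f` with the noise `N`. -/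
noncomputable def smooth (N : Measure ℝ) (f : ℝ → ℝ) (y : ℝ) : ℝ := ∫ z, f (y - z) ∂N

/-- The convolution of a function with values in `[0, ∞]` with the noise `N`. -/
noncomputable def lsmooth (N : Measure ℝ) (f : ℝ → ℝ≥0∞) (y : ℝ) : ℝ≥0∞ := ∫⁻ z, f (y - z) ∂N

section smooth

variable {N : Measure ℝ}

theorem measurable_lsmooth [IsProbabilityMeasure N] {f : ℝ → ℝ≥0∞} (hf : Measurable f) :
    Measurable (lsmooth N f) := by
  unfold lsmooth
  exact (hf.comp (by fun_prop : Measurable fun w : ℝ × ℝ => w.1 - w.2)).lintegral_prod_right'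

theorem lintegral_lsmooth [IsProbabilityMeasure N] {f : ℝ → ℝ≥0∞} (hf : Measurable f) :
    ∫⁻ y, lsmooth N f y = ∫⁻ x, f x := by
  unfold lsmooth
  rw [lintegral_lintegral_swap (f := fun y z => f (y - z))
    (hf.comp (by fun_prop : Measurable fun w : ℝ × ℝ => w.1 - w.2)).aemeasurable]
  simp_rw [lintegral_sub_right_eq_self]
  simp

theorem integrable_shift [IsProbabilityMeasure N] {f : ℝ → ℝ} (hf : Measurable f)
    {C : ℝ} (hC : ∀ x, |f x| ≤ C) (y : ℝ) :
    Integrable (fun z => f (y - z)) N :=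
  Integrable.of_bound (hf.comp (by fun_prop)).aestronglyMeasurable C
    (ae_of_all _ fun _ => by simpa using hC _)

theorem ofReal_smooth [IsProbabilityMeasure N] {f : ℝ → ℝ} (hf : Measurable f)
    (h0 : ∀ x, 0 ≤ f x) (h1 : ∀ x, f x ≤ 1)
    (y : ℝ) : ENNReal.ofReal (smooth N f y) = lsmooth N (fun x => ENNReal.ofReal (f x)) y := by
  unfold smooth lsmooth
  exact ofReal_integral_eq_lintegral_ofReal
    (integrable_shift hf (C := 1) (fun x => abs_le.2 ⟨by linarith [h0 x], h1 x⟩) y)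
    (ae_of_all _ fun _ => h0 _)

theorem ofReal_abs_smooth_le (f : ℝ → ℝ) (y : ℝ) :
    ENNReal.ofReal |smooth N f y| ≤ lsmooth N (fun x => ENNReal.ofReal |f x|) y := by
  unfold smooth lsmooth
  simp_rw [← Real.enorm_eq_ofReal_abs]
  exact enorm_integral_le_lintegral_enorm _

theorem smooth_nonneg {f : ℝ → ℝ} (h : ∀ x, 0 ≤ f x) (y : ℝ) : 0 ≤ smooth N f y :=
  integral_nonneg fun _ => h _

theorem measurable_smooth_uncurry [IsProbabilityMeasure N] {Ω : Type*} [MeasurableSpace Ω]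
    {f : Ω → ℝ → ℝ}
    (hf : Measurable (Function.uncurry f)) :
    Measurable (fun w : Ω × ℝ => smooth N (f w.1) w.2) := by
  unfold smooth
  have : Measurable (fun w : (Ω × ℝ) × ℝ => f w.1.1 (w.1.2 - w.2)) :=
    hf.comp (by fun_prop : Measurable fun w : (Ω × ℝ) × ℝ => (w.1.1, w.1.2 - w.2))
  exact this.stronglyMeasurable.integral_prod_right'.measurable

theorem measurable_smooth [IsProbabilityMeasure N] {f : ℝ → ℝ} (hf : Measurable f) :
    Measurable (smooth N f) := by
  unfold smooth
  have : Measurable (fun w : ℝ × ℝ => f (w.1 - w.2)) := hf.comp (by fun_prop)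
  exact this.stronglyMeasurable.integral_prod_right'.measurable

end smooth

/-! ### The positive part of a smoothed gap -/

/-- The tail of `F` shifted by `h / 2`, or of `1 - G`, according to the sign of `x`. For `h > 0`
and distribution functions of scale well below `h` it is small everywhere, whereas
`farTail (-h) G F` is close to `1` for `|x|` well below `h`. -/
noncomputable def farTail (h : ℝ) (F G : ℝ → ℝ) (x : ℝ) : ℝ :=
  if x < 0 then F (x - h / 2) else 1 - G (x + h / 2)

/-- The gap `F (x - h / 2) - G (x + h / 2)` as the difference of a function that is small and one
that is large near the origin. -/
theorem sub_eq_farTail_sub (h : ℝ) (F G : ℝ → ℝ) (x : ℝ) :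
    F (x - h / 2) - G (x + h / 2) = farTail h F G x - farTail (-h) G F x := by
  unfold farTail
  rw [neg_div, sub_neg_eq_add, ← sub_eq_add_neg]
  split_ifs <;> ring

theorem measurable_farTail_uncurry {Ω : Type*} [MeasurableSpace Ω] {F G : Ω → ℝ → ℝ}
    (hF : Measurable (Function.uncurry F)) (hG : Measurable (Function.uncurry G)) (h : ℝ) :
    Measurable (fun w : Ω × ℝ => farTail h (F w.1) (G w.1) w.2) := by
  unfold farTail
  apply Measurable.ite (measurableSet_lt measurable_snd measurable_const)
  · exact hF.comp (by fun_prop : Measurable fun w : Ω × ℝ => (w.1, w.2 - h / 2))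
  · exact (hG.comp (by fun_prop : Measurable fun w : Ω × ℝ => (w.1, w.2 + h / 2))).const_sub _

theorem measurable_farTail {F G : ℝ → ℝ} (hF : Measurable F) (hG : Measurable G) (h : ℝ) :
    Measurable (farTail h F G) := by
  unfold farTail
  exact Measurable.ite measurableSet_Iio (hF.comp (by fun_prop))
    ((hG.comp (by fun_prop)).const_sub _)

theorem farTail_nonneg {F G : ℝ → ℝ} (hF : ∀ x, 0 ≤ F x) (hG : ∀ x, G x ≤ 1) (h x : ℝ) :
    0 ≤ farTail h F G x := by
  unfold farTail
  split_ifs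
  · exact hF _
  · exact sub_nonneg.2 (hG _)

theorem farTail_le_one {F G : ℝ → ℝ} (hF : ∀ x, F x ≤ 1) (hG : ∀ x, 0 ≤ G x) (h x : ℝ) :
    farTail h F G x ≤ 1 := by
  unfold farTail
  split_ifs
  · exact hF _
  · linarith [hG (x + h / 2)]

theorem CdfSample.err_farTail {Ω : Type*} [MeasurableSpace Ω] {P : Measure Ω} {n : ℕ}
    {F G : ℝ → ℝ} {Fh Gh : Ω → ℝ → ℝ} (hF : CdfSample P n F Fh) (hG : CdfSample P n G Gh)
    (h x : ℝ) :
    ∫⁻ ω, ENNReal.ofReal |farTail h (Fh ω) (Gh ω) x - farTail h F G x| ∂P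
      ≤ ENNReal.ofReal (sampleErr n (farTail h F G x)) := by
  unfold farTail
  split_ifs
  · exact hF.err _
  · refine le_trans (le_of_eq (lintegral_congr fun ω => ?_)) (hG.err' (x + h / 2))
    rw [abs_sub_comm]
    congr 2
    ring

/-- A perturbation `s` of `k` changes `(t - k)⁺` by at most `|s|` and by at most `t`, and by
nothing at all unless `k` or `k + s` is below `t`; the last bound is a quantitative form of this.
-/
theorem abs_max_sub_max_bounds {t k s : ℝ} (ht : 0 ≤ t) (hk : 0 ≤ k) (hks : 0 ≤ k + s) :
    |max (t - k - s) 0 - max (t - k) 0| ≤ t ∧ |max (t - k - s) 0 - max (t - k) 0| ≤ |s| ∧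
      |max (t - k - s) 0 - max (t - k) 0| * k ≤ t * |s| := by
  have h2 : |max (t - k - s) 0 - max (t - k) 0| ≤ |s| := by
    refine (abs_max_sub_max_le_abs _ _ _).trans (le_of_eq ?_)
    rw [← abs_neg]; congr 1; ring
  refine ⟨?_, h2, ?_⟩
  · rw [abs_le]
    constructor
    · have h3 : max (t - k) 0 ≤ t := max_le (by linarith) ht
      linarith [le_max_right (t - k - s) 0]
    · have h3 : max (t - k - s) 0 ≤ t := max_le (by linarith) ht
      linarith [le_max_right (t - k) 0]
  · rcases le_total k t with h | h
    · rw [mul_comm]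
      exact mul_le_mul h h2 (abs_nonneg _) ht
    · rw [max_eq_right (by linarith : t - k ≤ 0), sub_zero, abs_of_nonneg (le_max_right _ _)]
      rcases le_total (t - k - s) 0 with h4 | h4
      · rw [max_eq_right h4, zero_mul]; positivity
      · rw [max_eq_left h4, abs_of_nonpos (by linarith)]
        nlinarith [mul_nonneg (sub_nonneg.2 h) hks]

/-- The change at `y` of the positive part of the smoothed gap when `F`, `G` are replaced by `F'`,
`G'`. -/
noncomputable def gapDiff (N : Measure ℝ) (h : ℝ) (F G F' G' : ℝ → ℝ) (y : ℝ) : ℝ :=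
  |max (smooth N F' (y - h / 2) - smooth N G' (y + h / 2)) 0
    - max (smooth N F (y - h / 2) - smooth N G (y + h / 2)) 0|

theorem smooth_sub_smooth_eq {N : Measure ℝ} [IsProbabilityMeasure N] {F G : ℝ → ℝ}
    (hF : Measurable F) (hG : Measurable G) (hF0 : ∀ x, 0 ≤ F x) (hF1 : ∀ x, F x ≤ 1)
    (hG0 : ∀ x, 0 ≤ G x) (hG1 : ∀ x, G x ≤ 1) (h y : ℝ) :
    smooth N F (y - h / 2) - smooth N G (y + h / 2)
      = smooth N (fun x => farTail h F G x - farTail (-h) G F x) y := by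
  unfold smooth
  rw [← integral_sub (integrable_shift hF (C := 1)
      (fun x => abs_le.2 ⟨by linarith [hF0 x], hF1 x⟩) _)
    (integrable_shift hG (C := 1) (fun x => abs_le.2 ⟨by linarith [hG0 x], hG1 x⟩) _)]
  refine integral_congr_ae (ae_of_all _ fun z => ?_)
  dsimp only
  rw [← sub_eq_farTail_sub]
  congr 2 <;> ring

/-- The mean error of the positive part of the smoothed gap. The errors of `farTail h F G`, and
those of `farTail (-h) G F` outside `[-h, h]`, are small and enter through their `L¹` norm. The
remaining error `e` comes from `farTail (-h) G F` on `[-h, h]`, where it is of order `n ^ (-1 / 2)`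
and far too large to be integrated; but there it hardly changes the positive part, which `e`
records by being bounded by the small tail `t`, and by `t * s / k` for the error `s` of the large
tail `k`. -/
theorem CdfSample.exists_error_bound {Ω : Type*} [MeasurableSpace Ω] {P : Measure Ω}
    [IsProbabilityMeasure P] {n : ℕ} {F G : ℝ → ℝ} {Fh Gh : Ω → ℝ → ℝ}
    (hF : CdfSample P n F Fh) (hG : CdfSample P n G Gh) (N : Measure ℝ) [IsProbabilityMeasure N]
    (h : ℝ) :
    ∃ e : ℝ → ℝ≥0∞,
      (∫⁻ ω, (∫⁻ y, ENNReal.ofReal (gapDiff N h F G (Fh ω) (Gh ω) y)) ∂P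
        ≤ (∫⁻ x, (ENNReal.ofReal (sampleErr n (farTail h F G x))
            + {x | h < |x|}.indicator
              (fun x => ENNReal.ofReal (sampleErr n (farTail (-h) G F x))) x)) + ∫⁻ y, e y) ∧
      (∀ y, e y ≤ lsmooth N (fun x => ENNReal.ofReal (farTail h F G x)) y) ∧
      (∀ y, e y ≤ lsmooth N ({x | |x| ≤ h}.indicator
          fun x => ENNReal.ofReal (sampleErr n (farTail (-h) G F x))) y) ∧
      (∀ y, e y * lsmooth N (fun x => ENNReal.ofReal (farTail (-h) G F x)) y
        ≤ lsmooth N (fun x => ENNReal.ofReal (farTail h F G x)) y *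
          lsmooth N ({x | |x| ≤ h}.indicator
            fun x => ENNReal.ofReal (sampleErr n (farTail (-h) G F x))) y) := by
  have mI : MeasurableSet {x : ℝ | |x| ≤ h} := measurableSet_le (by fun_prop) (by fun_prop)
  have mO : MeasurableSet {x : ℝ | h < |x|} := measurableSet_lt (by fun_prop) (by fun_prop)
  set τ := farTail h F G with hτ
  set k := farTail (-h) G F with hk
  set τh : Ω → ℝ → ℝ := fun ω => farTail h (Fh ω) (Gh ω) with hτh
  set kh : Ω → ℝ → ℝ := fun ω => farTail (-h) (Gh ω) (Fh ω) with hkh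
  have mτ : Measurable τ := measurable_farTail hF.meas hG.meas h
  have mk : Measurable k := measurable_farTail hG.meas hF.meas _
  have mτh : Measurable (Function.uncurry τh) :=
    measurable_farTail_uncurry hF.meas_hat hG.meas_hat h
  have mkh : Measurable (Function.uncurry kh) :=
    measurable_farTail_uncurry hG.meas_hat hF.meas_hat _
  have τ0 : ∀ x, 0 ≤ τ x := farTail_nonneg hF.nonneg hG.le_one _
  have τ1 : ∀ x, τ x ≤ 1 := farTail_le_one hF.le_one hG.nonneg _
  have k0 : ∀ x, 0 ≤ k x := farTail_nonneg hG.nonneg hF.le_one _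
  have k1 : ∀ x, k x ≤ 1 := farTail_le_one hG.le_one hF.nonneg _
  have τh0 : ∀ ω x, 0 ≤ τh ω x := fun ω => farTail_nonneg (hF.nonneg_hat ω) (hG.le_one_hat ω) _
  have τh1 : ∀ ω x, τh ω x ≤ 1 := fun ω => farTail_le_one (hF.le_one_hat ω) (hG.nonneg_hat ω) _
  have kh0 : ∀ ω x, 0 ≤ kh ω x := fun ω => farTail_nonneg (hG.nonneg_hat ω) (hF.le_one_hat ω) _
  have kh1 : ∀ ω x, kh ω x ≤ 1 := fun ω => farTail_le_one (hG.le_one_hat ω) (hF.nonneg_hat ω) _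
  -- `ψ` is the large error of the large tail, which must not be integrated; `χ` is all the rest
  set ψ : Ω → ℝ → ℝ := fun ω => {x | |x| ≤ h}.indicator fun x => kh ω x - k x with hψ
  set χ : Ω → ℝ → ℝ := fun ω x => (τh ω x - τ x)
    - {x | h < |x|}.indicator (fun x => kh ω x - k x) x with hχ
  have mdk : Measurable (fun w : Ω × ℝ => kh w.1 w.2 - k w.2) :=
    mkh.sub (mk.comp measurable_snd)
  have mψ : Measurable (Function.uncurry ψ) := by
    have : Function.uncurry ψ = (Prod.snd ⁻¹' {x : ℝ | |x| ≤ h}).indicator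
        fun w : Ω × ℝ => kh w.1 w.2 - k w.2 := by
      ext ⟨ω, x⟩; simp [hψ, indicator, Function.uncurry]
    rw [this]
    exact mdk.indicator (measurable_snd mI)
  have mχ : Measurable (Function.uncurry χ) := by
    have : Function.uncurry χ = fun w : Ω × ℝ => (τh w.1 w.2 - τ w.2)
        - (Prod.snd ⁻¹' {x : ℝ | h < |x|}).indicator (fun w : Ω × ℝ => kh w.1 w.2 - k w.2) w := by
      ext ⟨ω, x⟩; simp [hχ, indicator, Function.uncurry]
    rw [this]
    exact (mτh.sub (mτ.comp measurable_snd)).sub (mdk.indicator (measurable_snd mO))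
  have mψω : ∀ ω, Measurable (ψ ω) := fun ω => mψ.comp measurable_prodMk_left
  have mχω : ∀ ω, Measurable (χ ω) := fun ω => mχ.comp measurable_prodMk_left
  have dk1 : ∀ ω x, |kh ω x - k x| ≤ 1 := fun ω x => abs_le.2
    ⟨by linarith [kh0 ω x, k1 x], by linarith [kh1 ω x, k0 x]⟩
  have ψ1 : ∀ ω x, |ψ ω x| ≤ 1 := by
    intro ω x
    by_cases hx : |x| ≤ h
    · simpa [hψ, hx, indicator] using dk1 ω x
    · simp [hψ, hx]
  have χ1 : ∀ ω x, |χ ω x| ≤ 2 := by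
    intro ω x
    have h1 : |τh ω x - τ x| ≤ 1 := abs_le.2
      ⟨by linarith [τh0 ω x, τ1 x], by linarith [τh1 ω x, τ0 x]⟩
    refine (abs_sub _ _).trans ?_
    by_cases hx : h < |x|
    · simp only [indicator, mem_ofPred_eq, hx, if_true]
      linarith [dk1 ω x]
    · simp only [indicator, mem_ofPred_eq, hx, if_false, abs_zero]
      linarith
  have kψ : ∀ ω x, 0 ≤ k x + ψ ω x := by
    intro ω x
    by_cases hx : |x| ≤ h
    · simpa [hψ, hx] using kh0 ω x
    · simpa [hψ, hx] using k0 x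
  have split : ∀ ω x, τh ω x - kh ω x = τ x - k x - ψ ω x + χ ω x := by
    intro ω x
    simp only [hψ, hχ]
    by_cases hx : |x| ≤ h
    · simp only [indicator, mem_ofPred_eq, hx, not_lt.2 hx, if_true, if_false]; ring
    · simp only [indicator, mem_ofPred_eq, hx, not_le.1 hx, if_true, if_false]; ring
  have iτ : ∀ y, Integrable (fun z => τ (y - z)) N :=
    integrable_shift mτ (fun x => abs_le.2 ⟨by linarith [τ0 x], τ1 x⟩)
  have ik : ∀ y, Integrable (fun z => k (y - z)) N :=
    integrable_shift mk (fun x => abs_le.2 ⟨by linarith [k0 x], k1 x⟩)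
  have iψ : ∀ ω y, Integrable (fun z => ψ ω (y - z)) N := fun ω => integrable_shift (mψω ω) (ψ1 ω)
  have iχ : ∀ ω y, Integrable (fun z => χ ω (y - z)) N := fun ω => integrable_shift (mχω ω) (χ1 ω)
  set t := smooth N τ with ht
  set κ := smooth N k with hκ
  set s : Ω → ℝ → ℝ := fun ω => smooth N (ψ ω) with hs
  have t0 : ∀ y, 0 ≤ t y := smooth_nonneg τ0
  have κ0 : ∀ y, 0 ≤ κ y := smooth_nonneg k0
  have κs : ∀ ω y, 0 ≤ κ y + s ω y := by
    intro ω y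
    simp only [hκ, hs, smooth]
    rw [← integral_add (ik y) (iψ ω y)]
    exact integral_nonneg fun z => kψ ω _
  have e1 : ∀ y, smooth N F (y - h / 2) - smooth N G (y + h / 2) = t y - κ y := by
    intro y
    rw [smooth_sub_smooth_eq hF.meas hG.meas hF.nonneg hF.le_one hG.nonneg hG.le_one]
    simp only [ht, hκ, smooth]
    rw [← integral_sub (iτ y) (ik y)]
  have e2 : ∀ ω y, smooth N (Fh ω) (y - h / 2) - smooth N (Gh ω) (y + h / 2)
      = t y - κ y - s ω y + smooth N (χ ω) y := by
    intro ω y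
    rw [smooth_sub_smooth_eq (F := Fh ω) (G := Gh ω) (hF.meas_hat.comp measurable_prodMk_left)
      (hG.meas_hat.comp measurable_prodMk_left) (hF.nonneg_hat ω) (hF.le_one_hat ω)
      (hG.nonneg_hat ω) (hG.le_one_hat ω)]
    simp only [ht, hκ, hs, smooth]
    have i1 : Integrable (fun z => τ (y - z) - k (y - z)) N := (iτ y).sub (ik y)
    have i2 : Integrable (fun z => τ (y - z) - k (y - z) - ψ ω (y - z)) N := i1.sub (iψ ω y)
    rw [← integral_sub (iτ y) (ik y), ← integral_sub i1 (iψ ω y), ← integral_add i2 (iχ ω y)]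
    exact integral_congr_ae (ae_of_all _ fun z => split ω (y - z))
  set E : Ω → ℝ → ℝ := fun ω y => |max (t y - κ y - s ω y) 0 - max (t y - κ y) 0| with hE
  have mt : Measurable t := measurable_smooth mτ
  have mκ : Measurable κ := measurable_smooth mk
  have ms : Measurable (Function.uncurry s) := measurable_smooth_uncurry mψ
  have mE : Measurable (fun w : Ω × ℝ => E w.1 w.2) := by
    have a1 : Measurable (fun w : Ω × ℝ => t w.2 - κ w.2) :=
      (mt.comp measurable_snd).sub (mκ.comp measurable_snd)
    have a2 : Measurable (fun w : Ω × ℝ => |max (t w.2 - κ w.2 - Function.uncurry s w) 0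
      - max (t w.2 - κ w.2) 0|) :=
      (((a1.sub ms).max measurable_const).sub (a1.max measurable_const)).abs
    exact a2
  have bound : ∀ ω y, gapDiff N h F G (Fh ω) (Gh ω) y ≤ |smooth N (χ ω) y| + E ω y := by
    intro ω y
    unfold gapDiff
    rw [e1, e2]
    refine (abs_sub_le _ (max (t y - κ y - s ω y) 0) _).trans ?_
    refine add_le_add ((abs_max_sub_max_le_abs _ _ _).trans (le_of_eq ?_)) le_rfl
    congr 1; ring
  have Es : ∀ y, ∫⁻ ω, ENNReal.ofReal |s ω y| ∂P ≤ lsmooth N ({x | |x| ≤ h}.indicator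
          fun x => ENNReal.ofReal (sampleErr n (k x))) y := by
    intro y
    calc ∫⁻ ω, ENNReal.ofReal |s ω y| ∂P
        ≤ ∫⁻ ω, (∫⁻ z, ENNReal.ofReal |ψ ω (y - z)| ∂N) ∂P :=
          lintegral_mono fun ω => ofReal_abs_smooth_le _ _
      _ = ∫⁻ z, (∫⁻ ω, ENNReal.ofReal |ψ ω (y - z)| ∂P) ∂N := by
          rw [lintegral_lintegral_swap]
          apply Measurable.aemeasurable
          have hy : Measurable fun w : Ω × ℝ => (w.1, y - w.2) := by fun_prop
          exact (mψ.comp hy).abs.ennreal_ofReal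
      _ ≤ _ := by
          refine lintegral_mono fun z => ?_
          dsimp only
          by_cases hz : |y - z| ≤ h
          · simp only [hψ, indicator, mem_ofPred_eq, hz, if_true]
            exact hG.err_farTail hF (-h) (y - z)
          · simp [hψ, indicator, hz]
  refine ⟨fun y => ∫⁻ ω, ENNReal.ofReal (E ω y) ∂P, ?_, ?_, ?_, ?_⟩
  · calc ∫⁻ ω, (∫⁻ y, ENNReal.ofReal (gapDiff N h F G (Fh ω) (Gh ω) y)) ∂P
        ≤ ∫⁻ ω, ((∫⁻ x, ENNReal.ofReal |χ ω x|) + ∫⁻ y, ENNReal.ofReal (E ω y)) ∂P := by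
          refine lintegral_mono fun ω => ?_
          have mχa : Measurable fun x => ENNReal.ofReal |χ ω x| := (mχω ω).abs.ennreal_ofReal
          rw [← lintegral_lsmooth (N := N) mχa, ← lintegral_add_left (measurable_lsmooth mχa)]
          refine lintegral_mono fun y => ?_
          refine (ENNReal.ofReal_le_ofReal (bound ω y)).trans ?_
          rw [ENNReal.ofReal_add (abs_nonneg _) (abs_nonneg _)]
          gcongr
          exact ofReal_abs_smooth_le _ _
      _ = (∫⁻ x, (∫⁻ ω, ENNReal.ofReal |χ ω x| ∂P)) + ∫⁻ y, (∫⁻ ω, ENNReal.ofReal (E ω y) ∂P) := by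
          rw [lintegral_add_right _ (mE.ennreal_ofReal.lintegral_prod_right'),
            lintegral_lintegral_swap (f := fun ω y => ENNReal.ofReal (E ω y))
              mE.ennreal_ofReal.aemeasurable,
            lintegral_lintegral_swap (f := fun ω x => ENNReal.ofReal |χ ω x|)
              mχ.abs.ennreal_ofReal.aemeasurable]
      _ ≤ _ := by
          gcongr with x
          calc ∫⁻ ω, ENNReal.ofReal |χ ω x| ∂P
              ≤ ∫⁻ ω, (ENNReal.ofReal |τh ω x - τ x| + ENNReal.ofReal
                |{x | h < |x|}.indicator (fun x => kh ω x - k x) x|) ∂P := by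
                refine lintegral_mono fun ω => ?_
                rw [← ENNReal.ofReal_add (abs_nonneg _) (abs_nonneg _)]
                exact ENNReal.ofReal_le_ofReal (abs_sub _ _)
            _ = ∫⁻ ω, ENNReal.ofReal |τh ω x - τ x| ∂P + ∫⁻ ω, ENNReal.ofReal
                |{x | h < |x|}.indicator (fun x => kh ω x - k x) x| ∂P := by
                rw [lintegral_add_left]
                exact ((mτh.comp measurable_prodMk_right).sub_const _).abs.ennreal_ofReal
            _ ≤ _ := by
                gcongr
                · exact hF.err_farTail hG h x
                · by_cases hx : h < |x|
                  · simp only [indicator, mem_ofPred_eq, hx, if_true]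
                    exact hG.err_farTail hF (-h) x
                  · simp [indicator, hx]
  · intro y
    rw [← ofReal_smooth mτ τ0 τ1]
    calc ∫⁻ ω, ENNReal.ofReal (E ω y) ∂P ≤ ∫⁻ ω, ENNReal.ofReal (t y) ∂P :=
          lintegral_mono fun ω => ENNReal.ofReal_le_ofReal
            (abs_max_sub_max_bounds (t0 y) (κ0 y) (κs ω y)).1
      _ = _ := by simp [ht]
  · intro y
    exact (lintegral_mono fun ω => ENNReal.ofReal_le_ofReal
      (abs_max_sub_max_bounds (t0 y) (κ0 y) (κs ω y)).2.1).trans (Es y)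
  · intro y
    rw [← ofReal_smooth mτ τ0 τ1, ← ofReal_smooth mk k0 k1]
    refine le_trans ?_ (mul_le_mul_right (Es y) _)
    rw [← lintegral_const_mul' _ _ ENNReal.ofReal_ne_top,
      ← lintegral_mul_const' _ _ ENNReal.ofReal_ne_top]
    refine lintegral_mono fun ω => ?_
    change ENNReal.ofReal (E ω y) * ENNReal.ofReal (κ y)
      ≤ ENNReal.ofReal (t y) * ENNReal.ofReal |s ω y|
    rw [← ENNReal.ofReal_mul (abs_nonneg _), ← ENNReal.ofReal_mul (t0 y)]
    exact ENNReal.ofReal_le_ofReal (abs_max_sub_max_bounds (t0 y) (κ0 y) (κs ω y)).2.2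

/-! ### Gaussian windows -/

theorem gaussianNoise_eq_map (σ : ℝ) :
    gaussianNoise σ = (gaussianReal 0 1).map (fun z => σ * z) := by
  rw [gaussianReal_map_const_mul, gaussianNoise]
  congr 1
  · simp
  · ext; simp [Real.toNNReal_of_nonneg (sq_nonneg σ)]

instance (σ : ℝ) : IsProbabilityMeasure (gaussianNoise σ) := by
  unfold gaussianNoise; infer_instance

theorem lintegral_gaussianNoise_weight_le {q h σ : ℝ} (hq : 0 ≤ q) (hσ : 0 ≤ σ) (hh : 0 < h)
    (hσh : σ ≤ h) :
    ∫⁻ z, ENNReal.ofReal ((1 + 2 * |z| / h) ^ q) ∂(gaussianNoise σ)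
      ≤ ∫⁻ z, ENNReal.ofReal ((1 + 2 * |z|) ^ q) ∂(gaussianReal 0 1) := by
  rw [gaussianNoise_eq_map, lintegral_map (by fun_prop) (by fun_prop)]
  refine lintegral_mono fun z => ?_
  apply ENNReal.ofReal_le_ofReal
  apply Real.rpow_le_rpow (by positivity) _ hq
  gcongr 1 + ?_
  rw [div_le_iff₀ hh, abs_mul, abs_of_nonneg hσ]
  nlinarith [abs_nonneg z]

theorem lintegral_gaussianReal_weight_ne_top (q : ℝ) (hq : 0 < q) :
    ∫⁻ z, ENNReal.ofReal ((1 + 2 * |z|) ^ q) ∂(gaussianReal 0 1) ≠ ∞ := by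
  have h1 : MemLp (fun z : ℝ => 1 + 2 * |z|) (ENNReal.ofReal q) (gaussianReal 0 1) := by
    have h0 : MemLp (fun z : ℝ => z) (ENNReal.ofReal q) (gaussianReal 0 1) :=
      memLp_id_gaussianReal' _ ENNReal.ofReal_ne_top
    have hc : MemLp (fun _ : ℝ => (1 : ℝ)) (ENNReal.ofReal q) (gaussianReal 0 1) := memLp_const 1
    exact hc.add (h0.abs.const_mul 2)
  have h2 := h1.integrable_norm_rpow (by simpa using hq) ENNReal.ofReal_ne_top
  rw [ENNReal.toReal_ofReal hq.le] at h2
  have h3 := h2.lintegral_lt_top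
  refine (lt_of_le_of_lt (lintegral_mono fun z => ?_) h3).ne
  apply ENNReal.ofReal_le_ofReal
  rw [Real.norm_of_nonneg (by positivity)]

theorem lsmooth_indicator_window (N : Measure ℝ) (a y : ℝ) :
    lsmooth N ({x : ℝ | |x| ≤ a}.indicator 1) y = N (Icc (y - a) (y + a)) := by
  unfold lsmooth
  rw [← lintegral_indicator_one measurableSet_Icc]
  refine lintegral_congr fun z => ?_
  simp only [indicator, mem_ofPred_eq, mem_Icc, Pi.one_apply]
  congr 1
  rw [abs_le]
  apply propext
  constructor <;> rintro ⟨h1, h2⟩ <;> constructor <;> linarith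

theorem gaussianNoise_apply_Icc {σ : ℝ} (hσ : 0 < σ) (s : Set ℝ) :
    gaussianNoise σ s = ∫⁻ z in s, ENNReal.ofReal ((√(2 * Real.pi * σ ^ 2))⁻¹ *
      Real.exp (-z ^ 2 / (2 * σ ^ 2))) := by
  have hv : Real.toNNReal (σ ^ 2) ≠ 0 := by simpa using hσ.ne'
  rw [gaussianNoise, gaussianReal_apply 0 hv]
  simp [gaussianPDF, gaussianPDFReal, Real.coe_toNNReal _ (sq_nonneg σ)]

/-- The mass of a Gaussian window of half-width `h ≤ σ` is at most its length times the density at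
its centre, up to a factor `exp (|y| / σ)`. -/
theorem gaussianNoise_window_le {σ h : ℝ} (hσ : 0 < σ) (hhσ : h ≤ σ) (y : ℝ) :
    gaussianNoise σ (Icc (y - h) (y + h)) ≤ ENNReal.ofReal ((√(2 * Real.pi * σ ^ 2))⁻¹ *
      Real.exp (-(|y| / σ) ^ 2 / 2 + |y| / σ)) * ENNReal.ofReal (2 * h) := by
  rw [gaussianNoise_apply_Icc hσ]
  have h2 : ENNReal.ofReal (2 * h) = volume (Icc (y - h) (y + h)) := by
    rw [Real.volume_Icc]; congr 1; ring
  rw [h2, ← setLIntegral_const]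
  apply setLIntegral_mono measurable_const
  intro z hz
  gcongr
  rw [neg_div, div_pow, neg_div, div_div, mul_comm (σ ^ 2) 2]
  have h3 : |y| ^ 2 ≤ z ^ 2 + 2 * σ * |y| := by
    have h4 : |y| ≤ |z| + σ := by
      have : |y - z| ≤ h := abs_le.2 ⟨by linarith [hz.2], by linarith [hz.1]⟩
      have h5 := abs_sub_abs_le_abs_sub y z
      linarith
    rcases le_total |y| σ with h6 | h6
    · nlinarith [abs_nonneg y, sq_nonneg z]
    · have h7 : (|y| - σ) ^ 2 ≤ |z| ^ 2 := pow_le_pow_left₀ (by linarith) (by linarith) 2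
      rw [sq_abs] at h7
      nlinarith
  have e1 : |y| / σ = 2 * σ * |y| / (2 * σ ^ 2) := by field_simp
  rw [e1, neg_add_eq_sub, ← sub_div, neg_le_iff_add_nonneg, ← add_div]
  apply div_nonneg _ (by positivity)
  linarith

theorem le_gaussianNoise_window {σ h : ℝ} (hσ : 0 < σ) (hhσ : h ≤ σ) (y : ℝ) :
    ENNReal.ofReal ((√(2 * Real.pi * σ ^ 2))⁻¹ *
      Real.exp (-(|y| / σ) ^ 2 / 2 - |y| / σ - 1 / 2)) * ENNReal.ofReal (h / 2)
      ≤ gaussianNoise σ (Icc (y - h / 4) (y + h / 4)) := by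
  rw [gaussianNoise_apply_Icc hσ]
  have h2 : ENNReal.ofReal (h / 2) = volume (Icc (y - h / 4) (y + h / 4)) := by
    rw [Real.volume_Icc]; congr 1; ring
  rw [h2, ← setLIntegral_const]
  apply setLIntegral_mono (by fun_prop)
  intro z hz
  gcongr
  have h3 : z ^ 2 ≤ |y| ^ 2 + 2 * σ * |y| + σ ^ 2 := by
    have h4 : |z| ≤ |y| + σ := by
      have : |z - y| ≤ h / 4 := abs_le.2 ⟨by linarith [hz.1], by linarith [hz.2]⟩
      have h5 := abs_sub_abs_le_abs_sub z y
      have h6 := abs_nonneg (z - y)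
      linarith
    have h7 : |z| ^ 2 ≤ (|y| + σ) ^ 2 := pow_le_pow_left₀ (abs_nonneg _) h4 2
    rw [sq_abs] at h7
    linarith
  have e1 : -(|y| / σ) ^ 2 / 2 - |y| / σ - 1 / 2
      = -(|y| ^ 2 + 2 * σ * |y| + σ ^ 2) / (2 * σ ^ 2) := by field_simp; ring
  rw [e1]
  gcongr

theorem gaussianNoise_window_le_exp {σ h l : ℝ} (hσ : 0 < σ) (hh : 0 < h) (hhσ : h ≤ σ) (y : ℝ) :
    gaussianNoise σ (Icc (y - h) (y + h))
      ≤ ENNReal.ofReal (2 * Real.exp ((1 + l) ^ 2 / 2) * (h / σ) * Real.exp (-l * (|y| / σ))) := by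
  refine (gaussianNoise_window_le hσ hhσ y).trans ?_
  rw [← ENNReal.ofReal_mul (by positivity)]
  apply ENNReal.ofReal_le_ofReal
  have h1 : (√(2 * Real.pi * σ ^ 2))⁻¹ ≤ σ⁻¹ := by
    gcongr
    apply Real.le_sqrt_of_sq_le
    have := Real.pi_gt_three
    nlinarith [sq_nonneg σ]
  have h2 : Real.exp (-(|y| / σ) ^ 2 / 2 + |y| / σ)
      ≤ Real.exp ((1 + l) ^ 2 / 2) * Real.exp (-l * (|y| / σ)) := by
    rw [← Real.exp_add]
    apply Real.exp_le_exp.2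
    nlinarith [sq_nonneg (|y| / σ - (1 + l))]
  calc (√(2 * Real.pi * σ ^ 2))⁻¹ * Real.exp (-(|y| / σ) ^ 2 / 2 + |y| / σ) * (2 * h)
      ≤ σ⁻¹ * (Real.exp ((1 + l) ^ 2 / 2) * Real.exp (-l * (|y| / σ))) * (2 * h) := by gcongr
    _ = _ := by field_simp

/-- The masses of two concentric Gaussian windows are comparable, up to a factor exponential in the
distance `|y|` of the centre from the mean. -/
theorem gaussianNoise_window_ratio {σ h : ℝ} (hσ : 0 < σ) (hhσ : h ≤ σ) (y : ℝ) :
    gaussianNoise σ (Icc (y - h) (y + h))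
      ≤ ENNReal.ofReal (4 * Real.exp (1 / 2) * Real.exp (2 * (|y| / σ)))
        * gaussianNoise σ (Icc (y - h / 4) (y + h / 4)) := by
  refine (gaussianNoise_window_le hσ hhσ y).trans ?_
  refine le_trans (le_of_eq ?_) (mul_le_mul_right (le_gaussianNoise_window hσ hhσ y) _)
  rw [← ENNReal.ofReal_mul (by positivity), ← ENNReal.ofReal_mul (by positivity),
    ← ENNReal.ofReal_mul (by positivity)]
  congr 1
  have : Real.exp (-(|y| / σ) ^ 2 / 2 + |y| / σ) = Real.exp (1 / 2) * Real.exp (2 * (|y| / σ))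
      * Real.exp (-(|y| / σ) ^ 2 / 2 - |y| / σ - 1 / 2) := by
    rw [← Real.exp_add, ← Real.exp_add]; congr 1; ring
  rw [this]; ring

theorem gaussianNoise_window_pos {σ h : ℝ} (hσ : 0 < σ) (hh : 0 < h) (hhσ : h ≤ σ) (y : ℝ) :
    gaussianNoise σ (Icc (y - h / 4) (y + h / 4)) ≠ 0 := by
  refine (lt_of_lt_of_le ?_ (le_gaussianNoise_window hσ hhσ y)).ne'
  apply ENNReal.mul_pos
  · rw [Ne, ENNReal.ofReal_eq_zero, not_le]; positivity
  · rw [Ne, ENNReal.ofReal_eq_zero, not_le]; positivity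

/-! ### Integrals over half-lines -/

theorem lintegral_comp_abs_eq {f : ℝ → ℝ≥0∞} :
    ∫⁻ x, f |x| = 2 * ∫⁻ x in Ioi 0, f x := by
  rw [← lintegral_add_compl _ (measurableSet_Iic (a := (0 : ℝ))), compl_Iic, two_mul]
  congr 1
  · rw [setLIntegral_congr (Iio_ae_eq_Iic (a := (0 : ℝ))).symm]
    have h1 : ∫⁻ x in Iio (0 : ℝ), f |x| = ∫⁻ x in Iio (0 : ℝ), f (-x) :=
      setLIntegral_congr_fun measurableSet_Iio fun x hx => by simp [abs_of_neg (mem_Iio.1 hx)]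
    rw [h1, ← lintegral_indicator measurableSet_Iio, ← lintegral_indicator measurableSet_Ioi,
      ← lintegral_neg_eq_self]
    refine lintegral_congr fun x => ?_
    simp [indicator]
  · exact setLIntegral_congr_fun measurableSet_Ioi fun x hx => by simp [abs_of_pos (mem_Ioi.1 hx)]

theorem setLIntegral_Ioi_comp_add (f : ℝ → ℝ≥0∞) (a c : ℝ) :
    ∫⁻ x in Ioi a, f (x + c) = ∫⁻ x in Ioi (a + c), f x := by
  rw [← lintegral_indicator measurableSet_Ioi, ← lintegral_indicator measurableSet_Ioi,
    ← lintegral_add_right_eq_self ((Ioi (a + c)).indicator f) c]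
  refine lintegral_congr fun x => ?_
  simp [indicator]

theorem lintegral_Ioi_ofReal_div_rpow {m a s : ℝ} (hm : 0 < m) (ha : 0 < a) (hs : 1 < s) :
    ∫⁻ r in Ioi a, ENNReal.ofReal ((m / r) ^ s)
      = ENNReal.ofReal (m * (a / m) ^ (1 - s) / (s - 1)) := by
  have h1 : EqOn (fun r : ℝ => (m / r) ^ s) (fun r => m ^ s * r ^ (-s)) (Ioi a) := by
    intro r hr
    have hr' : 0 < r := ha.trans hr
    dsimp only
    rw [Real.div_rpow hm.le hr'.le, Real.rpow_neg hr'.le, div_eq_mul_inv]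
  have hi : IntegrableOn (fun r : ℝ => m ^ s * r ^ (-s)) (Ioi a) :=
    (integrableOn_Ioi_rpow_of_lt (by linarith) ha).const_mul _
  rw [← ofReal_integral_eq_lintegral_ofReal]
  · rw [setIntegral_congr_fun measurableSet_Ioi h1, integral_const_mul,
      integral_Ioi_rpow_of_lt (by linarith) ha]
    congr 1
    rw [Real.div_rpow ha.le hm.le, show (1 - s) = -(s - 1) by ring, Real.rpow_neg hm.le,
      Real.rpow_sub_one hm.ne', show -s + 1 = -(s - 1) by ring]
    have : s - 1 ≠ 0 := by linarith
    field_simp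
  · exact hi.congr_fun (fun r hr => (h1 hr).symm) measurableSet_Ioi
  · filter_upwards [ae_restrict_mem measurableSet_Ioi] with r hr
    have hr' : 0 < r := ha.trans hr
    positivity

/-! ### Large gaps: tails and narrow noise -/

/-- The tails of the distribution function `F` are at most `(m / x) ^ q`; by Markov's inequality
this holds when the `q`-th moment is at most `m ^ q`. -/
structure TailBound (m q : ℝ) (F : ℝ → ℝ) : Prop where
  left : ∀ x, 0 < x → F (-x) ≤ (m / x) ^ q
  right : ∀ x, 0 < x → 1 - F x ≤ (m / x) ^ q

theorem TailBound.farTail_le {m q : ℝ} {F G : ℝ → ℝ} (hF : TailBound m q F) (hG : TailBound m q G)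
    {h x : ℝ} (hx : 0 < |x| + h / 2) : farTail h F G x ≤ (m / (|x| + h / 2)) ^ q := by
  unfold farTail
  split_ifs with h0
  · rw [abs_of_neg h0] at hx ⊢
    convert hF.left _ hx using 2
    ring
  · rw [abs_of_nonneg (not_lt.1 h0)] at hx ⊢
    exact hG.right _ hx

/-- When both laws live on a scale `m ≤ h / 8`, the large tail is at least `1 / 2` well inside
`[-h, h]`. -/
theorem TailBound.half_le_farTail {m q : ℝ} {F G : ℝ → ℝ} (hm : 0 < m) (hq : 1 ≤ q)
    (hF : TailBound m q F) (hG : TailBound m q G) {h x : ℝ} (hh : 8 * m ≤ h) (hx : |x| ≤ h / 4) :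
    1 / 2 ≤ farTail (-h) G F x := by
  have key : ∀ r, h / 4 ≤ r → (m / r) ^ q ≤ 1 / 2 := by
    intro r hr
    have hr0 : 0 < r := by linarith
    have h1 : m / r ≤ 1 / 2 := by rw [div_le_iff₀ hr0]; linarith
    calc (m / r) ^ q ≤ (m / r) ^ (1 : ℝ) :=
          Real.rpow_le_rpow_of_exponent_ge (by positivity) (by linarith) hq
      _ ≤ 1 / 2 := by rwa [Real.rpow_one]
  have hx' := abs_le.1 hx
  unfold farTail
  split_ifs with h0
  · have h2 := hG.right (x - -h / 2) (by linarith)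
    have h3 := key (x - -h / 2) (by linarith)
    linarith
  · have h2 := hF.left (-(x + -h / 2)) (by linarith)
    have h3 := key (-(x + -h / 2)) (by linarith)
    rw [neg_neg] at h2
    linarith

/-- The sampling error of a tail probability `(m / r) ^ q`. -/
noncomputable def errTail (n : ℕ) (m q r : ℝ) : ℝ := sampleErr n ((m / r) ^ q)

theorem lintegral_errTail_add (n : ℕ) (m q : ℝ) {h : ℝ} :
    ∫⁻ x, ENNReal.ofReal (errTail n m q (|x| + h / 2))
      = 2 * ∫⁻ r in Ioi (h / 2), ENNReal.ofReal (errTail n m q r) := by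
  rw [lintegral_comp_abs_eq (f := fun x => ENNReal.ofReal (errTail n m q (x + h / 2))),
    setLIntegral_Ioi_comp_add (fun r => ENNReal.ofReal (errTail n m q r)) 0 (h / 2), zero_add]

theorem measurable_errTail (n : ℕ) (m q : ℝ) : Measurable (errTail n m q) :=
  (measurable_sampleErr n).comp (by fun_prop)

theorem lintegral_farTail_err_le {n : ℕ} {m q h : ℝ} {F G : ℝ → ℝ} (hh : 0 < h)
    (hF : TailBound m q F) (hG : TailBound m q G) :
    ∫⁻ x, (ENNReal.ofReal (sampleErr n (farTail h F G x)) + {x | h < |x|}.indicator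
        (fun x => ENNReal.ofReal (sampleErr n (farTail (-h) G F x))) x)
      ≤ 4 * ∫⁻ r in Ioi (h / 2), ENNReal.ofReal (errTail n m q r) := by
  have hm1 : Measurable fun x : ℝ => ENNReal.ofReal (errTail n m q (|x| + h / 2)) :=
    ((measurable_errTail n m q).comp (by fun_prop)).ennreal_ofReal
  calc ∫⁻ x, (ENNReal.ofReal (sampleErr n (farTail h F G x)) + {x | h < |x|}.indicator
        (fun x => ENNReal.ofReal (sampleErr n (farTail (-h) G F x))) x)
      ≤ ∫⁻ x, (ENNReal.ofReal (errTail n m q (|x| + h / 2))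
          + (Ioi h).indicator (fun x => ENNReal.ofReal (errTail n m q (x + -h / 2))) |x|) := by
        refine lintegral_mono fun x => add_le_add ?_ ?_
        · exact ENNReal.ofReal_le_ofReal (sampleErr_mono (hF.farTail_le hG (by positivity)))
        · by_cases hx : h < |x|
          · simp only [indicator, mem_ofPred_eq, mem_Ioi, hx, if_true]
            exact ENNReal.ofReal_le_ofReal (sampleErr_mono (hG.farTail_le hF (by linarith)))
          · simp [indicator, hx]
    _ = 2 * (∫⁻ r in Ioi (h / 2), ENNReal.ofReal (errTail n m q r))
        + 2 * ∫⁻ r in Ioi (h / 2), ENNReal.ofReal (errTail n m q r) := by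
        rw [lintegral_add_left hm1, lintegral_errTail_add, lintegral_comp_abs_eq
          (f := (Ioi h).indicator (fun x => ENNReal.ofReal (errTail n m q (x + -h / 2))))]
        congr 2
        rw [lintegral_indicator measurableSet_Ioi, Measure.restrict_restrict measurableSet_Ioi,
          inter_eq_left.2 (Ioi_subset_Ioi hh.le),
          setLIntegral_Ioi_comp_add (fun r => ENNReal.ofReal (errTail n m q r))]
        congr 3
        ring
    _ = _ := by rw [← add_mul]; norm_num

theorem lsmooth_sqrt_sq_le {N : Measure ℝ} [IsProbabilityMeasure N] {f g : ℝ → ℝ≥0∞}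
    (hf : Measurable f) (hfg : ∀ x, f x ^ 2 ≤ g x) (y : ℝ) :
    lsmooth N f y ^ 2 ≤ lsmooth N g y := by
  have hm : AEMeasurable (fun z => f (y - z)) N := (hf.comp (by fun_prop)).aemeasurable
  have h1 := ENNReal.lintegral_mul_le_Lp_mul_Lq N Real.HolderConjugate.two_two hm
    (aemeasurable_const (b := (1 : ℝ≥0∞)))
  simp only [Pi.mul_apply, mul_one, ENNReal.one_rpow, lintegral_const, measure_univ] at h1
  have h2 : lsmooth N f y ^ 2 ≤ ((∫⁻ z, f (y - z) ^ (2 : ℝ) ∂N) ^ (1 / (2 : ℝ))) ^ 2 := by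
    gcongr; exact h1
  refine h2.trans ?_
  rw [← ENNReal.rpow_natCast, ← ENNReal.rpow_mul]
  norm_num
  exact lintegral_mono fun z => hfg _

/-- The remaining error when the noise is not wider than the gap. By the Cauchy–Schwarz inequality
the smoothed error satisfies `s ^ 2 ≤ k / n`, hence `e ^ 2 ≤ s * (t * s / k) ≤ t / n`, and the
small tail `t` keeps its polynomial decay because noise of scale at most `h` hardly moves
`(m / (|x| + h / 2)) ^ q`. -/
theorem lintegral_le_of_noise_le_gap {n : ℕ} {m q h K : ℝ} {F G : ℝ → ℝ} {N : Measure ℝ}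
    [IsProbabilityMeasure N] (hn : 1 ≤ n) (hm : 0 < m) (hq : 1 ≤ q) (hh : 0 < h) (hK : 1 ≤ K)
    (hN : ∫⁻ z, ENNReal.ofReal ((1 + 2 * |z| / h) ^ q) ∂N ≤ ENNReal.ofReal K)
    (hF : TailBound m q F) (hG : TailBound m q G) (mF : Measurable F) (mG : Measurable G)
    (F1 : ∀ x, F x ≤ 1) (G0 : ∀ x, 0 ≤ G x) (G1 : ∀ x, G x ≤ 1) (F0 : ∀ x, 0 ≤ F x)
    {e : ℝ → ℝ≥0∞}
    (he1 : ∀ y, e y ≤ lsmooth N (fun x => ENNReal.ofReal (farTail h F G x)) y)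
    (he2 : ∀ y, e y ≤ lsmooth N ({x | |x| ≤ h}.indicator
          fun x => ENNReal.ofReal (sampleErr n (farTail (-h) G F x))) y)
    (he3 : ∀ y, e y * lsmooth N (fun x => ENNReal.ofReal (farTail (-h) G F x)) y
        ≤ lsmooth N (fun x => ENNReal.ofReal (farTail h F G x)) y *
          lsmooth N ({x | |x| ≤ h}.indicator
            fun x => ENNReal.ofReal (sampleErr n (farTail (-h) G F x))) y) :
    ∫⁻ y, e y ≤ ENNReal.ofReal (2 * K)
      * ∫⁻ r in Ioi (h / 2), ENNReal.ofReal (errTail n m q r) := by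
  have mk : Measurable (farTail (-h) G F) := measurable_farTail mG mF _
  have k0 : ∀ x, 0 ≤ farTail (-h) G F x := farTail_nonneg G0 F1 _
  have k1 : ∀ x, farTail (-h) G F x ≤ 1 := farTail_le_one G1 F0 _
  have mI : MeasurableSet {x : ℝ | |x| ≤ h} := measurableSet_le (by fun_prop) (by fun_prop)
  have env0 : ∀ y : ℝ, 0 ≤ (m / (|y| + h / 2)) ^ q := fun y => by positivity
  have ht : ∀ y, lsmooth N (fun x => ENNReal.ofReal (farTail h F G x)) y
      ≤ ENNReal.ofReal (K * (m / (|y| + h / 2)) ^ q) := by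
    intro y
    calc lsmooth N (fun x => ENNReal.ofReal (farTail h F G x)) y
        ≤ ∫⁻ z, ENNReal.ofReal ((m / (|y| + h / 2)) ^ q)
            * ENNReal.ofReal ((1 + 2 * |z| / h) ^ q) ∂N := by
          refine lintegral_mono fun z => ?_
          rw [← ENNReal.ofReal_mul (env0 y), ← Real.mul_rpow (by positivity) (by positivity)]
          apply ENNReal.ofReal_le_ofReal
          refine (hF.farTail_le hG (by positivity)).trans ?_
          apply Real.rpow_le_rpow (by positivity) _ (by linarith)
          -- the envelope varies slowly at the scale `h`
          rw [div_mul_eq_mul_div, div_le_div_iff₀ (by positivity) (by positivity), mul_assoc]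
          gcongr
          have h1 : |y| ≤ |y - z| + |z| := by simpa using abs_add_le (y - z) z
          have h2 : (1 + 2 * |z| / h) * (|y - z| + h / 2)
              = |y - z| + h / 2 + |z| + 2 * |z| / h * |y - z| := by field_simp; ring
          have h3 : 0 ≤ 2 * |z| / h * |y - z| := by positivity
          linarith
      _ = ENNReal.ofReal ((m / (|y| + h / 2)) ^ q)
            * ∫⁻ z, ENNReal.ofReal ((1 + 2 * |z| / h) ^ q) ∂N := by
          rw [lintegral_const_mul' _ _ ENNReal.ofReal_ne_top]
      _ ≤ ENNReal.ofReal ((m / (|y| + h / 2)) ^ q) * ENNReal.ofReal K := by gcongr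
      _ = _ := by rw [← ENNReal.ofReal_mul (env0 y), mul_comm]
  have hs : ∀ y, lsmooth N ({x | |x| ≤ h}.indicator
        fun x => ENNReal.ofReal (sampleErr n (farTail (-h) G F x))) y ^ 2
      ≤ (n : ℝ≥0∞)⁻¹ * lsmooth N (fun x => ENNReal.ofReal (farTail (-h) G F x)) y := by
    intro y
    have hn' : (0 : ℝ) < n := by exact_mod_cast hn
    refine (lsmooth_sqrt_sq_le (g := fun x => ENNReal.ofReal (farTail (-h) G F x / n))
      (((measurable_sampleErr n).comp mk).ennreal_ofReal.indicator mI) (fun x => ?_) y).trans ?_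
    · by_cases hx : |x| ≤ h
      · simp only [indicator, mem_ofPred_eq, hx, if_true]
        change ENNReal.ofReal (sampleErr n (farTail (-h) G F x)) ^ 2 ≤ _
        rw [← ENNReal.ofReal_pow (sampleErr_nonneg (k0 x))]
        apply ENNReal.ofReal_le_ofReal
        rw [← Real.sq_sqrt (div_nonneg (k0 x) hn'.le)]
        exact pow_le_pow_left₀ (sampleErr_nonneg (k0 x)) sampleErr_le_sqrt 2
      · simp [indicator, hx]
    · unfold lsmooth
      rw [← lintegral_const_mul' _ _ (by simp; omega)]
      refine lintegral_mono fun z => ?_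
      dsimp only
      rw [div_eq_inv_mul, ENNReal.ofReal_mul (by positivity), ENNReal.ofReal_inv_of_pos hn',
        ENNReal.ofReal_natCast]
  have hb : ∀ y, e y ≤ ENNReal.ofReal (K * errTail n m q (|y| + h / 2)) := by
    intro y
    have hn' : (0 : ℝ) < n := by exact_mod_cast hn
    set t := lsmooth N (fun x => ENNReal.ofReal (farTail h F G x)) y
    set k := lsmooth N (fun x => ENNReal.ofReal (farTail (-h) G F x)) y
    set s := lsmooth N ({x | |x| ≤ h}.indicator
        fun x => ENNReal.ofReal (sampleErr n (farTail (-h) G F x))) y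
    set v := (m / (|y| + h / 2)) ^ q with hv
    have hk1 : k ≤ 1 := by
      calc k ≤ ∫⁻ _, 1 ∂N := lintegral_mono fun z => by simpa using k1 (y - z)
        _ = 1 := by simp
    have hsq : e y ^ 2 ≤ (n : ℝ≥0∞)⁻¹ * t := by
      by_cases hk : k = 0
      -- if `k = 0` there is nothing to divide by, but then `s = 0`
      · have h1 : s ^ 2 = 0 := by
          have := hs y
          rw [show lsmooth N (fun x => ENNReal.ofReal (farTail (-h) G F x)) y = 0 from hk,
            mul_zero] at this
          exact le_antisymm this zero_le
        have h2 : e y = 0 := le_antisymm ((he2 y).trans (by simpa using h1)) zero_le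
        simp [h2]
      · rw [← ENNReal.mul_le_mul_iff_left hk (hk1.trans_lt ENNReal.one_lt_top).ne]
        calc e y ^ 2 * k = e y * (e y * k) := by ring
          _ ≤ s * (t * s) := mul_le_mul' (he2 y) (he3 y)
          _ = t * s ^ 2 := by ring
          _ ≤ t * ((n : ℝ≥0∞)⁻¹ * k) := by gcongr; exact hs y
          _ = _ := by ring
    have h1 : e y ≤ ENNReal.ofReal (2 * (K * v)) :=
      ((he1 y).trans (ht y)).trans (ENNReal.ofReal_le_ofReal (by
        have : 0 ≤ K * v := mul_nonneg (by linarith) (env0 y)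
        linarith))
    have h2 : e y ≤ ENNReal.ofReal (√(K * v / n)) := by
      rw [← ENNReal.pow_le_pow_left_iff two_ne_zero, ← ENNReal.ofReal_pow (Real.sqrt_nonneg _),
        Real.sq_sqrt (div_nonneg (mul_nonneg (by linarith) (env0 y)) hn'.le)]
      refine hsq.trans ?_
      rw [div_eq_inv_mul, ENNReal.ofReal_mul (by positivity), ENNReal.ofReal_inv_of_pos hn',
        ENNReal.ofReal_natCast]
      gcongr
      exact ht y
    refine le_trans ?_ (ENNReal.ofReal_le_ofReal (sampleErr_const_mul_le hK))
    unfold sampleErr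
    rw [ENNReal.ofReal_min]
    exact le_min h1 h2
  calc ∫⁻ y, e y ≤ ∫⁻ y, ENNReal.ofReal (K * errTail n m q (|y| + h / 2)) := lintegral_mono hb
    _ = ENNReal.ofReal K * ∫⁻ y, ENNReal.ofReal (errTail n m q (|y| + h / 2)) := by
        simp_rw [ENNReal.ofReal_mul (by linarith : 0 ≤ K)]
        rw [lintegral_const_mul' _ _ ENNReal.ofReal_ne_top]
    _ = _ := by
        rw [lintegral_errTail_add, ← mul_assoc, mul_comm 2 K, ENNReal.ofReal_mul (by linarith)]
        simp

/-! ### Large gaps: wide noise -/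

theorem lintegral_exp_neg_abs_div_le {σ : ℝ} (hσ : 0 < σ) :
    ∫⁻ y : ℝ, ENNReal.ofReal (Real.exp (-(|y| / σ)) / σ) ≤ ENNReal.ofReal 2 := by
  rw [lintegral_comp_abs_eq (f := fun y => ENNReal.ofReal (Real.exp (-(y / σ)) / σ))]
  have ha : -σ⁻¹ < 0 := neg_neg_of_pos (inv_pos.2 hσ)
  have e1 : ∀ y : ℝ, Real.exp (-(y / σ)) / σ = Real.exp (-σ⁻¹ * y) * σ⁻¹ := by
    intro y; rw [div_eq_mul_inv]; congr 2; ring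
  simp_rw [e1]
  rw [← ofReal_integral_eq_lintegral_ofReal ((integrableOn_exp_mul_Ioi ha 0).mul_const _)
    (ae_of_all _ fun y => by positivity), integral_mul_const, integral_exp_mul_Ioi ha,
    show (2 : ℝ≥0∞) = ENNReal.ofReal 2 by simp, ← ENNReal.ofReal_mul (by norm_num)]
  apply ENNReal.ofReal_le_ofReal
  simp
  field_simp
  norm_num

/-- The remaining error when the noise is wider than the gap. The error `s` is at most
`n ^ (-1 / 2)` times the Gaussian mass of a window of half-width `h`, and `k` is at least half the
mass of a smaller window, so `t * s / k ≤ C * n ^ (-1 / 2) * exp (2 * |y| / σ) * t`. This is used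
while the exponential is at most `(h / m) ^ (q - s)`; beyond, the Gaussian decay of `s` itself is
used. The loss is the passage from the exponent `q` to an arbitrary `s < q`. -/
theorem exists_lintegral_le_of_gap_le_noise {q s : ℝ} (hs : 1 < s) (hsq : s < q) :
    ∃ C : ℝ, 0 < C ∧ ∀ (n : ℕ) (m h σ : ℝ) (F G : ℝ → ℝ), 1 ≤ n → 0 < m → 8 * m ≤ h → h ≤ σ →
      TailBound m q F → TailBound m q G → Measurable F → Measurable G →
      (∀ x, 0 ≤ F x) → (∀ x, F x ≤ 1) → (∀ x, 0 ≤ G x) → (∀ x, G x ≤ 1) →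
      ∀ (e : ℝ → ℝ≥0∞),
      (∀ y, e y ≤ lsmooth (gaussianNoise σ) (fun x => ENNReal.ofReal (farTail h F G x)) y) →
      (∀ y, e y ≤ lsmooth (gaussianNoise σ) ({x | |x| ≤ h}.indicator
          fun x => ENNReal.ofReal (sampleErr n (farTail (-h) G F x))) y) →
      (∀ y, e y * lsmooth (gaussianNoise σ) (fun x => ENNReal.ofReal (farTail (-h) G F x)) y
        ≤ lsmooth (gaussianNoise σ) (fun x => ENNReal.ofReal (farTail h F G x)) y *
          lsmooth (gaussianNoise σ) ({x | |x| ≤ h}.indicator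
            fun x => ENNReal.ofReal (sampleErr n (farTail (-h) G F x))) y) →
      ∫⁻ y, e y ≤ ENNReal.ofReal (C * (√n)⁻¹ * (m * (h / m) ^ (1 - s))) := by
  -- with this rate, `exp (-l * t) ≤ H ^ (-s) * exp (-t)` as soon as `exp (2 * t) ≥ H ^ (q - s)`
  set l : ℝ := 1 + 2 * s / (q - s) with hl
  set D : ℝ := 2 * Real.exp ((1 + l) ^ 2 / 2) with hD
  have hq1 : 0 < q - 1 := by linarith
  have hδ : 0 < q - s := by linarith
  refine ⟨8 * Real.exp (1 / 2) * (2 * (2 ^ (q - 1) / (q - 1))) + D * 2, by positivity, ?_⟩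
  intro n m h σ F G hn hm hmh hhσ hF hG mF mG F0 F1 G0 G1 e he1 he2 he3
  have hh : 0 < h := by linarith
  have hσ : 0 < σ := by linarith
  have hn' : (0 : ℝ) < n := by exact_mod_cast hn
  set N := gaussianNoise σ with hN
  set H := h / m with hH
  have hH0 : 0 < H := by positivity
  have k0 : ∀ x, 0 ≤ farTail (-h) G F x := farTail_nonneg G0 F1 _
  have k1 : ∀ x, farTail (-h) G F x ≤ 1 := farTail_le_one G1 F0 _
  set t := lsmooth N (fun x => ENNReal.ofReal (farTail h F G x)) with ht
  set w : ℝ := (√n)⁻¹ with hw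
  have hw0 : 0 ≤ w := by positivity
  have hS : ∀ y, lsmooth N ({x | |x| ≤ h}.indicator
      fun x => ENNReal.ofReal (sampleErr n (farTail (-h) G F x))) y
      ≤ ENNReal.ofReal w * N (Icc (y - h) (y + h)) := by
    intro y
    rw [← lsmooth_indicator_window]
    unfold lsmooth
    rw [← lintegral_const_mul' _ _ ENNReal.ofReal_ne_top]
    refine lintegral_mono fun z => ?_
    dsimp only
    by_cases hz : |y - z| ≤ h
    · simp only [indicator, mem_ofPred_eq, hz, if_true, Pi.one_apply, mul_one]
      apply ENNReal.ofReal_le_ofReal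
      refine sampleErr_le_sqrt.trans ?_
      rw [hw, ← Real.sqrt_inv]
      apply Real.sqrt_le_sqrt
      rw [← one_div]
      gcongr
      exact k1 _
    · simp [indicator, hz]
  have hk : ∀ y, N (Icc (y - h / 4) (y + h / 4))
      ≤ 2 * lsmooth N (fun x => ENNReal.ofReal (farTail (-h) G F x)) y := by
    intro y
    rw [← lsmooth_indicator_window]
    unfold lsmooth
    rw [← lintegral_const_mul' _ _ (by simp)]
    refine lintegral_mono fun z => ?_
    dsimp only
    by_cases hz : |y - z| ≤ h / 4
    · simp only [indicator, mem_ofPred_eq, hz, if_true, Pi.one_apply]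
      have := hF.half_le_farTail hm (by linarith) hG hmh hz
      rw [show (2 : ℝ≥0∞) = ENNReal.ofReal 2 by simp, ← ENNReal.ofReal_mul (by norm_num),
        ENNReal.one_le_ofReal]
      linarith
    · simp [indicator, hz]
  have b1 : ∀ y, e y ≤ ENNReal.ofReal (w * (D * (h / σ) * Real.exp (-l * (|y| / σ)))) := by
    intro y
    rw [ENNReal.ofReal_mul hw0]
    exact ((he2 y).trans (hS y)).trans
      (mul_le_mul_right (gaussianNoise_window_le_exp hσ hh hhσ y) _)
  have b2 : ∀ y, e y
      ≤ ENNReal.ofReal (w * (8 * Real.exp (1 / 2) * Real.exp (2 * (|y| / σ)))) * t y := by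
    intro y
    set W := N (Icc (y - h / 4) (y + h / 4)) with hW
    have hW0 : W ≠ 0 := gaussianNoise_window_pos hσ hh hhσ y
    have hW1 : W ≠ ∞ := measure_ne_top _ _
    rw [← ENNReal.mul_le_mul_iff_left hW0 hW1]
    calc e y * W ≤ e y * (2 * lsmooth N (fun x => ENNReal.ofReal (farTail (-h) G F x)) y) := by
          gcongr; exact hk y
      _ = 2 * (e y * lsmooth N (fun x => ENNReal.ofReal (farTail (-h) G F x)) y) := by ring
      _ ≤ 2 * (t y * (ENNReal.ofReal w * (ENNReal.ofReal (4 * Real.exp (1 / 2) *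
            Real.exp (2 * (|y| / σ))) * W))) := by
          gcongr 2 * ?_
          refine (he3 y).trans ?_
          gcongr
          refine (hS y).trans ?_
          gcongr
          exact gaussianNoise_window_ratio hσ hhσ y
      _ = _ := by
          rw [ENNReal.ofReal_mul hw0, show 8 * Real.exp (1 / 2) * Real.exp (2 * (|y| / σ))
            = 2 * (4 * Real.exp (1 / 2) * Real.exp (2 * (|y| / σ))) by ring,
            ENNReal.ofReal_mul (by norm_num : (0 : ℝ) ≤ 2)]
          simp only [ENNReal.ofReal_ofNat]
          ring
  -- `b2` close to the origin, `b1` far out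
  have b3 : ∀ y, e y ≤ ENNReal.ofReal (w * (8 * Real.exp (1 / 2) * H ^ (q - s))) * t y
      + ENNReal.ofReal (w * (D * h * H ^ (-s))) * ENNReal.ofReal (Real.exp (-(|y| / σ)) / σ) := by
    intro y
    rcases le_total (Real.exp (2 * (|y| / σ))) (H ^ (q - s)) with h1 | h1
    · refine (b2 y).trans (le_trans ?_ le_self_add)
      gcongr
    · refine (b1 y).trans (le_trans ?_ le_add_self)
      rw [← ENNReal.ofReal_mul (by positivity)]
      apply ENNReal.ofReal_le_ofReal
      have h2 : Real.exp (-l * (|y| / σ)) ≤ H ^ (-s) * Real.exp (-(|y| / σ)) := by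
        have h3 : Real.exp (-l * (|y| / σ))
            = Real.exp (2 * (|y| / σ)) ^ (-(s / (q - s))) * Real.exp (-(|y| / σ)) := by
          rw [← Real.exp_mul, ← Real.exp_add]
          congr 1
          rw [hl]; ring
        rw [h3]
        gcongr
        calc Real.exp (2 * (|y| / σ)) ^ (-(s / (q - s))) ≤ (H ^ (q - s)) ^ (-(s / (q - s))) :=
              Real.rpow_le_rpow_of_nonpos (by positivity) h1
                (neg_nonpos.2 (div_nonneg (by linarith) hδ.le))
          _ = H ^ (-s) := by
              rw [← Real.rpow_mul hH0.le]
              congr 1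
              field_simp
      calc w * (D * (h / σ) * Real.exp (-l * (|y| / σ)))
          ≤ w * (D * (h / σ) * (H ^ (-s) * Real.exp (-(|y| / σ)))) := by gcongr
        _ = _ := by ring
  have mt : Measurable t := measurable_lsmooth (measurable_farTail mF mG h).ennreal_ofReal
  have ht2 : ∫⁻ y, t y ≤ ENNReal.ofReal (2 * (m * (H / 2) ^ (1 - q) / (q - 1))) := by
    rw [ht, lintegral_lsmooth (measurable_farTail mF mG h).ennreal_ofReal]
    calc ∫⁻ x, ENNReal.ofReal (farTail h F G x)
        ≤ ∫⁻ x, ENNReal.ofReal ((m / (|x| + h / 2)) ^ q) :=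
          lintegral_mono fun x => ENNReal.ofReal_le_ofReal (hF.farTail_le hG (by positivity))
      _ = _ := by
          rw [lintegral_comp_abs_eq (f := fun x => ENNReal.ofReal ((m / (x + h / 2)) ^ q)),
            setLIntegral_Ioi_comp_add (fun r => ENNReal.ofReal ((m / r) ^ q)), zero_add,
            lintegral_Ioi_ofReal_div_rpow hm (by positivity) (by linarith),
            ENNReal.ofReal_mul (by norm_num : (0 : ℝ) ≤ 2), hH, div_right_comm]
          simp
  calc ∫⁻ y, e y ≤ ∫⁻ y, (ENNReal.ofReal (w * (8 * Real.exp (1 / 2) * H ^ (q - s))) * t y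
      + ENNReal.ofReal (w * (D * h * H ^ (-s))) * ENNReal.ofReal (Real.exp (-(|y| / σ)) / σ)) :=
        lintegral_mono b3
    _ = ENNReal.ofReal (w * (8 * Real.exp (1 / 2) * H ^ (q - s))) * (∫⁻ y, t y)
      + ENNReal.ofReal (w * (D * h * H ^ (-s))) *
        ∫⁻ y : ℝ, ENNReal.ofReal (Real.exp (-(|y| / σ)) / σ) := by
        rw [lintegral_add_left (mt.const_mul _), lintegral_const_mul _ mt,
          lintegral_const_mul' _ _ ENNReal.ofReal_ne_top]
    _ ≤ ENNReal.ofReal (w * (8 * Real.exp (1 / 2) * H ^ (q - s))) *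
          ENNReal.ofReal (2 * (m * (H / 2) ^ (1 - q) / (q - 1)))
      + ENNReal.ofReal (w * (D * h * H ^ (-s))) * ENNReal.ofReal 2 := by
        gcongr
        exact lintegral_exp_neg_abs_div_le hσ
    _ = _ := by
        rw [← ENNReal.ofReal_mul (by positivity), ← ENNReal.ofReal_mul (by positivity),
          ← ENNReal.ofReal_add (by positivity) (by positivity)]
        congr 1
        have e1 : h = m * H := by rw [hH]; field_simp
        have e2 : H ^ (q - s) * (H / 2) ^ (1 - q) = 2 ^ (q - 1) * H ^ (1 - s) := by
          rw [Real.div_rpow hH0.le (by norm_num), show (1 - q) = -(q - 1) by ring,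
            Real.rpow_neg (by norm_num : (0 : ℝ) ≤ 2), div_inv_eq_mul, ← mul_assoc,
            ← Real.rpow_add hH0, mul_comm]
          congr 2; ring
        have e3 : H * H ^ (-s) = H ^ (1 - s) := by
          rw [← Real.rpow_one_add' hH0.le (by linarith)]
          congr 1
        rw [e1, ← e3]
        rw [← e3] at e2
        calc _ = w * m * (8 * Real.exp (1 / 2) * (2 / (q - 1)) *
              (H ^ (q - s) * (H / 2) ^ (1 - q)) + D * 2 * (H * H ^ (-s))) := by ring
          _ = _ := by rw [e2]; ring

/-- The bound on the mean error contributed by the scale `r`: the sampling error of the tail, and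
the error of order `n ^ (-1 / 2)` with the worse exponent `s < q`. -/
noncomputable def gapErr (n : ℕ) (m q s r : ℝ) : ℝ := errTail n m q r + (√n)⁻¹ * (m / r) ^ s

theorem measurable_gapErr (n : ℕ) (m q s : ℝ) : Measurable (gapErr n m q s) :=
  (measurable_errTail n m q).add (by fun_prop)

theorem errTail_nonneg (n : ℕ) {m q r : ℝ} (hm : 0 < m) (hr : 0 < r) : 0 ≤ errTail n m q r :=
  sampleErr_nonneg (by positivity)

/-- The mean error at a gap `h` large compared with the scale `m`, whatever the noise level `σ`. -/
theorem exists_lintegral_gapDiff_le {q s : ℝ} (hs : 1 < s) (hsq : s < q) :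
    ∃ C : ℝ, 0 < C ∧ ∀ (n : ℕ) (m h σ : ℝ) (F G : ℝ → ℝ) (Ω : Type*) (_ : MeasurableSpace Ω)
      (P : Measure Ω) (_ : IsProbabilityMeasure P) (Fh Gh : Ω → ℝ → ℝ), 1 ≤ n → 0 < m → 8 * m ≤ h →
      0 ≤ σ → TailBound m q F → TailBound m q G → CdfSample P n F Fh → CdfSample P n G Gh →
      ∫⁻ ω, (∫⁻ y, ENNReal.ofReal (gapDiff (gaussianNoise σ) h F G (Fh ω) (Gh ω) y)) ∂P
        ≤ ENNReal.ofReal C * ∫⁻ r in Ioi (h / 2), ENNReal.ofReal (gapErr n m q s r) := by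
  obtain ⟨C, hC, key⟩ := exists_lintegral_le_of_gap_le_noise hs hsq
  set K : ℝ := max 1 (∫⁻ z, ENNReal.ofReal ((1 + 2 * |z|) ^ q) ∂(gaussianReal 0 1)).toReal with hK
  have hK1 : 1 ≤ K := le_max_left _ _
  have hs1 : 0 < s - 1 := by linarith
  refine ⟨4 + 2 * K + C * (s - 1), by positivity, ?_⟩
  intro n m h σ F G Ω _ P _ Fh Gh hn hm hmh hσ hF hG cF cG
  have hh : 0 < h := by linarith
  obtain ⟨e, he0, he1, he2, he3⟩ := cF.exists_error_bound cG (gaussianNoise σ) h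
  set T := ∫⁻ r in Ioi (h / 2), ENNReal.ofReal (errTail n m q r) with hT
  set T' := ∫⁻ r in Ioi (h / 2), ENNReal.ofReal (gapErr n m q s r) with hT'
  have hTT' : T ≤ T' := by
    apply setLIntegral_mono (measurable_gapErr n m q s).ennreal_ofReal
    intro r hr
    have hr0 : 0 < r := lt_trans (by positivity) (mem_Ioi.1 hr)
    apply ENNReal.ofReal_le_ofReal
    unfold gapErr
    have : 0 ≤ (√n)⁻¹ * (m / r) ^ s := by positivity
    linarith
  have hχ := lintegral_farTail_err_le (n := n) hh hF hG
  have hE : ∫⁻ y, e y ≤ ENNReal.ofReal (2 * K + C * (s - 1)) * T' := by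
    rcases le_total σ h with hσh | hσh
    · calc ∫⁻ y, e y ≤ ENNReal.ofReal (2 * K) * T := by
            refine lintegral_le_of_noise_le_gap hn hm (by linarith) hh hK1 ?_ hF hG cF.meas cG.meas
              cF.le_one cG.nonneg cG.le_one cF.nonneg he1 he2 he3
            refine (lintegral_gaussianNoise_weight_le (by linarith) hσ hh hσh).trans ?_
            rw [ENNReal.le_ofReal_iff_toReal_le
              (lintegral_gaussianReal_weight_ne_top q (by linarith)) (by positivity)]
            exact le_max_right _ _
        _ ≤ _ := by
            gcongr
            have : 0 ≤ C * (s - 1) := by positivity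
            linarith
    · calc ∫⁻ y, e y ≤ ENNReal.ofReal (C * (√n)⁻¹ * (m * (h / m) ^ (1 - s))) :=
            key n m h σ F G hn hm hmh hσh hF hG cF.meas cG.meas cF.nonneg cF.le_one cG.nonneg
              cG.le_one e he1 he2 he3
        _ ≤ ENNReal.ofReal (C * (s - 1)) * ∫⁻ r in Ioi (h / 2),
              ENNReal.ofReal ((√n)⁻¹ * (m / r) ^ s) := by
            simp_rw [ENNReal.ofReal_mul (by positivity : (0 : ℝ) ≤ (√n)⁻¹)]
            rw [lintegral_const_mul' _ _ ENNReal.ofReal_ne_top,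
              lintegral_Ioi_ofReal_div_rpow hm (by positivity) hs,
              ← ENNReal.ofReal_mul (by positivity), ← ENNReal.ofReal_mul (by positivity)]
            apply ENNReal.ofReal_le_ofReal
            have h1 : (h / m) ^ (1 - s) ≤ (h / 2 / m) ^ (1 - s) :=
              Real.rpow_le_rpow_of_nonpos (by positivity) (by gcongr; linarith) (by linarith)
            calc C * (√n)⁻¹ * (m * (h / m) ^ (1 - s))
                ≤ C * (√n)⁻¹ * (m * (h / 2 / m) ^ (1 - s)) := by gcongr
              _ = _ := by field_simp
        _ ≤ _ := by
            gcongr ?_ * ?_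
            · apply ENNReal.ofReal_le_ofReal; linarith
            · apply setLIntegral_mono (measurable_gapErr n m q s).ennreal_ofReal
              intro r hr
              have hr0 : 0 < r := lt_trans (by positivity) (mem_Ioi.1 hr)
              apply ENNReal.ofReal_le_ofReal
              unfold gapErr
              linarith [errTail_nonneg n (q := q) hm hr0]
  calc ∫⁻ ω, (∫⁻ y, ENNReal.ofReal (gapDiff (gaussianNoise σ) h F G (Fh ω) (Gh ω) y)) ∂P
      ≤ 4 * T' + ENNReal.ofReal (2 * K + C * (s - 1)) * T' := by
        refine he0.trans (add_le_add (hχ.trans ?_) hE)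
        gcongr
    _ = _ := by
        rw [← add_mul, show (4 : ℝ≥0∞) = ENNReal.ofReal 4 by simp,
          ← ENNReal.ofReal_add (by norm_num) (by positivity), add_assoc]

/-! ### Small gaps, and the rate -/

theorem CdfSample.lintegral_lintegral_abs_le {Ω : Type*} [MeasurableSpace Ω] {P : Measure Ω}
    [IsProbabilityMeasure P] {n : ℕ} {F : ℝ → ℝ} {Fh : Ω → ℝ → ℝ} {m q : ℝ}
    (cF : CdfSample P n F Fh) (hF : TailBound m q F) (hm : 0 < m) :
    ∫⁻ ω, (∫⁻ x, ENNReal.ofReal |Fh ω x - F x|) ∂P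
      ≤ 2 * (ENNReal.ofReal ((√n)⁻¹ * m) + ∫⁻ r in Ioi m, ENNReal.ofReal (errTail n m q r)) := by
  have hm1 : Measurable (fun w : Ω × ℝ => ENNReal.ofReal |Fh w.1 w.2 - F w.2|) :=
    (cF.meas_hat.sub (cF.meas.comp measurable_snd)).abs.ennreal_ofReal
  rw [lintegral_lintegral_swap (f := fun ω x => ENNReal.ofReal |Fh ω x - F x|) hm1.aemeasurable]
  calc ∫⁻ x, (∫⁻ ω, ENNReal.ofReal |Fh ω x - F x| ∂P)
      ≤ ∫⁻ x, ((Iic m).indicator (fun _ => ENNReal.ofReal (√n)⁻¹) |x|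
          + (Ioi m).indicator (fun x => ENNReal.ofReal (errTail n m q x)) |x|) := by
        refine lintegral_mono fun x => ?_
        by_cases hx : |x| ≤ m
        · refine le_trans ?_ le_self_add
          simp only [indicator, mem_Iic, hx, if_true]
          refine (cF.err x).trans (ENNReal.ofReal_le_ofReal ?_)
          refine sampleErr_le_sqrt.trans ?_
          rw [← Real.sqrt_inv, ← one_div]
          apply Real.sqrt_le_sqrt
          gcongr
          exact cF.le_one x
        · refine le_trans ?_ le_add_self
          have hx' := not_le.1 hx
          simp only [indicator, mem_Ioi, hx', if_true]
          rcases le_total x 0 with h0 | h0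
          · refine (cF.err x).trans (ENNReal.ofReal_le_ofReal (sampleErr_mono ?_))
            have := hF.left |x| (hm.trans hx')
            rwa [abs_of_nonpos h0, neg_neg, ← abs_of_nonpos h0] at this
          · refine (cF.err' x).trans (ENNReal.ofReal_le_ofReal (sampleErr_mono ?_))
            have := hF.right |x| (hm.trans hx')
            rwa [abs_of_nonneg h0] at this ⊢
    _ = _ := by
        have hmi : Measurable fun x : ℝ =>
            (Iic m).indicator (fun _ => ENNReal.ofReal (√n)⁻¹) |x| :=
          (measurable_const.indicator measurableSet_Iic).comp
            (by fun_prop : Measurable fun x : ℝ => |x|)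
        rw [lintegral_add_left hmi,
          lintegral_comp_abs_eq (f := (Iic m).indicator fun _ => ENNReal.ofReal (√n)⁻¹),
          lintegral_comp_abs_eq
            (f := (Ioi m).indicator fun x => ENNReal.ofReal (errTail n m q x)), mul_add]
        congr 2
        · rw [lintegral_indicator measurableSet_Iic, setLIntegral_const,
            Measure.restrict_apply measurableSet_Iic, inter_comm, Ioi_inter_Iic, Real.volume_Ioc,
            sub_zero, ENNReal.ofReal_mul (by positivity)]
        · rw [lintegral_indicator measurableSet_Ioi, Measure.restrict_restrict measurableSet_Ioi,
            inter_eq_left.2 (Ioi_subset_Ioi hm.le)]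

/-- The mean error at an arbitrary gap `h`, by contraction under smoothing and the `L¹` error of
the empirical distribution functions. -/
theorem CdfSample.lintegral_gapDiff_le {Ω : Type*} [MeasurableSpace Ω] {P : Measure Ω}
    [IsProbabilityMeasure P] {n : ℕ} {F G : ℝ → ℝ} {Fh Gh : Ω → ℝ → ℝ} {m q : ℝ}
    (cF : CdfSample P n F Fh) (cG : CdfSample P n G Gh) (hF : TailBound m q F)
    (hG : TailBound m q G) (hm : 0 < m) (N : Measure ℝ) [IsProbabilityMeasure N] (h : ℝ) :
    ∫⁻ ω, (∫⁻ y, ENNReal.ofReal (gapDiff N h F G (Fh ω) (Gh ω) y)) ∂P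
      ≤ 4 * (ENNReal.ofReal ((√n)⁻¹ * m) + ∫⁻ r in Ioi m, ENNReal.ofReal (errTail n m q r)) := by
  have key : ∀ {F : ℝ → ℝ} {Fh : Ω → ℝ → ℝ}, CdfSample P n F Fh → ∀ ω (c : ℝ),
      Measurable (fun y => ENNReal.ofReal |smooth N (Fh ω) (y + c) - smooth N F (y + c)|) ∧
      ∫⁻ y, ENNReal.ofReal |smooth N (Fh ω) (y + c) - smooth N F (y + c)|
        ≤ ∫⁻ x, ENNReal.ofReal |Fh ω x - F x| := by
    intro F Fh cF ω c
    have mFh : Measurable (Fh ω) := cF.meas_hat.comp measurable_prodMk_left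
    have hm := (((measurable_smooth (N := N) mFh).sub
      (measurable_smooth (N := N) cF.meas)).abs).ennreal_ofReal
    refine ⟨hm.comp (measurable_id.add_const c), ?_⟩
    rw [lintegral_add_right_eq_self
      (fun y => ENNReal.ofReal |smooth N (Fh ω) y - smooth N F y|) c,
      ← lintegral_lsmooth (N := N) (f := fun x => ENNReal.ofReal |Fh ω x - F x|)
        ((mFh.sub cF.meas).abs.ennreal_ofReal)]
    refine lintegral_mono fun y => ?_
    refine le_trans (le_of_eq ?_) (ofReal_abs_smooth_le _ y)
    congr 2
    simp only [smooth]
    rw [← integral_sub]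
    · exact integrable_shift mFh (C := 1)
        (fun x => abs_le.2 ⟨by linarith [cF.nonneg_hat ω x], cF.le_one_hat ω x⟩) y
    · exact integrable_shift cF.meas (C := 1)
        (fun x => abs_le.2 ⟨by linarith [cF.nonneg x], cF.le_one x⟩) y
  have mabs : Measurable fun ω => ∫⁻ x, ENNReal.ofReal |Fh ω x - F x| :=
    Measurable.lintegral_prod_right' (f := fun w : Ω × ℝ => ENNReal.ofReal |Fh w.1 w.2 - F w.2|)
      (cF.meas_hat.sub (cF.meas.comp measurable_snd)).abs.ennreal_ofReal
  calc ∫⁻ ω, (∫⁻ y, ENNReal.ofReal (gapDiff N h F G (Fh ω) (Gh ω) y)) ∂P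
      ≤ ∫⁻ ω, ((∫⁻ x, ENNReal.ofReal |Fh ω x - F x|) + ∫⁻ x, ENNReal.ofReal |Gh ω x - G x|) ∂P := by
        refine lintegral_mono fun ω => ?_
        refine le_trans ?_ (add_le_add (key cF ω (-(h / 2))).2 (key cG ω (h / 2)).2)
        rw [← lintegral_add_left (key cF ω (-(h / 2))).1]
        refine lintegral_mono fun y => ?_
        rw [← ENNReal.ofReal_add (abs_nonneg _) (abs_nonneg _)]
        apply ENNReal.ofReal_le_ofReal
        unfold gapDiff
        refine (abs_max_sub_max_le_abs _ _ _).trans ?_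
        rw [sub_sub_sub_comm, sub_eq_add_neg y]
        exact abs_sub _ _
    _ ≤ _ := by
        rw [lintegral_add_left mabs]
        refine (add_le_add (cF.lintegral_lintegral_abs_le hF hm)
          (cG.lintegral_lintegral_abs_le hG hm)).trans (le_of_eq ?_)
        rw [← add_mul]; norm_num

theorem IsGapKernel.lintegral_tail_le {p : ℝ} {κ : Measure ℝ} [SFinite κ] (hκ : IsGapKernel p κ)
    {m : ℝ} (hm : 0 < m) {g : ℝ → ℝ≥0∞} (hg : Measurable g) :
    ∫⁻ h in Ioi (8 * m), (∫⁻ r in Ioi (h / 2), g r) ∂κ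
      ≤ ∫⁻ r in Ioi m, ENNReal.ofReal (p * (2 * r) ^ (p - 1)) * g r := by
  have hS : MeasurableSet {w : ℝ × ℝ | w.1 / 2 < w.2} :=
    measurableSet_lt (by fun_prop) (by fun_prop)
  have hm2 : Measurable (fun w : ℝ × ℝ => (Ioi (w.1 / 2)).indicator g w.2) :=
    (hg.comp measurable_snd).indicator hS
  calc ∫⁻ h in Ioi (8 * m), (∫⁻ r in Ioi (h / 2), g r) ∂κ
      = ∫⁻ h in Ioi (8 * m), (∫⁻ r, (Ioi (h / 2)).indicator g r) ∂κ := by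
        simp_rw [lintegral_indicator measurableSet_Ioi]
    _ = ∫⁻ r, (∫⁻ h in Ioi (8 * m), (Ioi (h / 2)).indicator g r ∂κ) :=
        lintegral_lintegral_swap (f := fun h r => (Ioi (h / 2)).indicator g r) hm2.aemeasurable
    _ ≤ ∫⁻ r, (Ioi m).indicator (fun r => ENNReal.ofReal (p * (2 * r) ^ (p - 1)) * g r) r := by
        refine lintegral_mono fun r => ?_
        have e1 : ∀ h, (Ioi (h / 2)).indicator g r = (Iio (2 * r)).indicator (fun _ => g r) h := by
          intro h
          simp only [indicator, mem_Ioi, mem_Iio]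
          congr 1
          apply propext
          constructor <;> intro _ <;> linarith
        simp_rw [e1]
        rw [lintegral_indicator measurableSet_Iio, setLIntegral_const,
          Measure.restrict_apply measurableSet_Iio]
        by_cases hr : m < r
        · simp only [indicator, mem_Ioi, hr, if_true]
          rw [mul_comm, ← hκ.Iic_of_pos (2 * r) (by linarith)]
          gcongr
          exact fun x hx => mem_Iic.2 (le_of_lt hx.1)
        · have : Iio (2 * r) ∩ Ioi (8 * m) = ∅ := by
            ext x
            simp only [mem_inter_iff, mem_Iio, mem_Ioi, mem_empty_iff_false, iff_false, not_and]
            intro h1 h2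
            have := not_lt.1 hr
            linarith
          simp [this]
    _ = _ := lintegral_indicator measurableSet_Ioi _

theorem rpow_mul_div_rpow {m r a b : ℝ} (hm : 0 < m) (hr : 0 < r) :
    r ^ a * (m / r) ^ b = m ^ a * (m / r) ^ (b - a) := by
  have h1 : r = m * (m / r)⁻¹ := by field_simp
  have h2 : 0 < m / r := by positivity
  conv_lhs => rw [h1]
  rw [Real.mul_rpow hm.le (by positivity), Real.inv_rpow h2.le, ← Real.rpow_neg h2.le, mul_assoc,
    ← h1, ← Real.rpow_add h2]
  congr 2; ring

theorem lintegral_Ioi_rpow_mul_div_rpow {m R a b : ℝ} (hm : 0 < m) (hR : 0 < R) (hab : a + 1 < b) :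
    ∫⁻ r in Ioi (m * R), ENNReal.ofReal (r ^ a * (m / r) ^ b)
      = ENNReal.ofReal (m ^ (a + 1) * R ^ (a + 1 - b) / (b - a - 1)) := by
  have h1 : ∫⁻ r in Ioi (m * R), ENNReal.ofReal (r ^ a * (m / r) ^ b)
      = ∫⁻ r in Ioi (m * R), ENNReal.ofReal (m ^ a) * ENNReal.ofReal ((m / r) ^ (b - a)) := by
    refine setLIntegral_congr_fun measurableSet_Ioi fun r hr => ?_
    have hr0 : 0 < r := lt_trans (by positivity) (mem_Ioi.1 hr)
    rw [rpow_mul_div_rpow hm hr0, ENNReal.ofReal_mul (by positivity)]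
  rw [h1, lintegral_const_mul' _ _ ENNReal.ofReal_ne_top,
    lintegral_Ioi_ofReal_div_rpow hm (by positivity) (by linarith),
    ← ENNReal.ofReal_mul (by positivity), mul_div_cancel_left₀ _ hm.ne', Real.rpow_add_one hm.ne']
  congr 1
  rw [show 1 - (b - a) = a + 1 - b by ring]
  ring

theorem errTail_le_div_rpow (n : ℕ) {m q r : ℝ} (hm : 0 < m) (hr : 0 < r) :
    errTail n m q r ≤ (√n)⁻¹ * (m / r) ^ (q / 2) := by
  unfold errTail
  refine sampleErr_le_sqrt.trans (le_of_eq ?_)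
  rw [Real.sqrt_div (by positivity), div_eq_inv_mul, Real.sqrt_eq_rpow ((m / r) ^ q),
    ← Real.rpow_mul (by positivity)]
  congr 2; ring

theorem inv_sqrt_natCast (n : ℕ) : (√(n : ℝ))⁻¹ = (n : ℝ) ^ (-(1 / 2) : ℝ) := by
  rw [Real.sqrt_eq_rpow, Real.rpow_neg (Nat.cast_nonneg n)]

/-- The parametric rate is dominated by `sampleRate`. At `q = 2 * p` this needs `n ≥ 2`, for the
logarithm vanishes at `n = 1`. -/
theorem exists_inv_sqrt_le_sampleRate {p q : ℝ} (hp : 1 ≤ p) (hpq : p < q) :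
    ∃ C : ℝ, 0 < C ∧ ∀ n : ℕ, 1 ≤ n → (q = 2 * p → 2 ≤ n) → (√n)⁻¹ ≤ C * sampleRate p q n := by
  have hl2 : 0 < Real.log 2 := Real.log_pos (by norm_num)
  have hq : 0 < q := by linarith
  refine ⟨1 + (Real.log 2)⁻¹, by positivity, fun n hn hn2 => ?_⟩
  have hn' : (1 : ℝ) ≤ n := by exact_mod_cast hn
  have c1 : (1 : ℝ) ≤ 1 + (Real.log 2)⁻¹ := by
    have := inv_pos.2 hl2; linarith
  rw [inv_sqrt_natCast]
  have hw : 0 ≤ (n : ℝ) ^ (-(1 / 2) : ℝ) := by positivity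
  unfold sampleRate
  split_ifs with h1 h2
  · exact le_mul_of_one_le_left hw c1
  · have h3 : Real.log 2 ≤ Real.log n :=
      Real.log_le_log (by norm_num) (by exact_mod_cast hn2 h2)
    have h4 : 1 ≤ (1 + (Real.log 2)⁻¹) * Real.log n := by
      calc (1 : ℝ) = (Real.log 2)⁻¹ * Real.log 2 := by field_simp
        _ ≤ _ := by gcongr; linarith
    calc (n : ℝ) ^ (-(1 / 2) : ℝ)
        ≤ (n : ℝ) ^ (-(1 / 2) : ℝ) * ((1 + (Real.log 2)⁻¹) * Real.log n) :=
          le_mul_of_one_le_right hw h4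
      _ = _ := by ring
  · have h5 : (n : ℝ) ^ (-(1 / 2) : ℝ) ≤ (n : ℝ) ^ (-((q - p) / q)) := by
      apply Real.rpow_le_rpow_of_exponent_le hn'
      rw [neg_le_neg_iff, div_le_iff₀ hq]
      linarith [not_lt.1 h1]
    exact h5.trans (le_mul_of_one_le_left (by positivity) c1)

theorem setLIntegral_Ioc_rpow_mul_div_rpow {m R a b : ℝ} (hm : 0 < m) (hR : 1 ≤ R) :
    (b < a + 1 → ∫⁻ r in Ioc m (m * R), ENNReal.ofReal (r ^ a * (m / r) ^ b)
        ≤ ENNReal.ofReal (m ^ (a + 1) * R ^ (a + 1 - b) / (a + 1 - b))) ∧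
    (b = a + 1 → ∫⁻ r in Ioc m (m * R), ENNReal.ofReal (r ^ a * (m / r) ^ b)
        = ENNReal.ofReal (m ^ (a + 1) * Real.log R)) := by
  have hmR : m ≤ m * R := le_mul_of_one_le_right hm.le hR
  have h0 : (0 : ℝ) ∉ uIcc m (m * R) := by
    rw [uIcc_of_le hmR]; intro h; linarith [h.1]
  have e1 : EqOn (fun r : ℝ => r ^ a * (m / r) ^ b) (fun r => m ^ b * r ^ (a - b))
      (Ioc m (m * R)) := by
    intro r hr
    have hr0 : 0 < r := hm.trans hr.1
    dsimp only
    rw [Real.div_rpow hm.le hr0.le, Real.rpow_sub hr0]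
    ring
  have e2 : ∫⁻ r in Ioc m (m * R), ENNReal.ofReal (r ^ a * (m / r) ^ b)
      = ENNReal.ofReal (m ^ b * ∫ r in m..(m * R), r ^ (a - b)) := by
    have hi : IntegrableOn (fun r : ℝ => m ^ b * r ^ (a - b)) (Ioc m (m * R)) :=
      ((intervalIntegrable_iff_integrableOn_Ioc_of_le hmR).1
        (intervalIntegral.intervalIntegrable_rpow (Or.inr h0))).const_mul _
    rw [setLIntegral_congr_fun measurableSet_Ioc (fun r hr => congrArg ENNReal.ofReal (e1 hr)),
      ← ofReal_integral_eq_lintegral_ofReal hi, intervalIntegral.integral_of_le hmR,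
      integral_const_mul]
    filter_upwards [ae_restrict_mem measurableSet_Ioc] with r hr
    have hr0 : 0 < r := hm.trans hr.1
    positivity
  constructor
  · intro hb
    rw [e2, integral_rpow (Or.inl (by linarith))]
    apply ENNReal.ofReal_le_ofReal
    have h3 : 0 < a + 1 - b := by linarith
    rw [Real.mul_rpow hm.le (by linarith), show a - b + 1 = a + 1 - b by ring, ← mul_div_assoc]
    have e3 : m ^ (a + 1) = m ^ b * m ^ (a + 1 - b) := by
      rw [← Real.rpow_add hm]; congr 1; ring
    rw [e3, mul_assoc]
    gcongr
    have : 0 < m ^ (a + 1 - b) := by positivity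
    linarith
  · intro hb
    rw [e2]
    congr 1
    have e4 : ∀ r : ℝ, r ^ (a - b) = r⁻¹ := by
      intro r; rw [hb, show a - (a + 1) = -1 by ring, Real.rpow_neg_one]
    simp_rw [e4]
    rw [integral_inv h0, mul_div_cancel_left₀ _ hm.ne', hb]

/-- The three regimes of the rate: the integrand `r ^ (p - 1) * √((m / r) ^ q / n)` is integrable
at infinity for `q > 2 * p`, and otherwise one cuts at `m * n ^ (1 / q)`, where the standard
deviation meets the trivial bound. -/
theorem exists_lintegral_errTail_le {p q : ℝ} (hp : 1 ≤ p) (hpq : p < q) :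
    ∃ C : ℝ, 0 < C ∧ ∀ (n : ℕ) (m : ℝ), 1 ≤ n → (q = 2 * p → 2 ≤ n) → 0 < m →
      ∫⁻ r in Ioi m, ENNReal.ofReal (r ^ (p - 1) * errTail n m q r)
        ≤ ENNReal.ofReal (C * (m ^ p * sampleRate p q n)) := by
  obtain ⟨C₁, hC₁, hw⟩ := exists_inv_sqrt_le_sampleRate hp hpq
  have hq : 0 < q := by linarith
  have hqp : 0 < q - p := by linarith
  -- the crude bound, used beyond `m * n ^ (1 / q)`
  have far : ∀ (n : ℕ) (m R : ℝ), 0 < m → 0 < R →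
      ∫⁻ r in Ioi (m * R), ENNReal.ofReal (r ^ (p - 1) * errTail n m q r)
        ≤ ENNReal.ofReal (2 * (m ^ p * R ^ (p - q) / (q - p))) := by
    intro n m R hm hR
    calc ∫⁻ r in Ioi (m * R), ENNReal.ofReal (r ^ (p - 1) * errTail n m q r)
        ≤ ∫⁻ r in Ioi (m * R), ENNReal.ofReal 2 * ENNReal.ofReal (r ^ (p - 1) * (m / r) ^ q) := by
          refine setLIntegral_mono (by fun_prop) fun r hr => ?_
          have hr0 : 0 < r := lt_trans (by positivity) (mem_Ioi.1 hr)
          rw [← ENNReal.ofReal_mul (by norm_num)]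
          apply ENNReal.ofReal_le_ofReal
          calc r ^ (p - 1) * errTail n m q r ≤ r ^ (p - 1) * (2 * (m / r) ^ q) := by
                gcongr; exact sampleErr_le_two_mul
            _ = _ := by ring
      _ = _ := by
          rw [lintegral_const_mul' _ _ ENNReal.ofReal_ne_top,
            lintegral_Ioi_rpow_mul_div_rpow hm hR (by linarith), ← ENNReal.ofReal_mul (by norm_num),
            sub_add_cancel, show q - (p - 1) - 1 = q - p by ring]
  -- the bound by the standard deviation
  have near : ∀ (n : ℕ) (m : ℝ) (s : Set ℝ), 0 < m → s ⊆ Ioi m →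
      ∫⁻ r in s, ENNReal.ofReal (r ^ (p - 1) * errTail n m q r)
        ≤ ENNReal.ofReal (√n)⁻¹ * ∫⁻ r in s, ENNReal.ofReal (r ^ (p - 1) * (m / r) ^ (q / 2)) := by
    intro n m s hm hs
    rw [← lintegral_const_mul' _ _ ENNReal.ofReal_ne_top]
    refine setLIntegral_mono (by fun_prop) fun r hr => ?_
    have hr0 : 0 < r := hm.trans (hs hr)
    rw [← ENNReal.ofReal_mul (by positivity)]
    apply ENNReal.ofReal_le_ofReal
    calc r ^ (p - 1) * errTail n m q r ≤ r ^ (p - 1) * ((√n)⁻¹ * (m / r) ^ (q / 2)) := by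
          gcongr; exact errTail_le_div_rpow n hm hr0
      _ = _ := by ring
  have split : ∀ (f : ℝ → ℝ≥0∞) (m R : ℝ), m ≤ R →
      ∫⁻ r in Ioi m, f r ≤ (∫⁻ r in Ioc m R, f r) + ∫⁻ r in Ioi R, f r := by
    intro f m R hR
    rw [← Ioc_union_Ioi_eq_Ioi hR]
    exact lintegral_union_le _ _ _
  have hRn : ∀ n : ℕ, 1 ≤ n → (1 : ℝ) ≤ (n : ℝ) ^ (1 / q) := fun n hn =>
    Real.one_le_rpow (by exact_mod_cast hn) (by positivity)
  rcases lt_trichotomy (2 * p) q with h | h | h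
  · refine ⟨C₁ / (q / 2 - p), div_pos hC₁ (by linarith), fun n m hn hn2 hm => ?_⟩
    refine (near n m (Ioi m) hm subset_rfl).trans ?_
    have h1 := lintegral_Ioi_rpow_mul_div_rpow (a := p - 1) (b := q / 2) hm one_pos (by linarith)
    rw [mul_one] at h1
    rw [h1, ← ENNReal.ofReal_mul (by positivity)]
    apply ENNReal.ofReal_le_ofReal
    rw [Real.one_rpow, mul_one, sub_add_cancel, show q / 2 - (p - 1) - 1 = q / 2 - p by ring]
    have h2 : 0 < q / 2 - p := by linarith
    calc (√n)⁻¹ * (m ^ p / (q / 2 - p)) ≤ (C₁ * sampleRate p q n) * (m ^ p / (q / 2 - p)) := by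
          gcongr; exact hw n hn hn2
      _ = _ := by ring
  · have h' : q = 2 * p := h.symm
    refine ⟨1 / q + 2 * C₁ / (q - p), by positivity, fun n m hn hn2 hm => ?_⟩
    have hn' : (1 : ℝ) ≤ n := by exact_mod_cast hn
    set R : ℝ := (n : ℝ) ^ (1 / q) with hR
    have hR1 : 1 ≤ R := hRn n hn
    have hlog : Real.log R = 1 / q * Real.log n := Real.log_rpow (by linarith) _
    have hR2 : R ^ (p - q) = (√n)⁻¹ := by
      rw [hR, ← Real.rpow_mul (by linarith), inv_sqrt_natCast]
      congr 1; rw [h']; field_simp; ring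
    refine (split _ m (m * R) (le_mul_of_one_le_right hm.le hR1)).trans ?_
    refine (add_le_add (near n m _ hm Ioc_subset_Ioi_self) (far n m R hm (by linarith))).trans ?_
    rw [(setLIntegral_Ioc_rpow_mul_div_rpow hm hR1).2 (by linarith), sub_add_cancel, hlog, hR2,
      ← ENNReal.ofReal_mul (by positivity), ← ENNReal.ofReal_add]
    · apply ENNReal.ofReal_le_ofReal
      have h3 : (√n)⁻¹ * Real.log n = sampleRate p q n := by
        unfold sampleRate
        rw [if_neg (by linarith), if_pos h', inv_sqrt_natCast]
      calc (√n)⁻¹ * (m ^ p * (1 / q * Real.log n)) + 2 * (m ^ p * (√n)⁻¹ / (q - p))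
          = 1 / q * (m ^ p * ((√n)⁻¹ * Real.log n)) + 2 * (m ^ p * (√n)⁻¹ / (q - p)) := by ring
        _ ≤ 1 / q * (m ^ p * sampleRate p q n)
            + 2 * (m ^ p * (C₁ * sampleRate p q n) / (q - p)) := by
            rw [h3]; gcongr; exact hw n hn hn2
        _ = _ := by ring
    · have := Real.log_nonneg hn'
      positivity
    · positivity
  · refine ⟨1 / (p - q / 2) + 2 / (q - p), ?_, fun n m hn _ hm => ?_⟩
    · have : 0 < p - q / 2 := by linarith
      positivity
    have h2 : 0 < p - q / 2 := by linarith
    have hn' : (1 : ℝ) ≤ n := by exact_mod_cast hn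
    have hn0 : (0 : ℝ) < n := by linarith
    set R : ℝ := (n : ℝ) ^ (1 / q) with hR
    have hR1 : 1 ≤ R := hRn n hn
    have hrate : sampleRate p q n = (n : ℝ) ^ (-((q - p) / q)) := by
      unfold sampleRate
      rw [if_neg (by linarith), if_neg (by linarith)]
    have hR2 : R ^ (p - q) = sampleRate p q n := by
      rw [hR, ← Real.rpow_mul hn0.le, hrate]
      congr 1; field_simp; ring
    have hR3 : (√n)⁻¹ * R ^ (p - q / 2) = sampleRate p q n := by
      rw [hR, ← Real.rpow_mul hn0.le, inv_sqrt_natCast, ← Real.rpow_add hn0, hrate]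
      congr 1; field_simp; ring
    refine (split _ m (m * R) (le_mul_of_one_le_right hm.le hR1)).trans ?_
    refine (add_le_add (near n m _ hm Ioc_subset_Ioi_self) (far n m R hm (by linarith))).trans ?_
    have h4 := (setLIntegral_Ioc_rpow_mul_div_rpow (a := p - 1) (b := q / 2) hm hR1).1 (by linarith)
    refine (add_le_add_left (mul_le_mul_right h4 _) _).trans ?_
    rw [sub_add_cancel, hR2, ← ENNReal.ofReal_mul (by positivity), ← ENNReal.ofReal_add]
    · apply ENNReal.ofReal_le_ofReal
      apply le_of_eq
      calc (√n)⁻¹ * (m ^ p * R ^ (p - q / 2) / (p - q / 2))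
            + 2 * (m ^ p * sampleRate p q n / (q - p))
          = m ^ p * ((√n)⁻¹ * R ^ (p - q / 2)) / (p - q / 2)
            + 2 * (m ^ p * sampleRate p q n / (q - p)) := by ring
        _ = _ := by rw [hR3]; ring
    · positivity
    · rw [hrate]; positivity

theorem sampleRate_nonneg (p q : ℝ) {n : ℕ} (hn : 1 ≤ n) : 0 ≤ sampleRate p q n := by
  have := Real.log_nonneg (by exact_mod_cast hn : (1 : ℝ) ≤ n)
  unfold sampleRate
  split_ifs <;> positivity

/-! ### The one-dimensional estimate -/

/-- The one-dimensional estimate: the mean error of the positive part of the smoothed gap,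
integrated against the gap kernel. Gaps below `8 * m` are treated by the crude bound. The constant
does not depend on the noise. -/
theorem exists_lintegral_gap_le {p q : ℝ} (hp : 1 ≤ p) (hpq : p < q) :
    ∃ C : ℝ, 0 < C ∧ ∀ (κ : Measure ℝ) (_ : SFinite κ) (_ : IsGapKernel p κ) (n : ℕ) (m σ : ℝ)
      (F G : ℝ → ℝ) (Ω : Type*) (_ : MeasurableSpace Ω) (P : Measure Ω)
      (_ : IsProbabilityMeasure P) (Fh Gh : Ω → ℝ → ℝ), 1 ≤ n → (q = 2 * p → 2 ≤ n) → 0 < m →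
      0 ≤ σ → TailBound m q F → TailBound m q G → CdfSample P n F Fh → CdfSample P n G Gh →
      ∫⁻ h, (∫⁻ ω, (∫⁻ y, ENNReal.ofReal
          (gapDiff (gaussianNoise σ) h F G (Fh ω) (Gh ω) y)) ∂P) ∂κ
        ≤ ENNReal.ofReal (C * (m ^ p * sampleRate p q n)) := by
  -- any exponent strictly between `p` and `q` would do
  set s : ℝ := (p + q) / 2 with hs
  obtain ⟨C₀, hC₀, hgap⟩ := 
    exists_lintegral_gapDiff_le (q := q) (s := s) (by linarith) (by linarith)
  obtain ⟨C₁, hC₁, hw⟩ := exists_inv_sqrt_le_sampleRate hp hpq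
  obtain ⟨C₂, hC₂, herr⟩ := exists_lintegral_errTail_le hp hpq
  have hsp : 0 < s - p := by linarith
  refine ⟨p * 8 ^ (p - 1) * (4 * (C₁ + C₂)) + C₀ * (p * 2 ^ (p - 1) * (C₂ + C₁ / (s - p))),
    by positivity, ?_⟩
  intro κ _ hκ n m σ F G Ω _ P _ Fh Gh hn hn2 hm hσ hF hG cF cG
  have hr0 : 0 ≤ sampleRate p q n := sampleRate_nonneg p q hn
  have hw' := hw n hn hn2
  have herr' := herr n m hn hn2 hm
  set ρ := m ^ p * sampleRate p q n with hρ
  have hρ0 : 0 ≤ ρ := by positivity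
  have hmp : m ^ (p - 1) * m = m ^ p := by
    rw [Real.rpow_sub_one hm.ne']; field_simp
  have hwm : (√n)⁻¹ * m ^ p ≤ C₁ * ρ := by
    calc (√n)⁻¹ * m ^ p ≤ (C₁ * sampleRate p q n) * m ^ p := by gcongr
      _ = _ := by ring
  -- gaps below the scale `8 * m`
  have small : ∫⁻ h in Iic (8 * m), (∫⁻ ω, (∫⁻ y, ENNReal.ofReal
      (gapDiff (gaussianNoise σ) h F G (Fh ω) (Gh ω) y)) ∂P) ∂κ
      ≤ ENNReal.ofReal (p * 8 ^ (p - 1) * (4 * (C₁ + C₂)) * ρ) := by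
    calc ∫⁻ h in Iic (8 * m), (∫⁻ ω, (∫⁻ y, ENNReal.ofReal
          (gapDiff (gaussianNoise σ) h F G (Fh ω) (Gh ω) y)) ∂P) ∂κ
        ≤ ∫⁻ _ in Iic (8 * m), 4 * (ENNReal.ofReal ((√n)⁻¹ * m)
            + ∫⁻ r in Ioi m, ENNReal.ofReal (errTail n m q r)) ∂κ :=
          lintegral_mono fun h => cF.lintegral_gapDiff_le cG hF hG hm _ h
      _ = 4 * (ENNReal.ofReal ((√n)⁻¹ * m) + ∫⁻ r in Ioi m, ENNReal.ofReal (errTail n m q r))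
            * ENNReal.ofReal (p * (8 * m) ^ (p - 1)) := by
          rw [setLIntegral_const, hκ.Iic_of_pos _ (by positivity)]
      _ = ENNReal.ofReal (4 * (p * 8 ^ (p - 1))) * (ENNReal.ofReal ((√n)⁻¹ * m ^ p)
            + ∫⁻ r in Ioi m, ENNReal.ofReal (m ^ (p - 1) * errTail n m q r)) := by
          simp_rw [ENNReal.ofReal_mul (by positivity : 0 ≤ m ^ (p - 1))]
          rw [lintegral_const_mul' _ _ ENNReal.ofReal_ne_top, ← hmp,
            Real.mul_rpow (by norm_num) hm.le,
            show (√n)⁻¹ * (m ^ (p - 1) * m) = m ^ (p - 1) * ((√n)⁻¹ * m) by ring,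
            ENNReal.ofReal_mul (by positivity : 0 ≤ m ^ (p - 1)), ← mul_add,
            show p * (8 ^ (p - 1) * m ^ (p - 1)) = (p * 8 ^ (p - 1)) * m ^ (p - 1) by ring,
            ENNReal.ofReal_mul (by positivity : 0 ≤ p * 8 ^ (p - 1)),
            ENNReal.ofReal_mul (by norm_num : (0 : ℝ) ≤ 4)]
          simp only [ENNReal.ofReal_ofNat]
          ring
      _ ≤ ENNReal.ofReal (4 * (p * 8 ^ (p - 1))) * (ENNReal.ofReal (C₁ * ρ)
            + ENNReal.ofReal (C₂ * ρ)) := by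
          gcongr
          refine le_trans ?_ herr'
          refine setLIntegral_mono' measurableSet_Ioi fun r hr => ?_
          have hr0 : 0 < r := hm.trans (mem_Ioi.1 hr)
          apply ENNReal.ofReal_le_ofReal
          have h1 : m ^ (p - 1) ≤ r ^ (p - 1) :=
            Real.rpow_le_rpow hm.le (le_of_lt (mem_Ioi.1 hr)) (by linarith)
          exact mul_le_mul_of_nonneg_right h1 (errTail_nonneg n hm hr0)
      _ = _ := by
          rw [← ENNReal.ofReal_add (by positivity) (by positivity),
            ← ENNReal.ofReal_mul (by positivity)]
          congr 1; ring
  -- gaps beyond `8 * m`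
  have large : ∫⁻ h in Ioi (8 * m), (∫⁻ ω, (∫⁻ y, ENNReal.ofReal
      (gapDiff (gaussianNoise σ) h F G (Fh ω) (Gh ω) y)) ∂P) ∂κ
      ≤ ENNReal.ofReal (C₀ * (p * 2 ^ (p - 1) * (C₂ + C₁ / (s - p))) * ρ) := by
    calc ∫⁻ h in Ioi (8 * m), (∫⁻ ω, (∫⁻ y, ENNReal.ofReal
          (gapDiff (gaussianNoise σ) h F G (Fh ω) (Gh ω) y)) ∂P) ∂κ
        ≤ ∫⁻ h in Ioi (8 * m), ENNReal.ofReal C₀ *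
            (∫⁻ r in Ioi (h / 2), ENNReal.ofReal (gapErr n m q s r)) ∂κ :=
          setLIntegral_mono' measurableSet_Ioi fun h hh =>
            hgap n m h σ F G Ω _ P inferInstance Fh Gh hn hm (le_of_lt hh) hσ hF hG cF cG
      _ = ENNReal.ofReal C₀ * ∫⁻ h in Ioi (8 * m),
            (∫⁻ r in Ioi (h / 2), ENNReal.ofReal (gapErr n m q s r)) ∂κ :=
          lintegral_const_mul' _ _ ENNReal.ofReal_ne_top
      _ ≤ ENNReal.ofReal C₀ * ∫⁻ r in Ioi m, ENNReal.ofReal (p * (2 * r) ^ (p - 1)) *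
            ENNReal.ofReal (gapErr n m q s r) := by
          exact mul_le_mul_right
            (hκ.lintegral_tail_le hm (measurable_gapErr n m q s).ennreal_ofReal) _
      _ = ENNReal.ofReal C₀ * ∫⁻ r in Ioi m, ENNReal.ofReal (p * 2 ^ (p - 1)) *
            (ENNReal.ofReal (r ^ (p - 1) * errTail n m q r)
              + ENNReal.ofReal (√n)⁻¹ * ENNReal.ofReal (r ^ (p - 1) * (m / r) ^ s)) := by
          congr 1
          refine setLIntegral_congr_fun measurableSet_Ioi fun r hr => ?_
          have hr0 : 0 < r := hm.trans (mem_Ioi.1 hr)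
          have he := errTail_nonneg n (q := q) hm hr0
          rw [← ENNReal.ofReal_mul (by positivity), ← ENNReal.ofReal_mul (by positivity),
            ← ENNReal.ofReal_add (by positivity) (by positivity),
            ← ENNReal.ofReal_mul (by positivity), Real.mul_rpow (by norm_num) hr0.le]
          congr 1
          unfold gapErr
          ring
      _ ≤ ENNReal.ofReal C₀ * (ENNReal.ofReal (p * 2 ^ (p - 1)) *
            (ENNReal.ofReal (C₂ * ρ) + ENNReal.ofReal (C₁ * ρ / (s - p)))) := by
          gcongr ENNReal.ofReal C₀ * ?_
          rw [lintegral_const_mul' _ _ ENNReal.ofReal_ne_top, lintegral_add_right _ (by fun_prop),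
            lintegral_const_mul' _ _ ENNReal.ofReal_ne_top]
          gcongr
          have h1 := lintegral_Ioi_rpow_mul_div_rpow (a := p - 1) (b := s) hm one_pos (by linarith)
          rw [mul_one, Real.one_rpow, mul_one, sub_add_cancel,
            show s - (p - 1) - 1 = s - p by ring] at h1
          rw [h1, ← ENNReal.ofReal_mul (by positivity), ← mul_div_assoc]
          gcongr
      _ = _ := by
          rw [← ENNReal.ofReal_add (by positivity) (by positivity),
            ← ENNReal.ofReal_mul (by positivity), ← ENNReal.ofReal_mul (by positivity)]
          congr 1; field_simp
  rw [← lintegral_add_compl _ (measurableSet_Iic (a := 8 * m)), compl_Iic, add_mul,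
    ENNReal.ofReal_add (by positivity) (by positivity)]
  exact add_le_add small large

/-! ### Smoothed Wasserstein distances -/

theorem cdf_conv_eq_smooth (α N : Measure ℝ) [IsProbabilityMeasure α] [IsProbabilityMeasure N]
    (y : ℝ) : cdf (α.conv N) y = smooth N (cdf α) y := by
  have h1 : ENNReal.ofReal (cdf (α.conv N) y) = ENNReal.ofReal (smooth N (cdf α) y) := by
    rw [ofReal_smooth (monotone_cdf α).measurable (cdf_nonneg α) (cdf_le_one α), ofReal_cdf,
      ← lintegral_indicator_one measurableSet_Iic,
      Measure.lintegral_conv (measurable_one.indicator measurableSet_Iic)]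
    have hm : Measurable (fun w : ℝ × ℝ => (Iic y).indicator (1 : ℝ → ℝ≥0∞) (w.1 + w.2)) :=
      (measurable_one.indicator measurableSet_Iic).comp (by fun_prop)
    rw [lintegral_lintegral_swap hm.aemeasurable]
    unfold lsmooth
    refine lintegral_congr fun z => ?_
    dsimp only
    rw [ofReal_cdf, ← lintegral_indicator_one measurableSet_Iic]
    refine lintegral_congr fun x => ?_
    simp only [indicator, mem_Iic, le_sub_iff_add_le, Pi.one_apply]
  rwa [ENNReal.ofReal_eq_ofReal_iff (cdf_nonneg _ _) (smooth_nonneg (cdf_nonneg α) _)] at h1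

theorem wassersteinPow_conv_eq {p : ℝ} {κ : Measure ℝ} [SFinite κ] (hp : 1 ≤ p)
    (hκ : IsGapKernel p κ) (α β N : Measure ℝ) [IsProbabilityMeasure α] [IsProbabilityMeasure β]
    [IsProbabilityMeasure N] :
    wassersteinPow p (α.conv N) (β.conv N)
      = gapCost κ (smooth N (cdf α)) (smooth N (cdf β)) := by
  rw [wassersteinPow_eq_gapCost hp hκ]
  congr 1 <;> ext y <;> exact cdf_conv_eq_smooth _ _ y

theorem measurable_gapCost {A : Type*} [MeasurableSpace A] (κ : Measure ℝ) [SFinite κ]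
    {F G : A → ℝ → ℝ} (hF : Measurable (Function.uncurry F))
    (hG : Measurable (Function.uncurry G)) :
    Measurable fun a => gapCost κ (F a) (G a) := by
  unfold gapCost
  have h1 : ∀ {F : A → ℝ → ℝ}, Measurable (Function.uncurry F) →
      Measurable (fun w : (A × ℝ) × ℝ => F w.1.1 (w.2 - w.1.2 / 2)) := fun hF =>
    hF.comp (by fun_prop : Measurable fun w : (A × ℝ) × ℝ => (w.1.1, w.2 - w.1.2 / 2))
  have h2 : ∀ {F : A → ℝ → ℝ}, Measurable (Function.uncurry F) →
      Measurable (fun w : (A × ℝ) × ℝ => F w.1.1 (w.2 + w.1.2 / 2)) := fun hF =>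
    hF.comp (by fun_prop : Measurable fun w : (A × ℝ) × ℝ => (w.1.1, w.2 + w.1.2 / 2))
  exact (((((h1 hF).sub (h2 hG)).ennreal_ofReal).add
    (((h1 hG).sub (h2 hF)).ennreal_ofReal)).lintegral_prod_right').lintegral_prod_right'

theorem measurable_gapDiff {A : Type*} [MeasurableSpace A] (N : Measure ℝ) [IsProbabilityMeasure N]
    {F G F' G' : A → ℝ → ℝ} (hF : Measurable (Function.uncurry F))
    (hG : Measurable (Function.uncurry G)) (hF' : Measurable (Function.uncurry F'))
    (hG' : Measurable (Function.uncurry G')) :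
    Measurable fun w : (A × ℝ) × ℝ =>
      ENNReal.ofReal (gapDiff N w.1.2 (F w.1.1) (G w.1.1) (F' w.1.1) (G' w.1.1) w.2) := by
  have h1 : ∀ {F : A → ℝ → ℝ}, Measurable (Function.uncurry F) →
      Measurable (fun w : (A × ℝ) × ℝ => smooth N (F w.1.1) (w.2 - w.1.2 / 2)) := fun hF =>
    (measurable_smooth_uncurry hF).comp
      (by fun_prop : Measurable fun w : (A × ℝ) × ℝ => (w.1.1, w.2 - w.1.2 / 2))
  have h2 : ∀ {F : A → ℝ → ℝ}, Measurable (Function.uncurry F) →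
      Measurable (fun w : (A × ℝ) × ℝ => smooth N (F w.1.1) (w.2 + w.1.2 / 2)) := fun hF =>
    (measurable_smooth_uncurry hF).comp
      (by fun_prop : Measurable fun w : (A × ℝ) × ℝ => (w.1.1, w.2 + w.1.2 / 2))
  unfold gapDiff
  exact (((((h1 hF').sub (h2 hG')).max measurable_const).sub
    (((h1 hF).sub (h2 hG)).max measurable_const)).abs).ennreal_ofReal

theorem gapDiff_symm (N : Measure ℝ) (h : ℝ) (F G F' G' : ℝ → ℝ) (y : ℝ) :
    gapDiff N h F' G' F G y = gapDiff N h F G F' G' y := abs_sub_comm _ _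

/-- The change of the two integrands of the gap cost of the smoothed functions, integrated. -/
noncomputable def gapDist (κ N : Measure ℝ) (F G F' G' : ℝ → ℝ) : ℝ≥0∞ :=
  ∫⁻ h, (∫⁻ y, (ENNReal.ofReal (gapDiff N h F G F' G' y)
    + ENNReal.ofReal (gapDiff N h G F G' F' y))) ∂κ

theorem gapDist_symm (κ N : Measure ℝ) (F G F' G' : ℝ → ℝ) :
    gapDist κ N F' G' F G = gapDist κ N F G F' G' := by
  unfold gapDist; simp_rw [gapDiff_symm]

theorem measurable_gapDist {A : Type*} [MeasurableSpace A] (κ N : Measure ℝ) [SFinite κ]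
    [IsProbabilityMeasure N]
    {F G F' G' : A → ℝ → ℝ} (hF : Measurable (Function.uncurry F))
    (hG : Measurable (Function.uncurry G)) (hF' : Measurable (Function.uncurry F'))
    (hG' : Measurable (Function.uncurry G')) :
    Measurable fun a => gapDist κ N (F a) (G a) (F' a) (G' a) := by
  have h : Measurable fun w : (A × ℝ) × ℝ =>
      ENNReal.ofReal (gapDiff N w.1.2 (F w.1.1) (G w.1.1) (F' w.1.1) (G' w.1.1) w.2)
        + ENNReal.ofReal (gapDiff N w.1.2 (G w.1.1) (F w.1.1) (G' w.1.1) (F' w.1.1) w.2) :=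
    (measurable_gapDiff N hF hG hF' hG').add (measurable_gapDiff N hG hF hG' hF')
  have h1 := h.lintegral_prod_right' (ν := volume)
  exact h1.lintegral_prod_right' (ν := κ)

theorem gapCost_le_add (κ : Measure ℝ) [SFinite κ] {A B A' B' : ℝ → ℝ} (hA : Measurable A)
    (hB : Measurable B) :
    gapCost κ A' B' ≤ gapCost κ A B + ∫⁻ h, (∫⁻ y,
      (ENNReal.ofReal |max (A' (y - h / 2) - B' (y + h / 2)) 0
          - max (A (y - h / 2) - B (y + h / 2)) 0|
        + ENNReal.ofReal |max (B' (y - h / 2) - A' (y + h / 2)) 0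
          - max (B (y - h / 2) - A (y + h / 2)) 0|)) ∂κ := by
  have key : ∀ a b : ℝ, ENNReal.ofReal a
      ≤ ENNReal.ofReal b + ENNReal.ofReal |max a 0 - max b 0| := by
    intro a b
    have hb : ENNReal.ofReal (max b 0) = ENNReal.ofReal b := by
      rcases le_total b 0 with h | h <;> simp [h, ENNReal.ofReal_of_nonpos]
    rw [← hb, ← ENNReal.ofReal_add (le_max_right _ _) (abs_nonneg _)]
    apply ENNReal.ofReal_le_ofReal
    linarith [le_abs_self (max a 0 - max b 0), le_max_left a 0]
  have mm : Measurable fun w : ℝ × ℝ => ENNReal.ofReal (A (w.2 - w.1 / 2) - B (w.2 + w.1 / 2))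
      + ENNReal.ofReal (B (w.2 - w.1 / 2) - A (w.2 + w.1 / 2)) := by fun_prop
  unfold gapCost
  rw [← lintegral_add_left mm.lintegral_prod_right']
  refine lintegral_mono fun h => ?_
  have mh : Measurable fun y => ENNReal.ofReal (A (y - h / 2) - B (y + h / 2))
      + ENNReal.ofReal (B (y - h / 2) - A (y + h / 2)) := by fun_prop
  dsimp only
  rw [← lintegral_add_left mh]
  refine lintegral_mono fun y => ?_
  dsimp only
  rw [add_add_add_comm]
  exact add_le_add (key _ _) (key _ _)

theorem gapCost_le_add_gapDist (κ N : Measure ℝ) [SFinite κ] [IsProbabilityMeasure N]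
    {F G : ℝ → ℝ} (F' G' : ℝ → ℝ) (hF : Measurable F) (hG : Measurable G) :
    gapCost κ (smooth N F') (smooth N G')
      ≤ gapCost κ (smooth N F) (smooth N G) + gapDist κ N F G F' G' :=
  gapCost_le_add κ (measurable_smooth hF) (measurable_smooth hG)

/-- The independent coupling, with the same noise added to both points. -/
theorem wassersteinPow_conv_le {p : ℝ} (α β N : Measure ℝ)
    [IsProbabilityMeasure α] [IsProbabilityMeasure β] [IsProbabilityMeasure N] :
    wassersteinPow p (α.conv N) (β.conv N) ≤ ∫⁻ a, (∫⁻ b, ‖a - b‖ₑ ^ p ∂β) ∂α := by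
  set T : (ℝ × ℝ) × ℝ → ℝ × ℝ := fun w => (w.1.1 + w.2, w.1.2 + w.2) with hT
  have mT : Measurable T := by fun_prop
  have h1 : ((α.prod β).prod N).map T ∈ couplings (α.conv N) (β.conv N) := by
    constructor
    · rw [Measure.map_map measurable_fst mT]
      have e1 : Prod.fst ∘ T = (fun w : ℝ × ℝ => w.1 + w.2) ∘ Prod.map Prod.fst id := by ext; rfl
      rw [e1, ← Measure.map_map (by fun_prop) (by fun_prop),
        ← Measure.map_prod_map _ _ measurable_fst measurable_id, Measure.map_id,
        Measure.map_fst_prod, measure_univ, one_smul]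
      rfl
    · rw [Measure.map_map measurable_snd mT]
      have e1 : Prod.snd ∘ T = (fun w : ℝ × ℝ => w.1 + w.2) ∘ Prod.map Prod.snd id := by ext; rfl
      rw [e1, ← Measure.map_map (by fun_prop) (by fun_prop),
        ← Measure.map_prod_map _ _ measurable_snd measurable_id, Measure.map_id,
        Measure.map_snd_prod, measure_univ, one_smul]
      rfl
  refine (iInf₂_le _ h1).trans ?_
  rw [lintegral_map (by fun_prop) mT]
  simp only [hT, add_sub_add_right_eq_sub]
  rw [lintegral_prod _ (by fun_prop)]
  simp only [lintegral_const, measure_univ, mul_one]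
  rw [lintegral_prod _ (by fun_prop)]

/-! ### Projections and empirical measures -/

theorem sphereUniform_univ_le_one (d : ℕ) : sphereUniform d univ ≤ 1 := by
  rw [sphereUniform, Measure.smul_apply, smul_eq_mul]
  exact ENNReal.inv_mul_le_one _

instance (d : ℕ) : IsFiniteMeasure (sphereUniform d) :=
  ⟨(sphereUniform_univ_le_one d).trans_lt ENNReal.one_lt_top⟩

instance {d : ℕ} (u : UnitSphere d) (μ : Measure (EuclideanSpace ℝ (Fin d)))
    [IsProbabilityMeasure μ] : IsProbabilityMeasure (radonProj u μ) :=
  Measure.isProbabilityMeasure_map (by fun_prop)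

theorem cdf_radonProj {d : ℕ} (u : UnitSphere d) (μ : Measure (EuclideanSpace ℝ (Fin d)))
    [IsProbabilityMeasure μ] (t : ℝ) : cdf (radonProj u μ) t
      = μ.real {s | inner ℝ (u : EuclideanSpace ℝ (Fin d)) s ≤ t} := by
  rw [cdf_eq_real, radonProj, map_measureReal_apply (by fun_prop) measurableSet_Iic]
  rfl

theorem measurable_cdf_radonProj {d : ℕ} (μ : Measure (EuclideanSpace ℝ (Fin d)))
    [IsProbabilityMeasure μ] :
    Measurable (Function.uncurry fun u : UnitSphere d => (cdf (radonProj u μ) : ℝ → ℝ)) := by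
  have h : MeasurableSet {w : (UnitSphere d × ℝ) × EuclideanSpace ℝ (Fin d) |
      inner ℝ (w.1.1 : EuclideanSpace ℝ (Fin d)) w.2 ≤ w.1.2} :=
    measurableSet_le (by fun_prop) (by fun_prop)
  convert (measurable_measure_prodMk_left (ν := μ) h).ennreal_toReal using 2 with w
  exact cdf_radonProj w.1 μ w.2

theorem abs_inner_unitSphere_le {d : ℕ} (u : UnitSphere d) (s : EuclideanSpace ℝ (Fin d)) :
    |inner ℝ (u : EuclideanSpace ℝ (Fin d)) s| ≤ ‖s‖ := by
  simpa using abs_real_inner_le_norm (u : EuclideanSpace ℝ (Fin d)) s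

theorem tailBound_cdf_radonProj {d : ℕ} {m q : ℝ} (u : UnitSphere d)
    (μ : Measure (EuclideanSpace ℝ (Fin d))) [IsProbabilityMeasure μ] (hm : 0 < m) (hq : 0 < q)
    (hint : Integrable (fun x => ‖x‖ ^ q) μ) (hM : absMoment q μ ≤ m ^ q) :
    TailBound m q (cdf (radonProj u μ)) := by
  have key : ∀ x, 0 < x → ∀ S : Set (EuclideanSpace ℝ (Fin d)), (∀ s ∈ S, x ≤ ‖s‖) →
      μ.real S ≤ (m / x) ^ q := by
    intro x hx S hS
    have h1 := mul_meas_ge_le_integral_of_nonneg (μ := μ) (f := fun s => ‖s‖ ^ q)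
      (Eventually.of_forall fun s => by positivity) hint (x ^ q)
    have h2 : μ.real S ≤ μ.real {s | x ^ q ≤ ‖s‖ ^ q} :=
      measureReal_mono fun s hs => Real.rpow_le_rpow hx.le (hS s hs) hq.le
    rw [Real.div_rpow hm.le hx.le, le_div_iff₀ (by positivity), mul_comm]
    exact (mul_le_mul_of_nonneg_left h2 (by positivity)).trans (h1.trans hM)
  constructor
  · intro x hx
    rw [cdf_radonProj]
    refine key x hx _ fun s hs => ?_
    have := abs_le.1 (abs_inner_unitSphere_le u s)
    have h3 : inner ℝ (u : EuclideanSpace ℝ (Fin d)) s ≤ -x := hs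
    linarith
  · intro x hx
    rw [cdf_radonProj, ← probReal_compl_eq_one_sub (measurableSet_le (by fun_prop) (by fun_prop))]
    refine key x hx _ fun s hs => ?_
    have h3 : ¬ inner ℝ (u : EuclideanSpace ℝ (Fin d)) s ≤ x := hs
    exact (not_le.1 h3).le.trans ((le_abs_self _).trans (abs_inner_unitSphere_le u s))

theorem lintegral_empiricalMeasure {E : Type*} [MeasurableSpace E] {n : ℕ} (x : Fin n → E)
    {f : E → ℝ≥0∞} (hf : Measurable f) :
    ∫⁻ s, f s ∂(empiricalMeasure x) = (n : ℝ≥0∞)⁻¹ * ∑ i, f (x i) := by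
  rw [empiricalMeasure, lintegral_smul_measure, lintegral_finsetSum_measure, smul_eq_mul]
  simp_rw [lintegral_dirac' _ hf]

theorem isProbabilityMeasure_empiricalMeasure {E : Type*} [MeasurableSpace E] {n : ℕ} (hn : 1 ≤ n)
    (x : Fin n → E) : IsProbabilityMeasure (empiricalMeasure x) := by
  constructor
  rw [← lintegral_one, lintegral_empiricalMeasure x measurable_const]
  simp only [Finset.sum_const, Finset.card_univ, Fintype.card_fin, nsmul_eq_mul, mul_one]
  exact ENNReal.inv_mul_cancel (by simp; omega) (by simp)

theorem cdf_radonProj_empiricalMeasure {d n : ℕ} (hn : 1 ≤ n) (u : UnitSphere d)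
    (x : Fin n → EuclideanSpace ℝ (Fin d)) (t : ℝ) :
    cdf (radonProj u (empiricalMeasure x)) t
      = empCdf (fun i => inner ℝ (u : EuclideanSpace ℝ (Fin d)) (x i)) t := by
  have := isProbabilityMeasure_empiricalMeasure hn x
  have hS : MeasurableSet {s : EuclideanSpace ℝ (Fin d) |
    inner ℝ (u : EuclideanSpace ℝ (Fin d)) s ≤ t} :=
    measurableSet_le (by fun_prop) (by fun_prop)
  rw [cdf_radonProj, Measure.real, ← lintegral_indicator_one hS,
    lintegral_empiricalMeasure x (measurable_one.indicator hS), ENNReal.toReal_mul,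
    ENNReal.toReal_inv, ENNReal.toReal_natCast, ENNReal.toReal_sum, empCdf]
  · congr 1
    refine Finset.sum_congr rfl fun i _ => ?_
    by_cases h : inner ℝ (u : EuclideanSpace ℝ (Fin d)) (x i) ≤ t <;> simp [indicator, h]
  · intro i _
    by_cases h : inner ℝ (u : EuclideanSpace ℝ (Fin d)) (x i) ≤ t <;> simp [indicator, h]

/-! ### Finiteness -/

theorem lintegral_enorm_rpow_ne_top {E : Type*} [NormedAddCommGroup E] [MeasurableSpace E]
    [BorelSpace E] {p q : ℝ} (hp : 0 ≤ p) (hpq : p ≤ q) {μ : Measure E} [IsFiniteMeasure μ]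
    (h : Integrable (fun x => ‖x‖ ^ q) μ) : ∫⁻ x, ‖x‖ₑ ^ p ∂μ ≠ ∞ := by
  have h1 : ∫⁻ x, ‖x‖ₑ ^ q ∂μ ≠ ∞ := by
    have := h.2.ne
    convert this using 4 with x
    rw [Real.enorm_eq_ofReal (by positivity), ← ofReal_norm, 
      ENNReal.ofReal_rpow_of_nonneg (norm_nonneg _) (hp.trans hpq)]
  have h2 : ∫⁻ x, ‖x‖ₑ ^ p ∂μ ≤ ∫⁻ x, (1 + ‖x‖ₑ ^ q) ∂μ := by
    refine lintegral_mono fun x => ?_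
    rcases le_total ‖x‖ₑ 1 with hx | hx
    · exact (ENNReal.rpow_le_one hx hp).trans le_self_add
    · exact (ENNReal.rpow_le_rpow_of_exponent_le hx hpq).trans le_add_self
  refine (h2.trans_lt ?_).ne
  rw [lintegral_add_left measurable_const]
  simp [h1.lt_top]

theorem gswdPow_ne_top {d : ℕ} {σ p : ℝ} (hp : 1 ≤ p) {μ ν : Measure (EuclideanSpace ℝ (Fin d))}
    [IsProbabilityMeasure μ] [IsProbabilityMeasure ν] (hμ : ∫⁻ x, ‖x‖ₑ ^ p ∂μ ≠ ∞)
    (hν : ∫⁻ x, ‖x‖ₑ ^ p ∂ν ≠ ∞) : gswdPow σ p μ ν ≠ ∞ := by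
  have hp0 : 0 ≤ p := by linarith
  set B : ℝ≥0∞ := (2 : ℝ≥0∞) ^ (p - 1) * (∫⁻ x, ‖x‖ₑ ^ p ∂μ + ∫⁻ x, ‖x‖ₑ ^ p ∂ν)
  have hB : B ≠ ∞ := ENNReal.mul_ne_top (by simp [ENNReal.rpow_eq_top_iff])
    (ENNReal.add_ne_top.2 ⟨hμ, hν⟩)
  have h1 : gswdPow σ p μ ν ≤ ∫⁻ _, B ∂(sphereUniform d) := by
    refine lintegral_mono fun u => ?_
    refine (wassersteinPow_conv_le _ _ _).trans ?_
    rw [radonProj, lintegral_map (Measurable.lintegral_prod_right' (f := fun w : ℝ × ℝ =>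
      ‖w.1 - w.2‖ₑ ^ p) (by fun_prop)) (by fun_prop)]
    simp_rw [radonProj]
    have h2 : ∀ s, ∫⁻ b, ‖inner ℝ (u : EuclideanSpace ℝ (Fin d)) s - b‖ₑ ^ p
        ∂(ν.map fun s => inner ℝ (u : EuclideanSpace ℝ (Fin d)) s)
        ≤ 2 ^ (p - 1) * (‖s‖ₑ ^ p + ∫⁻ x, ‖x‖ₑ ^ p ∂ν) := by
      intro s
      rw [lintegral_map (by fun_prop) (by fun_prop)]
      calc _ ≤ ∫⁻ t, 2 ^ (p - 1) * (‖s‖ₑ ^ p + ‖t‖ₑ ^ p) ∂ν := by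
            refine lintegral_mono fun t => ?_
            refine le_trans ?_ (ENNReal.rpow_add_le_mul_rpow_add_rpow _ _ hp)
            refine ENNReal.rpow_le_rpow ((enorm_le_iff_norm_le.2 ?_).trans enorm_sub_le) hp0
            rw [← inner_sub_right]
            exact abs_inner_unitSphere_le u _
        _ = _ := by
            rw [lintegral_const_mul _ (by fun_prop), lintegral_add_left (by fun_prop)]
            simp
    refine (lintegral_mono h2).trans ?_
    rw [lintegral_const_mul _ (by fun_prop), lintegral_add_right _ (by fun_prop)]
    simp [B]
  refine (h1.trans_lt ?_).ne
  rw [lintegral_const]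
  exact ENNReal.mul_lt_top hB.lt_top (measure_lt_top _ _)

theorem lintegral_enorm_rpow_empiricalMeasure_ne_top {E : Type*} [NormedAddCommGroup E]
    [MeasurableSpace E] [BorelSpace E] {n : ℕ} (hn : 1 ≤ n) {p : ℝ} (hp : 0 ≤ p)
    (x : Fin n → E) : ∫⁻ s, ‖s‖ₑ ^ p ∂(empiricalMeasure x) ≠ ∞ := by
  rw [lintegral_empiricalMeasure x (by fun_prop)]
  refine ENNReal.mul_ne_top (by simp; omega) (ENNReal.sum_ne_top.2 fun i _ => ?_)
  exact ENNReal.rpow_ne_top_of_nonneg hp (by simp)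

/-! ### The sliced distance of samples -/

theorem lintegral_lintegral_add_swap {Ω : Type*} [MeasurableSpace Ω] (P : Measure Ω) [SFinite P]
    (κ : Measure ℝ) [SFinite κ] {a b : Ω → ℝ → ℝ → ℝ≥0∞}
    (ha : Measurable fun w : (Ω × ℝ) × ℝ => a w.1.1 w.1.2 w.2)
    (hb : Measurable fun w : (Ω × ℝ) × ℝ => b w.1.1 w.1.2 w.2) :
    ∫⁻ ω, (∫⁻ h, (∫⁻ y, (a ω h y + b ω h y)) ∂κ) ∂P
      = (∫⁻ h, (∫⁻ ω, (∫⁻ y, a ω h y) ∂P) ∂κ) + ∫⁻ h, (∫⁻ ω, (∫⁻ y, b ω h y) ∂P) ∂κ := by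
  have ka : Measurable fun w : Ω × ℝ => ∫⁻ y, a w.1 w.2 y := ha.lintegral_prod_right'
  have kb : Measurable fun w : Ω × ℝ => ∫⁻ y, b w.1 w.2 y := hb.lintegral_prod_right'
  have la : Measurable fun ω => ∫⁻ h, (∫⁻ y, a ω h y) ∂κ := ka.lintegral_prod_right'
  rw [← lintegral_lintegral_swap (f := fun ω h => ∫⁻ y, a ω h y) ka.aemeasurable,
    ← lintegral_lintegral_swap (f := fun ω h => ∫⁻ y, b ω h y) kb.aemeasurable,
    ← lintegral_add_left la]
  refine lintegral_congr fun ω => ?_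
  have ka' : Measurable fun h => ∫⁻ y, a ω h y := ka.comp measurable_prodMk_left
  rw [← lintegral_add_left ka']
  refine lintegral_congr fun h => ?_
  have ha' : Measurable fun y => a ω h y := ha.comp (measurable_prodMk_left (x := (ω, h)))
  rw [← lintegral_add_left ha']

theorem exists_lintegral_gapDist_le {p q : ℝ} (hp : 1 ≤ p) (hpq : p < q) :
    ∃ C : ℝ, 0 < C ∧ ∀ (κ : Measure ℝ) (_ : SFinite κ) (_ : IsGapKernel p κ) (n : ℕ) (m σ : ℝ)
      (F G : ℝ → ℝ) (Ω : Type u) (_ : MeasurableSpace Ω) (P : Measure Ω)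
      (_ : IsProbabilityMeasure P) (Fh Gh : Ω → ℝ → ℝ), 1 ≤ n → (q = 2 * p → 2 ≤ n) → 0 < m →
      0 ≤ σ → TailBound m q F → TailBound m q G → CdfSample P n F Fh → CdfSample P n G Gh →
      ∫⁻ ω, gapDist κ (gaussianNoise σ) F G (Fh ω) (Gh ω) ∂P
        ≤ ENNReal.ofReal (C * (m ^ p * sampleRate p q n)) := by
  obtain ⟨C, hC, H⟩ := exists_lintegral_gap_le.{u} hp hpq
  refine ⟨2 * C, by positivity, ?_⟩
  intro κ hs hκ n m σ F G Ω mΩ P hP Fh Gh hn hn2 hm hσ hF hG sF sG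
  have hr := sampleRate_nonneg p q hn
  have hFu : Measurable (Function.uncurry fun _ : Ω => F) := sF.meas.comp measurable_snd
  have hGu : Measurable (Function.uncurry fun _ : Ω => G) := sG.meas.comp measurable_snd
  have e := lintegral_lintegral_add_swap P κ
    (a := fun ω h y => ENNReal.ofReal (gapDiff (gaussianNoise σ) h F G (Fh ω) (Gh ω) y))
    (b := fun ω h y => ENNReal.ofReal (gapDiff (gaussianNoise σ) h G F (Gh ω) (Fh ω) y))
    (measurable_gapDiff (gaussianNoise σ) (F := fun _ => F) (G := fun _ => G) (F' := Fh) (G' := Gh)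
      hFu hGu sF.meas_hat sG.meas_hat)
    (measurable_gapDiff (gaussianNoise σ) (F := fun _ => G) (G := fun _ => F) (F' := Gh) (G' := Fh)
      hGu hFu sG.meas_hat sF.meas_hat)
  refine e.le.trans ?_
  rw [show 2 * C * (m ^ p * sampleRate p q n)
    = C * (m ^ p * sampleRate p q n) + C * (m ^ p * sampleRate p q n) by ring,
    ENNReal.ofReal_add (by positivity) (by positivity)]
  exact add_le_add
    (H κ hs hκ n m σ F G Ω mΩ P hP Fh Gh hn hn2 hm hσ hF hG sF sG)
    (H κ hs hκ n m σ G F Ω mΩ P hP Gh Fh hn hn2 hm hσ hG hF sG sF)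

theorem integral_abs_toReal_sub_le {Ω : Type*} [MeasurableSpace Ω] {P : Measure Ω}
    [IsFiniteMeasure P] {g E : Ω → ℝ≥0∞} {c : ℝ≥0∞} {B : ℝ} (hg : Measurable g)
    (hgt : ∀ ω, g ω ≠ ∞) (hct : c ≠ ∞) (h1 : ∀ ω, g ω ≤ c + E ω) (h2 : ∀ ω, c ≤ g ω + E ω)
    (hB : 0 ≤ B) (hE : ∫⁻ ω, E ω ∂P ≤ ENNReal.ofReal B) :
    Integrable (fun ω => (g ω).toReal) P ∧ ∫ ω, |(g ω).toReal - c.toReal| ∂P ≤ B := by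
  have hm : Measurable fun ω => (g ω).toReal - c.toReal := hg.ennreal_toReal.sub_const _
  have key : ∀ ω, ENNReal.ofReal |(g ω).toReal - c.toReal| ≤ E ω := by
    intro ω
    by_cases hω : E ω = ∞
    · simp [hω]
    refine ENNReal.ofReal_le_of_le_toReal (abs_sub_le_iff.2 ⟨?_, ?_⟩)
    · have := ENNReal.toReal_mono (ENNReal.add_ne_top.2 ⟨hct, hω⟩) (h1 ω)
      rw [ENNReal.toReal_add hct hω] at this
      linarith
    · have := ENNReal.toReal_mono (ENNReal.add_ne_top.2 ⟨hgt ω, hω⟩) (h2 ω)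
      rw [ENNReal.toReal_add (hgt ω) hω] at this
      linarith
  have hI : ∫⁻ ω, ENNReal.ofReal |(g ω).toReal - c.toReal| ∂P ≤ ENNReal.ofReal B :=
    (lintegral_mono key).trans hE
  have hint : Integrable (fun ω => (g ω).toReal - c.toReal) P := by
    refine ⟨hm.aestronglyMeasurable, ?_⟩
    rw [hasFiniteIntegral_iff_norm]
    exact hI.trans_lt ENNReal.ofReal_lt_top
  refine ⟨(hint.add (integrable_const c.toReal)).congr (Eventually.of_forall fun ω => ?_), ?_⟩
  · simp
  rw [integral_eq_lintegral_of_nonneg_ae (Eventually.of_forall fun _ => abs_nonneg _)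
    hm.abs.aestronglyMeasurable]
  exact ENNReal.toReal_le_of_le_ofReal hB hI

theorem measurable_empCdf_inner {d n : ℕ} {Ω : Type*} [MeasurableSpace Ω]
    {X : Fin n → Ω → EuclideanSpace ℝ (Fin d)} (hX : ∀ i, Measurable (X i)) :
    Measurable (Function.uncurry fun w : Ω × UnitSphere d =>
      empCdf fun i => inner ℝ (w.2 : EuclideanSpace ℝ (Fin d)) (X i w.1)) := by
  unfold empCdf
  refine Measurable.const_mul (Finset.measurable_fun_sum _ fun i _ => ?_) _
  have hXi : Measurable fun v : (Ω × UnitSphere d) × ℝ => X i v.1.1 := (hX i).comp (by fun_prop)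
  have hS : MeasurableSet {v : (Ω × UnitSphere d) × ℝ |
      inner ℝ (v.1.2 : EuclideanSpace ℝ (Fin d)) (X i v.1.1) ≤ v.2} :=
    measurableSet_le (by fun_prop) (by fun_prop)
  exact (measurable_one (α := ℝ)).indicator hS

theorem cdfSample_radonProj {d n : ℕ} (hn : 1 ≤ n) {Ω : Type*} [MeasurableSpace Ω] {P : Measure Ω}
    [IsProbabilityMeasure P] {μ : Measure (EuclideanSpace ℝ (Fin d))} [IsProbabilityMeasure μ]
    {X : Fin n → Ω → EuclideanSpace ℝ (Fin d)} (hm : ∀ i, Measurable (X i)) (hX : iIndepFun X P)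
    (hlaw : ∀ i, HasLaw (X i) μ P) (u : UnitSphere d) :
    CdfSample P n (cdf (radonProj u μ))
      (fun ω => empCdf fun i => inner ℝ (u : EuclideanSpace ℝ (Fin d)) (X i ω)) := by
  have mu : Measurable fun s => inner ℝ (u : EuclideanSpace ℝ (Fin d)) s := by fun_prop
  refine cdfSample_empCdf hn (fun i => mu.comp (hm i)) (hX.comp (fun _ => _) fun _ => mu)
    fun i => ⟨(mu.comp (hm i)).aemeasurable, ?_⟩
  rw [radonProj, ← (hlaw i).map_eq, Measure.map_map mu (hm i)]
  rfl

theorem gswdPow_eq_lintegral_gapCost {d : ℕ} {p : ℝ} {κ : Measure ℝ} [SFinite κ] (hp : 1 ≤ p)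
    (hκ : IsGapKernel p κ) (σ : ℝ) (μ ν : Measure (EuclideanSpace ℝ (Fin d)))
    [IsProbabilityMeasure μ] [IsProbabilityMeasure ν] :
    gswdPow σ p μ ν = ∫⁻ u, gapCost κ (smooth (gaussianNoise σ) (cdf (radonProj u μ)))
      (smooth (gaussianNoise σ) (cdf (radonProj u ν))) ∂(sphereUniform d) :=
  lintegral_congr fun _ => wassersteinPow_conv_eq hp hκ _ _ _

theorem measurable_uncurry_comp_snd {A B : Type*} [MeasurableSpace A] [MeasurableSpace B]
    {F : B → ℝ → ℝ} (hF : Measurable (Function.uncurry F)) :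
    Measurable (Function.uncurry fun w : A × B => F w.2) := by
  have h : Measurable fun v : (A × B) × ℝ => (v.1.2, v.2) := by fun_prop
  exact hF.comp h

/-- The sample bound for measurable observations, at any scale `m` whose `q`-th power dominates
both moments. It contains no moment of the noise. -/
theorem exists_gswdPow_sample_bound {p q : ℝ} (hp : 1 ≤ p) (hpq : p < q) :
    ∃ C : ℝ, 0 < C ∧ ∀ (d : ℕ) (σ : ℝ), 0 ≤ σ →
      ∀ (μ ν : Measure (EuclideanSpace ℝ (Fin d))),
        IsProbabilityMeasure μ → IsProbabilityMeasure ν →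
        Integrable (fun x => ‖x‖ ^ q) μ → Integrable (fun x => ‖x‖ ^ q) ν →
      ∀ (n : ℕ), 1 ≤ n → (q = 2 * p → 2 ≤ n) →
      ∀ (Ω : Type u) (_ : MeasurableSpace Ω) (P : Measure Ω), IsProbabilityMeasure P →
      ∀ (X Y : Fin n → Ω → EuclideanSpace ℝ (Fin d)),
        (∀ i, Measurable (X i)) → (∀ i, Measurable (Y i)) → iIndepFun X P → iIndepFun Y P →
        (∀ i, HasLaw (X i) μ P) → (∀ i, HasLaw (Y i) ν P) →
      ∀ m : ℝ, 0 < m → absMoment q μ ≤ m ^ q → absMoment q ν ≤ m ^ q →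
        Integrable (fun ω => (gswdPow σ p (empiricalMeasure (fun i => X i ω))
          (empiricalMeasure (fun i => Y i ω))).toReal) P ∧
        ∫ ω, |(gswdPow σ p (empiricalMeasure (fun i => X i ω))
            (empiricalMeasure (fun i => Y i ω))).toReal - (gswdPow σ p μ ν).toReal| ∂P
          ≤ C * (m ^ p * sampleRate p q n) := by
  obtain ⟨C, hC, H⟩ := exists_lintegral_gapDist_le.{u} hp hpq
  obtain ⟨κ, hs, hκ⟩ := exists_isGapKernel hp
  refine ⟨C, hC, ?_⟩
  intro d σ hσ μ ν hμ hν iμ iν n hn hn2 Ω mΩ P hP X Y mX mY hX hY lX lY m hm hMμ hMν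
  have hp0 : 0 ≤ p := by linarith
  have hr := sampleRate_nonneg p q hn
  set N := gaussianNoise σ
  set Fh : Ω × UnitSphere d → ℝ → ℝ := fun w =>
    empCdf fun i => inner ℝ (w.2 : EuclideanSpace ℝ (Fin d)) (X i w.1) with hFh
  set Gh : Ω × UnitSphere d → ℝ → ℝ := fun w =>
    empCdf fun i => inner ℝ (w.2 : EuclideanSpace ℝ (Fin d)) (Y i w.1) with hGh
  set F : UnitSphere d → ℝ → ℝ := fun u => cdf (radonProj u μ) with hF
  set G : UnitSphere d → ℝ → ℝ := fun u => cdf (radonProj u ν) with hG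
  have mFh : Measurable (Function.uncurry Fh) := measurable_empCdf_inner mX
  have mGh : Measurable (Function.uncurry Gh) := measurable_empCdf_inner mY
  have mF : Measurable (Function.uncurry F) := measurable_cdf_radonProj μ
  have mG : Measurable (Function.uncurry G) := measurable_cdf_radonProj ν
  have prob : ∀ Z : Fin n → Ω → EuclideanSpace ℝ (Fin d), ∀ ω,
      IsProbabilityMeasure (empiricalMeasure fun i => Z i ω) := fun Z ω =>
    isProbabilityMeasure_empiricalMeasure hn _
  have eg : ∀ ω, gswdPow σ p (empiricalMeasure fun i => X i ω) (empiricalMeasure fun i => Y i ω)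
      = ∫⁻ u, gapCost κ (smooth N (Fh (ω, u))) (smooth N (Gh (ω, u))) ∂(sphereUniform d) := by
    intro ω
    have := prob X ω
    have := prob Y ω
    rw [gswdPow_eq_lintegral_gapCost hp hκ]
    refine lintegral_congr fun u => ?_
    congr 2 <;> ext t <;> exact cdf_radonProj_empiricalMeasure hn u _ t
  have e0 := gswdPow_eq_lintegral_gapCost hp hκ σ μ ν
  have mT : Measurable fun w : Ω × UnitSphere d =>
      gapCost κ (smooth N (Fh w)) (smooth N (Gh w)) :=
    measurable_gapCost κ (F := fun w => smooth N (Fh w)) (G := fun w => smooth N (Gh w))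
      (measurable_smooth_uncurry mFh) (measurable_smooth_uncurry mGh)
  have mF2 := measurable_uncurry_comp_snd (A := Ω) mF
  have mG2 := measurable_uncurry_comp_snd (A := Ω) mG
  have mD : Measurable fun w : Ω × UnitSphere d =>
      gapDist κ N (F w.2) (G w.2) (Fh w) (Gh w) :=
    measurable_gapDist κ N (F := fun w : Ω × UnitSphere d => F w.2)
      (G := fun w : Ω × UnitSphere d => G w.2) (F' := Fh) (G' := Gh) mF2 mG2 mFh mGh
  have mDω : ∀ ω, Measurable fun u => gapDist κ N (F u) (G u) (Fh (ω, u)) (Gh (ω, u)) :=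
    fun ω => Measurable.of_uncurry_left
      (f := fun ω u => gapDist κ N (F u) (G u) (Fh (ω, u)) (Gh (ω, u))) mD
  refine integral_abs_toReal_sub_le
    (E := fun ω => ∫⁻ u, gapDist κ N (F u) (G u) (Fh (ω, u)) (Gh (ω, u)) ∂(sphereUniform d))
    ?_ ?_ ?_ ?_ ?_ (by positivity) ?_
  · simp_rw [eg]
    exact mT.lintegral_prod_right'
  · intro ω
    have := prob X ω
    have := prob Y ω
    exact gswdPow_ne_top hp (lintegral_enorm_rpow_empiricalMeasure_ne_top hn hp0 _)
      (lintegral_enorm_rpow_empiricalMeasure_ne_top hn hp0 _)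
  · exact gswdPow_ne_top hp (lintegral_enorm_rpow_ne_top hp0 hpq.le iμ)
      (lintegral_enorm_rpow_ne_top hp0 hpq.le iν)
  · intro ω
    rw [eg, e0, ← lintegral_add_right _ (mDω ω)]
    refine lintegral_mono fun u => ?_
    exact gapCost_le_add_gapDist κ N _ _ (cdfSample_radonProj hn mX hX lX u).meas
      (cdfSample_radonProj hn mY hY lY u).meas
  · intro ω
    rw [eg, e0, ← lintegral_add_right _ (mDω ω)]
    refine lintegral_mono fun u => ?_
    dsimp only
    rw [← gapDist_symm]
    exact gapCost_le_add_gapDist κ N _ _ mFh.of_uncurry_left mGh.of_uncurry_left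
  · rw [lintegral_lintegral_swap (f := fun ω u => gapDist κ N (F u) (G u) (Fh (ω, u)) (Gh (ω, u)))
      mD.aemeasurable]
    calc _ ≤ ∫⁻ _, ENNReal.ofReal (C * (m ^ p * sampleRate p q n)) ∂(sphereUniform d) := by
          refine lintegral_mono fun u => ?_
          exact H κ hs hκ n m σ (F u) (G u) Ω mΩ P hP (fun ω => Fh (ω, u)) (fun ω => Gh (ω, u))
            hn hn2 hm hσ
            (tailBound_cdf_radonProj u μ hm (by linarith) iμ hMμ)
            (tailBound_cdf_radonProj u ν hm (by linarith) iν hMν)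
            (cdfSample_radonProj hn mX hX lX u) (cdfSample_radonProj hn mY hY lY u)
      _ ≤ _ := by
          rw [lintegral_const]
          exact mul_le_of_le_one_right' (sphereUniform_univ_le_one d)

/-! ### Moments -/

/-- At `k = 0` both sides are `1`, as the truncated subtraction gives `0‼`. -/
theorem integral_abs_rpow_gaussianReal (k : ℕ) :
    ∫ x, |x| ^ (2 * (k : ℝ)) ∂(gaussianReal 0 1)
      = ((2 * k - 1).doubleFactorial : ℝ) := by
  rw [integral_gaussianReal_eq_integral_smul one_ne_zero]
  have h1 : ∀ x : ℝ, gaussianPDFReal 0 1 x • |x| ^ (2 * (k : ℝ))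
      = (√(2 * Real.pi))⁻¹ * (|x| ^ (2 * (k : ℝ)) * Real.exp (-(1 / 2) * |x| ^ (2 : ℝ))) := by
    intro x
    simp only [gaussianPDFReal, NNReal.coe_one, mul_one, sub_zero, smul_eq_mul, Real.rpow_two,
      sq_abs]
    rw [show -x ^ 2 / 2 = -(1 / 2) * x ^ 2 by ring]
    ring
  simp_rw [h1]
  rw [integral_const_mul, integral_comp_abs
    (f := fun x => x ^ (2 * (k : ℝ)) * Real.exp (-(1 / 2) * x ^ (2 : ℝ))),
    integral_rpow_mul_exp_neg_mul_rpow two_pos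
      (by linarith [(Nat.cast_nonneg k : (0 : ℝ) ≤ k)]) one_half_pos,
    show (2 * (k : ℝ) + 1) / 2 = k + 1 / 2 by ring, Real.Gamma_nat_add_half,
    show -(2 * (k : ℝ) + 1) / 2 = -(k + 1 / 2) by ring, one_div, Real.inv_rpow two_pos.le,
    Real.rpow_neg two_pos.le, inv_inv, Real.rpow_add two_pos, Real.rpow_natCast,
    Real.sqrt_mul two_pos.le, ← one_div (2 : ℝ), ← Real.sqrt_eq_rpow]
  field_simp

theorem absMoment_gaussianNoise_even {k : ℕ} (hk : k ≠ 0) {σ : ℝ} (hσ : 0 ≤ σ) :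
    absMoment (2 * (k : ℝ)) (gaussianNoise σ)
      = ((2 * k).factorial : ℝ) / (2 ^ k * (k.factorial : ℝ)) * σ ^ (2 * k) := by
  obtain ⟨j, rfl⟩ := Nat.exists_eq_succ_of_ne_zero hk
  have h1 : ∀ z : ℝ, ‖σ * z‖ ^ (2 * ((j.succ : ℕ) : ℝ))
      = σ ^ (2 * j.succ) * |z| ^ (2 * ((j.succ : ℕ) : ℝ)) := by
    intro z
    rw [norm_mul, Real.norm_of_nonneg hσ, Real.norm_eq_abs, Real.mul_rpow hσ (abs_nonneg z),
      ← Real.rpow_natCast σ]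
    push_cast
    rfl
  have h2 : ((2 * j.succ).factorial : ℝ)
      = 2 ^ j.succ * j.succ.factorial * (2 * j.succ - 1).doubleFactorial := by
    have h3 := Nat.factorial_eq_mul_doubleFactorial (2 * j + 1)
    rw [show 2 * j + 1 + 1 = 2 * j.succ by omega, Nat.doubleFactorial_two_mul,
      show 2 * j + 1 = 2 * j.succ - 1 by omega] at h3
    exact_mod_cast h3
  rw [absMoment, gaussianNoise_eq_map, integral_map (by fun_prop)
    (by fun_prop : Measurable fun x : ℝ => ‖x‖ ^ (2 * ((j.succ : ℕ) : ℝ))).aestronglyMeasurable]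
  simp_rw [h1]
  rw [integral_const_mul, integral_abs_rpow_gaussianReal, h2]
  field_simp

theorem absMoment_nonneg {E : Type*} [NormedAddCommGroup E] [MeasurableSpace E] (q : ℝ)
    (μ : Measure E) : 0 ≤ absMoment q μ :=
  integral_nonneg fun _ => by positivity

theorem rpow_le_momentFactor {p q : ℝ} (hp : 1 ≤ p) (hpq : p < q) (σ : ℝ) {M : ℝ} (hM : 0 ≤ M) :
    M ^ (p / q) ≤ momentFactor p q σ M := by
  have h2 : 1 ≤ (2 : ℝ) ^ (p * (q - 1) / q) :=
    Real.one_le_rpow one_le_two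
      (div_nonneg (mul_nonneg (by linarith) (by linarith)) (by linarith))
  have hq : 0 ≤ p / q := div_nonneg (by linarith) (by linarith)
  have hN := absMoment_nonneg q (gaussianNoise σ)
  unfold momentFactor
  split_ifs
  · exact le_mul_of_one_le_left (by positivity) h2
  · exact (Real.rpow_le_rpow hM (by linarith) hq).trans
      (le_mul_of_one_le_left (by positivity) h2)

/-! ### The sample bound -/

/-- The scale `m` is let decrease to `M ^ (1 / q)`, so that measures with vanishing moment are
covered too, and observations that are merely almost everywhere measurable are replaced by
measurable versions. -/
theorem exists_gswdPow_sample_bound_momentFactor {p q : ℝ} (hp : 1 ≤ p) (hpq : p < q) :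
    ∃ C : ℝ, 0 < C ∧ ∀ (d : ℕ) (σ : ℝ), 0 ≤ σ →
      ∀ (μ ν : Measure (EuclideanSpace ℝ (Fin d))),
        IsProbabilityMeasure μ → IsProbabilityMeasure ν →
        Integrable (fun x => ‖x‖ ^ q) μ → Integrable (fun x => ‖x‖ ^ q) ν →
      ∀ (n : ℕ), 1 ≤ n → (q = 2 * p → 2 ≤ n) →
      ∀ (Ω : Type u) (_ : MeasurableSpace Ω) (P : Measure Ω), IsProbabilityMeasure P →
      ∀ (X Y : Fin n → Ω → EuclideanSpace ℝ (Fin d)),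
        iIndepFun X P → iIndepFun Y P → (∀ i, HasLaw (X i) μ P) → (∀ i, HasLaw (Y i) ν P) →
        Integrable (fun ω => (gswdPow σ p (empiricalMeasure (fun i => X i ω))
          (empiricalMeasure (fun i => Y i ω))).toReal) P ∧
        ∫ ω, |(gswdPow σ p (empiricalMeasure (fun i => X i ω))
            (empiricalMeasure (fun i => Y i ω))).toReal - (gswdPow σ p μ ν).toReal| ∂P
          ≤ C * momentFactor p q σ (absMoment q μ + absMoment q ν) * sampleRate p q n := by
  obtain ⟨C, hC, H⟩ := exists_gswdPow_sample_bound.{u} hp hpq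
  refine ⟨C, hC, ?_⟩
  intro d σ hσ μ ν hμ hν iμ iν n hn hn2 Ω mΩ P hP X Y hX hY lX lY
  have hr := sampleRate_nonneg p q hn
  have hq : 0 < q := by linarith
  have hp0 : 0 < p := by linarith
  set X' : Fin n → Ω → EuclideanSpace ℝ (Fin d) := fun i => (lX i).aemeasurable.mk (X i)
  set Y' : Fin n → Ω → EuclideanSpace ℝ (Fin d) := fun i => (lY i).aemeasurable.mk (Y i)
  have eX : ∀ i, X i =ᵐ[P] X' i := fun i => (lX i).aemeasurable.ae_eq_mk
  have eY : ∀ i, Y i =ᵐ[P] Y' i := fun i => (lY i).aemeasurable.ae_eq_mk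
  have eXY : ∀ᵐ ω ∂P, gswdPow σ p (empiricalMeasure fun i => X' i ω)
      (empiricalMeasure fun i => Y' i ω) = gswdPow σ p (empiricalMeasure fun i => X i ω)
      (empiricalMeasure fun i => Y i ω) := by
    filter_upwards [ae_all_iff.2 eX, ae_all_iff.2 eY] with ω h1 h2
    simp_rw [h1, h2]
  set M := absMoment q μ + absMoment q ν
  have hμ0 := absMoment_nonneg q μ
  have hν0 := absMoment_nonneg q ν
  have hM : 0 ≤ M := add_nonneg hμ0 hν0
  have main : ∀ m : ℝ, M ^ (1 / q) < m → _ := fun m hm =>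
    H d σ hσ μ ν hμ hν iμ iν n hn hn2 Ω mΩ P hP X' Y'
      (fun i => (lX i).aemeasurable.measurable_mk) (fun i => (lY i).aemeasurable.measurable_mk)
      (hX.congr eX) (hY.congr eY) (fun i => (lX i).congr (eX i).symm)
      (fun i => (lY i).congr (eY i).symm) m ((by positivity : 0 ≤ M ^ (1 / q)).trans_lt hm)
      (by
        have h1 := Real.rpow_le_rpow (by positivity) hm.le hq.le
        rw [← Real.rpow_mul hM, one_div_mul_cancel hq.ne', Real.rpow_one] at h1
        linarith)
      (by
        have h1 := Real.rpow_le_rpow (by positivity) hm.le hq.le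
        rw [← Real.rpow_mul hM, one_div_mul_cancel hq.ne', Real.rpow_one] at h1
        linarith)
  constructor
  · refine (main (M ^ (1 / q) + 1) (by linarith)).1.congr ?_
    filter_upwards [eXY] with ω h
    rw [h]
  · have hlim : Tendsto (fun m : ℝ => C * (m ^ p * sampleRate p q n)) (𝓝[>] (M ^ (1 / q)))
        (𝓝 (C * ((M ^ (1 / q)) ^ p * sampleRate p q n))) :=
      (((Real.continuous_rpow_const hp0.le).mul_const _).const_mul C).continuousWithinAt
    have h1 := ge_of_tendsto hlim (eventually_nhdsWithin_of_forall fun m hm => (main m hm).2)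
    have h2 : ∫ ω, |(gswdPow σ p (empiricalMeasure (fun i => X i ω))
            (empiricalMeasure (fun i => Y i ω))).toReal - (gswdPow σ p μ ν).toReal| ∂P
        = ∫ ω, |(gswdPow σ p (empiricalMeasure (fun i => X' i ω))
            (empiricalMeasure (fun i => Y' i ω))).toReal - (gswdPow σ p μ ν).toReal| ∂P := by
      refine integral_congr_ae ?_
      filter_upwards [eXY] with ω h
      rw [h]
    rw [h2]
    refine h1.trans ?_
    rw [← Real.rpow_mul hM, one_div_mul_eq_div, mul_assoc]
    gcongr
    exact rpow_le_momentFactor hp hpq σ hM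

end

theorem mainTheorem4 (p q : ℝ) (hp : 1 ≤ p) (hpq : p < q) :
    ∃ C : ℝ, 0 < C ∧
      ∀ (d : ℕ), 1 ≤ d → ∀ (σ : ℝ), 0 ≤ σ →
      ∀ (μ ν : Measure (EuclideanSpace ℝ (Fin d))),
        IsProbabilityMeasure μ → IsProbabilityMeasure ν →
        Integrable (fun x => ‖x‖ ^ q) μ → Integrable (fun x => ‖x‖ ^ q) ν →
      ∀ (n : ℕ), 1 ≤ n → (q = 2 * p → 2 ≤ n) →
      ∀ (Ω : Type*) (_ : MeasurableSpace Ω) (P : Measure Ω), IsProbabilityMeasure P →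
      ∀ (X Y : Fin n → Ω → EuclideanSpace ℝ (Fin d)),
        iIndepFun X P → iIndepFun Y P →
        (∀ i, HasLaw (X i) μ P) → (∀ i, HasLaw (Y i) ν P) →
        gswdPow σ p μ ν ≠ ∞ ∧
        (∀ ω, gswdPow σ p (empiricalMeasure (fun i => X i ω))
          (empiricalMeasure (fun i => Y i ω)) ≠ ∞) ∧
        Integrable (fun ω => (gswdPow σ p (empiricalMeasure (fun i => X i ω))
          (empiricalMeasure (fun i => Y i ω))).toReal) P ∧
        ∫ ω, |(gswdPow σ p (empiricalMeasure (fun i => X i ω))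
            (empiricalMeasure (fun i => Y i ω))).toReal - (gswdPow σ p μ ν).toReal| ∂P
          ≤ 2 * C * momentFactor p q σ (absMoment q μ + absMoment q ν) * sampleRate p q n ∧
        (∀ k : ℕ, q = 2 * (k : ℝ) →
          absMoment q (gaussianNoise σ)
            = ((2 * k).factorial : ℝ) / (2 ^ k * (k.factorial : ℝ)) * σ ^ (2 * k)) := by
  
  obtain ⟨C, hC, H⟩ := exists_gswdPow_sample_bound_momentFactor.{u_1} hp hpq
  have hp0 : 0 ≤ p := by linarith
  refine ⟨C, hC, ?_⟩
  intro d hd σ hσ μ ν hμ hν iμ iν n hn hn2 Ω mΩ P hP X Y hX hY lX lY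
  obtain ⟨h1, h2⟩ := H d σ hσ μ ν hμ hν iμ iν n hn hn2 Ω mΩ P hP X Y hX hY lX lY
  refine ⟨gswdPow_ne_top hp (lintegral_enorm_rpow_ne_top hp0 hpq.le iμ)
    (lintegral_enorm_rpow_ne_top hp0 hpq.le iν), fun ω => ?_, h1, ?_, ?_⟩
  · have := isProbabilityMeasure_empiricalMeasure hn fun i => X i ω
    have := isProbabilityMeasure_empiricalMeasure hn fun i => Y i ω
    exact gswdPow_ne_top hp (lintegral_enorm_rpow_empiricalMeasure_ne_top hn hp0 _)
      (lintegral_enorm_rpow_empiricalMeasure_ne_top hn hp0 _)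
  · refine h2.trans ?_
    have hr := sampleRate_nonneg p q hn
    have hM := add_nonneg (absMoment_nonneg q μ) (absMoment_nonneg q ν)
    have hF := (Real.rpow_nonneg hM _).trans (rpow_le_momentFactor hp hpq σ hM)
    gcongr
    linarith
  · rintro k rfl
    refine absMoment_gaussianNoise_even ?_ hσ
    rintro rfl
    norm_num at hpq
    linarith
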